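/- **Setting.** Let $Y_1,\dots,Y_n$ be independent random vectors, where $Y_i\in\mathbb R^{q_i}$, $q_i\ge 1$, has the elliptical density $|\Sigma_i|^{-1/2}g_i\big((y-\mu_i)^\top\Sigma_i^{-1}(y-\mu_i)\big)$ with location $\mu_i=\mu_i(\theta_1)\in\mathbb R^{q_i}$ and positive definite scale matrix $\Sigma_i=\Sigma_i(\theta_2)$ (nonstochastic covariates are absorbed in the index $i$). Here $\theta=(\theta_1^\top,\theta_2^\top)^\top$, $\theta_j\in\Theta_j\subseteq\mathbb R^{p_j}$ with $\Theta_j$ open, and $\mu_i,\Sigma_i$ are twice differentiable. The known generators $g_i:[0,\infty)\to(0,\infty)$ are differentiable on $(0,\infty)$ and satisfy $\int_{\mathbb R^{q_i}}g_i(x^\top x)\,dx=1$. Put $W_i(u)=\frac{d}{du}\log g_i(u)$ and $\psi_{i(l,k)}=\int_{\mathbb R^{q_i}}W_i(x^\top x)^l(x^\top x)^k g_i(x^\top x)\,dx$, and assume that $\psi_{i(2,1)},\psi_{i(2,2)},\psi_{i(3,2)},\psi_{i(3,3)}$ exist and are finite. Let $\ell(\theta)=\sum_i\{-\frac12\log|\Sigma_i|+\log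 g_i((Y_i-\mu_i)^\top\Sigma_i^{-1}(Y_i-\mu_i))\}$ be the log-likelihood, $U_r=\partial\ell/\partial\theta_r$. Assume that $\ell$ is regular at $\theta$: on a neighbourhood of $\theta$ it is, for almost every value of the data, three times continuously differentiable, and there the quantities $|U_r|$, $|\partial_sU_r|$, $|U_rU_s|$, $|\partial_t\partial_sU_r|$, $|(\partial_sU_r)U_t|$, $|U_rU_sU_t|$, each multiplied by the joint density of the data, are bounded by one Lebesgue-integrable function of the data. The second-order bias of the maximum likelihood estimator $\widehat\theta_j$ is given by the Cox–Snell expression $$B_{\widehat\theta_j}(\theta)=\sum_{r,s,t}\kappa^{j,r}\kappa^{s,t}\Big\{\tfrac12\kappa_{rst}+\kappa_{rs,t}\Big\},$$ where $\kappa_{r,s}=E(U_rU_s)$, $\kappa_{rst}=E(\partial^2U_r/\partial\theta_s\partial\theta_t)$, $\kappa_{rs,t}=E((\partial U_r/\partial\theta_s)U_t)$ and $(\kappa^{r,s})=(\kappa_{r,s})^{-1}$. **Notation.** $\mathrm{vec}$ stacks columns. For each $i$ let $a_{i(r)}=\partial\mu_i/\partial\theta_{1(r)}$, $C_{i(s)}=\partial\Sigma_i/\partial\theta_{2(s)}$,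 $F_{\theta_1(i)}=\partial\mu_i/\partial\theta_1^\top$, $F_{\theta_2(i)}=\partial\,\mathrm{vec}(\Sigma_i)/\partial\theta_2^\top$, $\dot F_{\theta_j(i)}=[\partial F_{\theta_j(i)}/\partial\theta_{j(1)},\dots,\partial F_{\theta_j(i)}/\partial\theta_{j(p_j)}]$, and $$c_i=\tfrac{4\psi_{i(2,2)}}{q_i(q_i+2)},\quad c_i^*=\tfrac{8\psi_{i(3,2)}}{q_i(q_i+2)},\quad \widetilde\omega_i=\tfrac{\psi_{i(3,3)}}{q_i(q_i+2)(q_i+4)},\quad \eta_{1i}=c_i^*+\tfrac{4\psi_{i(2,1)}}{q_i},\quad \eta_{2i}=c_i^*-\tfrac{4\psi_{i(2,1)}}{q_i},$$ $$\widetilde H_{1(i)}=\tfrac{4\psi_{i(2,1)}}{q_i}\Sigma_i^{-1},\qquad \widetilde H_{2(i)}=c_i(2\Sigma_i\otimes\Sigma_i)^{-1}+\tfrac{c_i-1}{4}\mathrm{vec}(\Sigma_i^{-1})\mathrm{vec}(\Sigma_i^{-1})^\top,$$ $$M_i^*=\frac1{c_i}\Big(I_{q_i^2}-\frac{c_i-1}{2c_i+(c_i-1)q_i}\mathrm{vec}(\Sigma_i)\mathrm{vec}(\Sigma_i^{-1})^\top\Big),$$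 $$S_{1i(s)}=\mathrm{vec}(\Sigma_i)\mathrm{vec}(C_{i(s)})^\top+\tfrac12\mathrm{vec}(\Sigma_i)\mathrm{vec}(\Sigma_i)^\top\mathrm{tr}\{C_{i(s)}\Sigma_i^{-1}\},$$ $$S_{2i(s)}=\mathrm{vec}(C_{i(s)})\mathrm{vec}(\Sigma_i)^\top+\mathrm{vec}(\Sigma_i)\mathrm{vec}(C_{i(s)})^\top+4\Sigma_i\otimes C_{i(s)}+\big[\Sigma_i\otimes\Sigma_i+\tfrac12\mathrm{vec}(\Sigma_i)\mathrm{vec}(\Sigma_i)^\top\big]\mathrm{tr}\{C_{i(s)}\Sigma_i^{-1}\},$$ $$Q_{i(s)}^*=\big((c_i-1)S_{1i(s)}+\tfrac12(c_i+8\widetilde\omega_i)S_{2i(s)}\big)(\Sigma_i^{-1}\otimes\Sigma_i^{-1})F_{\theta_2(i)},$$ $$P_{i(r)}^*=\big(2\eta_{2i}(I_{q_i}\otimes a_{i(r)})+\eta_{1i}\mathrm{vec}(\Sigma_i)a_{i(r)}^\top\Sigma_i^{-1}\big)F_{\theta_1(i)},$$ $Q_i^*=[Q_{i(1)}^*,\dots,Q_{i(p_2)}^*]$,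 $P_i^*=[P_{i(1)}^*,\dots,P_{i(p_1)}^*]$. Let $F_{\theta_j}$ be the matrices $F_{\theta_j(i)}$ stacked over $i$, $\widetilde H_j=\mathrm{block\text{-}diag}\{\widetilde H_{j(1)},\dots,\widetilde H_{j(n)}\}$, and let $\xi_j$ be the vectors $\xi_{j(i)}$ stacked over $i$, with $$\xi_{1(i)}=-\tfrac12\dot F_{\theta_1(i)}\,\mathrm{vec}\big((F_{\theta_1}^\top\widetilde H_1F_{\theta_1})^{-1}\big),$$ $$\xi_{2(i)}=\tfrac14M_i^*P_i^*\,\mathrm{vec}\big((F_{\theta_1}^\top\widetilde H_1F_{\theta_1})^{-1}\big)+\tfrac14\big(M_i^*Q_i^*-2\dot F_{\theta_2(i)}\big)\mathrm{vec}\big((F_{\theta_2}^\top\widetilde H_2F_{\theta_2})^{-1}\big).$$ **Corollary 3.1.** If $F=\mathrm{block\text{-}diag}\{F_{\theta_1},F_{\theta_2}\}$ has rank $p_1+p_2$ at $\theta$, then $F_{\theta_1}^\top\widetilde H_1F_{\theta_1}$ and $F_{\theta_2}^\top\widetilde H_2F_{\theta_2}$ are invertible and the second-order bias vectors of $\widehat\theta_1$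 and $\widehat\theta_2$ are $$B_{\widehat\theta_1}(\theta)=(F_{\theta_1}^\top\widetilde H_1F_{\theta_1})^{-1}F_{\theta_1}^\top\widetilde H_1\xi_1,\qquad B_{\widehat\theta_2}(\theta)=(F_{\theta_2}^\top\widetilde H_2F_{\theta_2})^{-1}F_{\theta_2}^\top\widetilde H_2\xi_2 .$$ -/

import Mathlib

open scoped Matrix Kronecker
open MeasureTheory

noncomputable section

namespace EllipticalBias

/-! ### Likelihoods with a finite-dimensional parameter and the Cox–Snell second-order bias -/

/-- The partial derivative `∂h/∂θ_r` at `θ`. -/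
def pderiv {ι : Type*} [Fintype ι] [DecidableEq ι] (r : ι) (h : (ι → ℝ) → ℝ) (θ : ι → ℝ) : ℝ :=
  fderiv ℝ h θ (Pi.single r 1)

/-- `h` is twice (Fréchet) differentiable on the open set `U`. -/
def TwiceDifferentiableOn {ι : Type*} [Fintype ι] (h : (ι → ℝ) → ℝ) (U : Set (ι → ℝ)) : Prop :=
  DifferentiableOn ℝ h U ∧ DifferentiableOn ℝ (fderiv ℝ h) U

section Likelihood

variable {ι : Type*} [Fintype ι] [DecidableEq ι] {Y : Type*} [MeasureSpace Y]

/-- The score component `U_r = ∂ℓ/∂θ_r` of a log-likelihood `ℓ θ y`. -/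
def score (l : (ι → ℝ) → Y → ℝ) (r : ι) (θ : ι → ℝ) (y : Y) : ℝ :=
  pderiv r (fun t => l t y) θ

/-- `U_{rs} = ∂U_r/∂θ_s`. -/
def score2 (l : (ι → ℝ) → Y → ℝ) (r s : ι) (θ : ι → ℝ) (y : Y) : ℝ :=
  pderiv s (fun t => score l r t y) θ

/-- `U_{rst} = ∂²U_r/∂θ_s∂θ_t`. -/
def score3 (l : (ι → ℝ) → Y → ℝ) (r s t : ι) (θ : ι → ℝ) (y : Y) : ℝ :=
  pderiv t (fun τ => score2 l r s τ y) θ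

/-- Regularity of the log-likelihood `l` (with density `f θ`) at `θ₀`: on some neighbourhood of
`θ₀` it is almost surely three times continuously differentiable in the parameter, and the
derivatives of `l` up to order three and their products up to total order three, weighted with
the density, are dominated by one integrable function. -/
def IsRegularAt (f l : (ι → ℝ) → Y → ℝ) (θ₀ : ι → ℝ) : Prop :=
  ∃ N : Set (ι → ℝ), IsOpen N ∧ θ₀ ∈ N ∧ ∃ G : Y → ℝ, Integrable G ∧
    ∀ᵐ y, ContDiffOn ℝ 3 (fun θ => l θ y) N ∧
      ∀ θ ∈ N, ∀ r s t : ι,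
        |score l r θ y| * f θ y ≤ G y ∧
        |score2 l r s θ y| * f θ y ≤ G y ∧
        |score l r θ y * score l s θ y| * f θ y ≤ G y ∧
        |score3 l r s t θ y| * f θ y ≤ G y ∧
        |score2 l r s θ y * score l t θ y| * f θ y ≤ G y ∧
        |score l r θ y * score l s θ y * score l t θ y| * f θ y ≤ G y

/-- `E_θ(h(Y))` when `Y` has density `f θ`. -/
def expect (f : (ι → ℝ) → Y → ℝ) (θ : ι → ℝ) (h : Y → ℝ) : ℝ :=
  ∫ y, h y * f θ y

/-- The Fisher information matrix `K(θ)`, with entries `κ_{r,s} = E(U_r U_s)`. -/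
def fisherInfo (f l : (ι → ℝ) → Y → ℝ) (θ : ι → ℝ) : Matrix ι ι ℝ :=
  Matrix.of fun r s => expect f θ fun y => score l r θ y * score l s θ y

/-- `κ_{rst} = E(∂²U_r/∂θ_s∂θ_t)`. -/
def kappaThree (f l : (ι → ℝ) → Y → ℝ) (θ : ι → ℝ) (r s t : ι) : ℝ :=
  expect f θ fun y => score3 l r s t θ y

/-- `κ_{rs,t} = E((∂U_r/∂θ_s) U_t)`. -/
def kappaTwoOne (f l : (ι → ℝ) → Y → ℝ) (θ : ι → ℝ) (r s t : ι) : ℝ :=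
  expect f θ fun y => score2 l r s θ y * score l t θ y

/-- The `j`-th component of the (Cox–Snell) second-order bias vector of the maximum likelihood
estimator: `∑_{r,s,t} κ^{j,r} κ^{s,t} (κ_{rst} / 2 + κ_{rs,t})`. -/
def secondOrderBias (f l : (ι → ℝ) → Y → ℝ) (θ : ι → ℝ) (j : ι) : ℝ :=
  ∑ r, ∑ s, ∑ t, (fisherInfo f l θ)⁻¹ j r * (fisherInfo f l θ)⁻¹ s t *
    (1 / 2 * kappaThree f l θ r s t + kappaTwoOne f l θ r s t)

end Likelihood

/-! ### Elliptical densities -/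

/-- `u = (y - μ)ᵀ Σ⁻¹ (y - μ)`. -/
def mahal {q : ℕ} (m : Fin q → ℝ) (S : Matrix (Fin q) (Fin q) ℝ) (y : Fin q → ℝ) : ℝ :=
  (y - m) ⬝ᵥ (S⁻¹ *ᵥ (y - m))

/-- The density `|Σ|^{-1/2} g(u)` of `El_q(μ, Σ, g)` with respect to Lebesgue measure. -/
def ellipticalDensity {q : ℕ} (g : ℝ → ℝ) (m : Fin q → ℝ) (S : Matrix (Fin q) (Fin q) ℝ)
    (y : Fin q → ℝ) : ℝ :=
  S.det ^ (-(1 / 2) : ℝ) * g (mahal m S y)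

/-- `W_g(u) = d log g(u) / du`. -/
def W (g : ℝ → ℝ) (u : ℝ) : ℝ := deriv (fun t => Real.log (g t)) u

/-- The integrand of `E(W_g(r)^l r^k)`, where `r = ‖L‖²` and `L ∼ El_q(0, I_q, g)` has density
`g(xᵀx)`. -/
def psiIntegrand (q : ℕ) (g : ℝ → ℝ) (l k : ℕ) (x : Fin q → ℝ) : ℝ :=
  W g (x ⬝ᵥ x) ^ l * (x ⬝ᵥ x) ^ k * g (x ⬝ᵥ x)

/-- `ψ_{(l,k)} = E(W_g(r)^l r^k)`, with `r = ‖L‖²`, `L ∼ El_q(0, I_q, g)`. -/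
def psi (q : ℕ) (g : ℝ → ℝ) (l k : ℕ) : ℝ := ∫ x : Fin q → ℝ, psiIntegrand q g l k x

/-- `g` is the generator of a `q`-dimensional elliptical density, it is positive on `[0,∞)`,
differentiable on `(0,∞)`, and `ψ_{(2,1)}, ψ_{(2,2)}, ψ_{(3,2)}, ψ_{(3,3)}` exist and are
finite. -/
structure IsGenerator (q : ℕ) (g : ℝ → ℝ) : Prop where
  pos : ∀ u, 0 ≤ u → 0 < g u
  diff : ∀ u, 0 < u → DifferentiableAt ℝ g u
  integral_eq_one : ∫ x : Fin q → ℝ, g (x ⬝ᵥ x) = 1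
  psi21 : Integrable (psiIntegrand q g 2 1)
  psi22 : Integrable (psiIntegrand q g 2 2)
  psi32 : Integrable (psiIntegrand q g 3 2)
  psi33 : Integrable (psiIntegrand q g 3 3)

/-- `c = 4 ψ_{(2,2)} / (q (q + 2))`. -/
def cC (q : ℕ) (g : ℝ → ℝ) : ℝ := 4 * psi q g 2 2 / (q * (q + 2))

/-- `c^* = 8 ψ_{(3,2)} / (q (q + 2))`. -/
def cStar (q : ℕ) (g : ℝ → ℝ) : ℝ := 8 * psi q g 3 2 / (q * (q + 2))

/-- `ω̃ = ψ_{(3,3)} / (q (q + 2) (q + 4))`. -/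
def omegaT (q : ℕ) (g : ℝ → ℝ) : ℝ := psi q g 3 3 / (q * (q + 2) * (q + 4))

/-- `η₁ = c^* + 4 ψ_{(2,1)} / q`. -/
def eta1 (q : ℕ) (g : ℝ → ℝ) : ℝ := cStar q g + 4 * psi q g 2 1 / q

/-- `η₂ = c^* - 4 ψ_{(2,1)} / q`. -/
def eta2 (q : ℕ) (g : ℝ → ℝ) : ℝ := cStar q g - 4 * psi q g 2 1 / q

/-! ### The model: independent `Y_i ∼ El_{q_i}(μ_i(θ), Σ_i(θ), g_i)` -/

section Model

variable {n : ℕ} {q : Fin n → ℕ} {ι : Type*}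

/-- The joint density of the independent responses `Y_1, …, Y_n`. -/
def jointDensity (g : Fin n → ℝ → ℝ) (μ : ∀ i, (ι → ℝ) → Fin (q i) → ℝ)
    (S : ∀ i, (ι → ℝ) → Matrix (Fin (q i)) (Fin (q i)) ℝ)
    (θ : ι → ℝ) (y : ∀ i, Fin (q i) → ℝ) : ℝ :=
  ∏ i, ellipticalDensity (g i) (μ i θ) (S i θ) (y i)

/-- The log-likelihood `ℓ(θ) = ∑_i (-½ log |Σ_i| + log g_i(u_i))`. -/
def logLik (g : Fin n → ℝ → ℝ) (μ : ∀ i, (ι → ℝ) → Fin (q i) → ℝ)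
    (S : ∀ i, (ι → ℝ) → Matrix (Fin (q i)) (Fin (q i)) ℝ)
    (θ : ι → ℝ) (y : ∀ i, Fin (q i) → ℝ) : ℝ :=
  ∑ i, (-(1 / 2) * Real.log (S i θ).det + Real.log (g i (mahal (μ i θ) (S i θ) (y i))))

end Model

/-! ### Matrices attached to one observation

`Matrix.vec A` is indexed by pairs (column, row), which matches the Kronecker product: it is the
vector obtained by stacking the columns of `A`. -/

section Blocks

variable {q p : ℕ}

/-- The Jacobian `∂m/∂θᵀ`. -/
def locJac (m : (Fin p → ℝ) → Fin q → ℝ) (θ : Fin p → ℝ) : Matrix (Fin q) (Fin p) ℝ :=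
  Matrix.of fun a r => pderiv r (fun t => m t a) θ

/-- `a_{(r)} = ∂m/∂θ_r`. -/
def locDeriv (m : (Fin p → ℝ) → Fin q → ℝ) (θ : Fin p → ℝ) (r : Fin p) : Fin q → ℝ :=
  fun a => pderiv r (fun t => m t a) θ

/-- `C_{(s)} = ∂S/∂θ_s`. -/
def scaleDeriv (S : (Fin p → ℝ) → Matrix (Fin q) (Fin q) ℝ) (θ : Fin p → ℝ) (s : Fin p) :
    Matrix (Fin q) (Fin q) ℝ :=
  Matrix.of fun a b => pderiv s (fun t => S t a b) θ

/-- The Jacobian `∂ vec(S)/∂θᵀ`. -/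
def scaleJac (S : (Fin p → ℝ) → Matrix (Fin q) (Fin q) ℝ) (θ : Fin p → ℝ) :
    Matrix (Fin q × Fin q) (Fin p) ℝ :=
  Matrix.of fun k s => pderiv s (fun t => Matrix.vec (S t) k) θ

/-- `Ḟ = [∂F/∂θ_1, …, ∂F/∂θ_p]` for a matrix-valued function `F` with `p` columns; the column
`(r, s)` is the `s`-th column of `∂F/∂θ_r`. -/
def dotJac {k : Type*} (F : (Fin p → ℝ) → Matrix k (Fin p) ℝ) (θ : Fin p → ℝ) :
    Matrix k (Fin p × Fin p) ℝ :=
  Matrix.of fun a rs => pderiv rs.1 (fun t => F t a rs.2) θ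

/-- The matrix `[M_1, …, M_p]` made of `p` blocks side by side. -/
def hcat {k : Type*} (M : Fin p → Matrix k (Fin p) ℝ) : Matrix k (Fin p × Fin p) ℝ :=
  Matrix.of fun a rs => M rs.1 a rs.2

/-- The matrix `v wᵀ`. -/
def outer {k l : Type*} (v : k → ℝ) (w : l → ℝ) : Matrix k l ℝ := Matrix.vecMulVec v w

/-- `I_q ⊗ a` for a column vector `a`. -/
def idKronCol (a : Fin q → ℝ) : Matrix (Fin q × Fin q) (Fin q) ℝ :=
  ((1 : Matrix (Fin q) (Fin q) ℝ) ⊗ₖ Matrix.replicateCol Unit a).submatrix id (fun j => (j, ()))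

/-- `H̃_{1(i)} = (4 ψ_{(2,1)} / q) Σ⁻¹`. -/
def Ht1 (g : ℝ → ℝ) (S : Matrix (Fin q) (Fin q) ℝ) : Matrix (Fin q) (Fin q) ℝ :=
  (4 * psi q g 2 1 / q) • S⁻¹

/-- `H̃_{2(i)} = c (2 Σ ⊗ Σ)⁻¹ + ((c - 1) / 4) vec(Σ⁻¹) vec(Σ⁻¹)ᵀ`. -/
def Ht2 (g : ℝ → ℝ) (S : Matrix (Fin q) (Fin q) ℝ) :
    Matrix (Fin q × Fin q) (Fin q × Fin q) ℝ :=
  cC q g • ((2 : ℝ) • (S ⊗ₖ S))⁻¹ + ((cC q g - 1) / 4) • outer (S⁻¹).vec (S⁻¹).vec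

/-- `M^* = (1/c) (I - ((c - 1) / (2 c + (c - 1) q)) vec(Σ) vec(Σ⁻¹)ᵀ)`. -/
def Mstar (g : ℝ → ℝ) (S : Matrix (Fin q) (Fin q) ℝ) :
    Matrix (Fin q × Fin q) (Fin q × Fin q) ℝ :=
  (1 / cC q g) • (1 - ((cC q g - 1) / (2 * cC q g + (cC q g - 1) * q)) • outer S.vec (S⁻¹).vec)

/-- `S₁ = vec(Σ) vec(C)ᵀ + ½ tr(C Σ⁻¹) vec(Σ) vec(Σ)ᵀ`. -/
def S1 (S C : Matrix (Fin q) (Fin q) ℝ) : Matrix (Fin q × Fin q) (Fin q × Fin q) ℝ :=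
  outer S.vec C.vec + (1 / 2 * (C * S⁻¹).trace) • outer S.vec S.vec

/-- `S₂ = vec(C) vec(Σ)ᵀ + vec(Σ) vec(C)ᵀ + 4 Σ ⊗ C + tr(C Σ⁻¹) (Σ ⊗ Σ + ½ vec(Σ) vec(Σ)ᵀ)`. -/
def S2 (S C : Matrix (Fin q) (Fin q) ℝ) : Matrix (Fin q × Fin q) (Fin q × Fin q) ℝ :=
  outer C.vec S.vec + outer S.vec C.vec + (4 : ℝ) • (S ⊗ₖ C) +
    (C * S⁻¹).trace • (S ⊗ₖ S + (1 / 2 : ℝ) • outer S.vec S.vec)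

/-- `Q^*_{(s)} = ((c - 1) S₁ + ½ (c + 8 ω̃) S₂) (Σ⁻¹ ⊗ Σ⁻¹) F_{θ₂}`, with `C = C_{(s)}`. -/
def Qstar (g : ℝ → ℝ) (S C : Matrix (Fin q) (Fin q) ℝ) (F2 : Matrix (Fin q × Fin q) (Fin p) ℝ) :
    Matrix (Fin q × Fin q) (Fin p) ℝ :=
  ((cC q g - 1) • S1 S C + (1 / 2 * (cC q g + 8 * omegaT q g)) • S2 S C) * (S⁻¹ ⊗ₖ S⁻¹) * F2

/-- `P^*_{(r)} = (2 η₂ (I ⊗ a) + η₁ vec(Σ) aᵀ Σ⁻¹) F_{θ₁}`, with `a = a_{(r)}`. -/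
def Pstar (g : ℝ → ℝ) (S : Matrix (Fin q) (Fin q) ℝ) (a : Fin q → ℝ)
    (F1 : Matrix (Fin q) (Fin p) ℝ) : Matrix (Fin q × Fin q) (Fin p) ℝ :=
  ((2 * eta2 q g) • idKronCol a + eta1 q g • (outer S.vec a * S⁻¹)) * F1

end Blocks

/-! ### Quantities of the whole sample, with `μ_i = μ_i(θ₁)` and `Σ_i = Σ_i(θ₂)` -/

section Sample

variable {n p₁ p₂ : ℕ} {q : Fin n → ℕ}

/-- `F_{θ₁}`: the Jacobians of the `μ_i` stacked on top of each other. -/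
def F1 (μ : ∀ i, (Fin p₁ → ℝ) → Fin (q i) → ℝ) (θ₁ : Fin p₁ → ℝ) :
    Matrix (Σ i, Fin (q i)) (Fin p₁) ℝ :=
  Matrix.of fun k r => locJac (μ k.1) θ₁ k.2 r

/-- `F_{θ₂}`: the Jacobians of the `vec(Σ_i)` stacked on top of each other. -/
def F2 (S : ∀ i, (Fin p₂ → ℝ) → Matrix (Fin (q i)) (Fin (q i)) ℝ) (θ₂ : Fin p₂ → ℝ) :
    Matrix (Σ i, Fin (q i) × Fin (q i)) (Fin p₂) ℝ :=
  Matrix.of fun k s => scaleJac (S k.1) θ₂ k.2 s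

/-- `H̃₁ = block-diag(H̃_{1(1)}, …, H̃_{1(n)})`. -/
def H1 (g : Fin n → ℝ → ℝ) (S : ∀ i, (Fin p₂ → ℝ) → Matrix (Fin (q i)) (Fin (q i)) ℝ)
    (θ₂ : Fin p₂ → ℝ) : Matrix (Σ i, Fin (q i)) (Σ i, Fin (q i)) ℝ :=
  Matrix.blockDiagonal' fun i => Ht1 (g i) (S i θ₂)

/-- `H̃₂ = block-diag(H̃_{2(1)}, …, H̃_{2(n)})`. -/
def H2 (g : Fin n → ℝ → ℝ) (S : ∀ i, (Fin p₂ → ℝ) → Matrix (Fin (q i)) (Fin (q i)) ℝ)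
    (θ₂ : Fin p₂ → ℝ) :
    Matrix (Σ i, Fin (q i) × Fin (q i)) (Σ i, Fin (q i) × Fin (q i)) ℝ :=
  Matrix.blockDiagonal' fun i => Ht2 (g i) (S i θ₂)

/-- `K₁ = F_{θ₁}ᵀ H̃₁ F_{θ₁}`. -/
def K1 (g : Fin n → ℝ → ℝ) (μ : ∀ i, (Fin p₁ → ℝ) → Fin (q i) → ℝ)
    (S : ∀ i, (Fin p₂ → ℝ) → Matrix (Fin (q i)) (Fin (q i)) ℝ)
    (θ₁ : Fin p₁ → ℝ) (θ₂ : Fin p₂ → ℝ) : Matrix (Fin p₁) (Fin p₁) ℝ :=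
  (F1 μ θ₁)ᵀ * H1 g S θ₂ * F1 μ θ₁

/-- `K₂ = F_{θ₂}ᵀ H̃₂ F_{θ₂}`. -/
def K2 (g : Fin n → ℝ → ℝ) (S : ∀ i, (Fin p₂ → ℝ) → Matrix (Fin (q i)) (Fin (q i)) ℝ)
    (θ₂ : Fin p₂ → ℝ) : Matrix (Fin p₂) (Fin p₂) ℝ :=
  (F2 S θ₂)ᵀ * H2 g S θ₂ * F2 S θ₂

/-- `ξ₁`, with blocks `ξ_{1(i)} = -½ Ḟ_{θ₁(i)} vec(K₁⁻¹)`. -/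
def xi1 (g : Fin n → ℝ → ℝ) (μ : ∀ i, (Fin p₁ → ℝ) → Fin (q i) → ℝ)
    (S : ∀ i, (Fin p₂ → ℝ) → Matrix (Fin (q i)) (Fin (q i)) ℝ)
    (θ₁ : Fin p₁ → ℝ) (θ₂ : Fin p₂ → ℝ) : (Σ i, Fin (q i)) → ℝ :=
  fun k => ((-(1 / 2) : ℝ) •
    (dotJac (locJac (μ k.1)) θ₁ *ᵥ ((K1 g μ S θ₁ θ₂)⁻¹).vec)) k.2

/-- `ξ₂`, with blocks
`ξ_{2(i)} = ¼ M_i^* P_i^* vec(K₁⁻¹) + ¼ (M_i^* Q_i^* - 2 Ḟ_{θ₂(i)}) vec(K₂⁻¹)`. -/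
def xi2 (g : Fin n → ℝ → ℝ) (μ : ∀ i, (Fin p₁ → ℝ) → Fin (q i) → ℝ)
    (S : ∀ i, (Fin p₂ → ℝ) → Matrix (Fin (q i)) (Fin (q i)) ℝ)
    (θ₁ : Fin p₁ → ℝ) (θ₂ : Fin p₂ → ℝ) : (Σ i, Fin (q i) × Fin (q i)) → ℝ :=
  fun k =>
    ((1 / 4 : ℝ) • ((Mstar (g k.1) (S k.1 θ₂) *
        hcat fun r => Pstar (g k.1) (S k.1 θ₂) (locDeriv (μ k.1) θ₁ r) (locJac (μ k.1) θ₁)) *ᵥ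
          ((K1 g μ S θ₁ θ₂)⁻¹).vec) +
      (1 / 4 : ℝ) • ((Mstar (g k.1) (S k.1 θ₂) *
        (hcat fun s => Qstar (g k.1) (S k.1 θ₂) (scaleDeriv (S k.1) θ₂ s) (scaleJac (S k.1) θ₂)) -
          (2 : ℝ) • dotJac (scaleJac (S k.1)) θ₂) *ᵥ ((K2 g S θ₂)⁻¹).vec)) k.2

/-- The second-order bias vector of the maximum likelihood estimator of `θ = (θ₁, θ₂)` in the
model with independent `Y_i ∼ El_{q_i}(μ_i(θ₁), Σ_i(θ₂), g_i)`. -/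
def modelBias (g : Fin n → ℝ → ℝ) (μ : ∀ i, (Fin p₁ → ℝ) → Fin (q i) → ℝ)
    (S : ∀ i, (Fin p₂ → ℝ) → Matrix (Fin (q i)) (Fin (q i)) ℝ)
    (θ : Fin p₁ ⊕ Fin p₂ → ℝ) : Fin p₁ ⊕ Fin p₂ → ℝ :=
  secondOrderBias
    (jointDensity g (fun i t => μ i (t ∘ Sum.inl)) (fun i t => S i (t ∘ Sum.inr)))
    (logLik g (fun i t => μ i (t ∘ Sum.inl)) (fun i t => S i (t ∘ Sum.inr))) θ

end Sample

end EllipticalBias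

end

/-! The Cox–Snell summand `κ_{rst}/2 + κ_{rs,t}` contains second and third derivatives of the
log-likelihood, whereas the answer contains only moments of `W`, hence only first derivatives of the
generators. The Bartlett identities close this gap. Differentiating `E(1) = 1`, then `E(U_r) = 0`,
then `E(U_{rs}) = -κ_{r,s}` and `κ_{r,s} = E(U_r U_s)` under the integral sign gives a linear system
whose solution is `κ_{rst}/2 + κ_{rs,t} = (∂_r κ_{s,t} + ∂_s κ_{r,t} - 3 ∂_t κ_{r,s} - E(U_r U_s
U_t)) / 4` (`half_kappaThree_add_kappaTwoOne`). It therefore suffices to know the Fisher information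
near `θ` and the third moments of the score at `θ`.

The score is a sum of independent contributions with mean zero, so its second and third moments are
sums over observations. Under the reflection `y ↦ 2μ - y` location scores are odd and scale scores
are even. Moments with an odd number of location scores vanish, and the information is block
diagonal.

For one observation the remaining moments are integrals of `W(u)^l` times one to three quadratic
forms in `y - μ`. The substitution `y = R z + μ` with `R Rᵀ = Σ` makes them spherical. Invariance
under infinitesimal rotations together with Euler's identity for homogeneous polynomials then strips
off one quadratic form at a time (`integral_radial_mul_quadPoly`), leaving traces times the
constants `ψ`.

Two facts about the radius supplement this. In the variable `t = log ‖z‖` the weight `K(t) = e^{qt}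
g(e^{2t})` has logarithmic derivative `q + 2 W(r) r`, with `r = e^{2t}`. Integrating `K'` gives
`E(W(r) r) = -q/2`, which centres the scale scores. Since a positive constant is not integrable on
the line, `K` is not constant, so `E((W(r) r)²) > (q/2)²`, that is `2c + (c - 1) q > 0`. Hence every
`H̃_{2(i)}` is positive definite; so is every `H̃_{1(i)}`, and full rank makes both information
blocks invertible.

What remains is linear algebra. `M*` is chosen so that `H̃₂ M* = (2 Σ ⊗ Σ)⁻¹`
(`Ht2_mulVec_Mstar_mulVec`), and the summands of both sides agree after symmetrization in the two
indices contracted with the symmetric matrices `K₁⁻¹` and `K₂⁻¹`. -/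

noncomputable section

namespace EllipticalBias

open Filter Topology

/-! ### Partial derivatives -/

section PartialDerivatives

variable {ι : Type*} [Fintype ι] [DecidableEq ι]

omit [DecidableEq ι] in
theorem hasDerivAt_line (θ v : ι → ℝ) (ε : ℝ) :
    HasDerivAt (fun x : ℝ => θ + x • v) v ε := by
  simpa using ((hasDerivAt_id ε).smul_const v).const_add θ

theorem hasDerivAt_pderiv_line {h : (ι → ℝ) → ℝ} {θ : ι → ℝ} {r : ι} {ε : ℝ}
    (hd : DifferentiableAt ℝ h (θ + ε • Pi.single r (1 : ℝ))) :
    HasDerivAt (fun x : ℝ => h (θ + x • Pi.single r (1 : ℝ)))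
      (pderiv r h (θ + ε • Pi.single r (1 : ℝ))) ε :=
  hd.hasFDerivAt.comp_hasDerivAt ε (hasDerivAt_line θ _ ε)

theorem hasDerivAt_pderiv {h : (ι → ℝ) → ℝ} {θ : ι → ℝ} {r : ι} (hd : DifferentiableAt ℝ h θ) :
    HasDerivAt (fun x : ℝ => h (θ + x • Pi.single r (1 : ℝ))) (pderiv r h θ) 0 := by
  have := hasDerivAt_pderiv_line (h := h) (θ := θ) (r := r) (ε := 0) (by simpa using hd)
  simpa using this

theorem pderiv_congr {h k : (ι → ℝ) → ℝ} {θ : ι → ℝ} {r : ι} (H : h =ᶠ[𝓝 θ] k) :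
    pderiv r h θ = pderiv r k θ := by
  rw [pderiv, pderiv, H.fderiv_eq]

theorem contDiffOn_pderiv {h : (ι → ℝ) → ℝ} {N : Set (ι → ℝ)} {m k : WithTop ℕ∞}
    (hN : IsOpen N) (hh : ContDiffOn ℝ k h N) (hm : m + 1 ≤ k) (r : ι) :
    ContDiffOn ℝ m (pderiv r h) N :=
  (hh.fderiv_of_isOpen hN hm).clm_apply contDiffOn_const

/-- Symmetry of the second partial derivatives. -/
theorem pderiv_comm {h : (ι → ℝ) → ℝ} {N : Set (ι → ℝ)} {θ : ι → ℝ} (hN : IsOpen N) (hθ : θ ∈ N)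
    (hd : DifferentiableOn ℝ h N) (hd2 : DifferentiableAt ℝ (fderiv ℝ h) θ) (r s : ι) :
    pderiv s (pderiv r h) θ = pderiv r (pderiv s h) θ := by
  have key : ∀ r s : ι, pderiv s (pderiv r h) θ
      = fderiv ℝ (fderiv ℝ h) θ (Pi.single s 1) (Pi.single r 1) := by
    intro r s
    have := (hd2.hasFDerivAt.clm_apply (hasFDerivAt_const (Pi.single r (1 : ℝ)) θ)).fderiv
    rw [pderiv]
    change fderiv ℝ (fun t => fderiv ℝ h t (Pi.single r 1)) θ _ = _
    rw [this]
    simp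
  rw [key, key]
  refine second_derivative_symmetric_of_eventually (f := h) (f' := fderiv ℝ h) ?_
    hd2.hasFDerivAt _ _
  filter_upwards [hN.mem_nhds hθ] with y hy
  exact (hd.differentiableAt (hN.mem_nhds hy)).hasFDerivAt

omit [Fintype ι] [DecidableEq ι] in
theorem eventually_line_mem {N : Set (ι → ℝ)} {θ : ι → ℝ} (hN : IsOpen N) (hθ : θ ∈ N)
    (v : ι → ℝ) : ∀ᶠ x : ℝ in 𝓝 0, θ + x • v ∈ N := by
  have hc : Continuous fun x : ℝ => θ + x • v := by fun_prop
  exact hc.continuousAt.eventually_mem (hN.mem_nhds (by simpa using hθ))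

variable {Y : Type*} [MeasureSpace Y]

/-- A partial derivative is an almost everywhere limit of difference quotients along the steps `1/(n
+ 1)`. The shift by `k` keeps all evaluation points inside `N`, where measurability is known. -/
theorem aestronglyMeasurable_pderiv {h : (ι → ℝ) → Y → ℝ} {N : Set (ι → ℝ)} (hN : IsOpen N)
    (hm : ∀ θ ∈ N, AEStronglyMeasurable (h θ)) {θ : ι → ℝ} (hθ : θ ∈ N)
    (hd : ∀ᵐ y, DifferentiableAt ℝ (fun t => h t y) θ) (r : ι) :
    AEStronglyMeasurable fun y => pderiv r (fun t => h t y) θ := by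
  have hu : Tendsto (fun n : ℕ => ((n : ℝ) + 1)⁻¹) atTop (𝓝 0) := by
    simpa using tendsto_one_div_add_atTop_nhds_zero_nat (𝕜 := ℝ)
  obtain ⟨k, hk⟩ := eventually_atTop.1
    (hu.eventually (eventually_line_mem hN hθ (Pi.single r (1 : ℝ))))
  have hu' : Tendsto (fun n : ℕ => (((n + k : ℕ) : ℝ) + 1)⁻¹) atTop (𝓝[≠] 0) := by
    refine tendsto_nhdsWithin_iff.2 ⟨hu.comp (tendsto_add_atTop_nat k), .of_forall fun n => ?_⟩
    simp only [Set.mem_compl_iff, Set.mem_singleton_iff, inv_eq_zero]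
    positivity
  refine aestronglyMeasurable_of_tendsto_ae atTop
    (f := fun n : ℕ => fun y => (((n + k : ℕ) : ℝ) + 1)⁻¹⁻¹ •
      (h (θ + (((n + k : ℕ) : ℝ) + 1)⁻¹ • Pi.single r (1 : ℝ)) y - h θ y)) ?_ ?_
  · intro n
    exact ((hm _ (hk _ (Nat.le_add_left k n))).sub (hm θ hθ)).const_smul (((n + k : ℕ) : ℝ) + 1)⁻¹⁻¹
  · filter_upwards [hd] with y hy
    have := (hasDerivAt_pderiv (r := r) hy).tendsto_slope_zero.comp hu'
    simpa [Function.comp_def] using this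

/-- Differentiation under the integral sign along a coordinate direction. -/
theorem hasDerivAt_integral_pderiv {h : (ι → ℝ) → Y → ℝ} {N : Set (ι → ℝ)} (hN : IsOpen N)
    (hm : ∀ θ ∈ N, AEStronglyMeasurable (h θ)) {θ : ι → ℝ} (hθ : θ ∈ N) (hi : Integrable (h θ))
    (hd : ∀ᵐ y, ∀ θ ∈ N, DifferentiableAt ℝ (fun t => h t y) θ) (r : ι) {G : Y → ℝ}
    (hG : Integrable G) (hb : ∀ᵐ y, ∀ θ ∈ N, |pderiv r (fun t => h t y) θ| ≤ G y) :
    HasDerivAt (fun x : ℝ => ∫ y, h (θ + x • Pi.single r (1 : ℝ)) y)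
      (∫ y, pderiv r (fun t => h t y) θ) 0 := by
  have hev := eventually_line_mem hN hθ (Pi.single r (1 : ℝ))
  have := (hasDerivAt_integral_of_dominated_loc_of_deriv_le (μ := (volume : Measure Y))
    (x₀ := (0 : ℝ)) (F := fun x y => h (θ + x • Pi.single r (1 : ℝ)) y)
    (F' := fun x y => pderiv r (fun t => h t y) (θ + x • Pi.single r (1 : ℝ))) (bound := G)
    hev (hev.mono fun x hx => hm _ hx) (by simpa using hi) ?_ ?_ hG ?_).2
  · simpa using this
  · simpa using aestronglyMeasurable_pderiv hN hm hθ (hd.mono fun y hy => hy θ hθ) r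
  · filter_upwards [hb] with y hy x hx using hy _ hx
  · filter_upwards [hd] with y hy x hx using hasDerivAt_pderiv_line (h := fun t => h t y) (hy _ hx)

end PartialDerivatives

/-! ### Bartlett identities -/

section Bartlett

variable {ι : Type*} [Fintype ι] [DecidableEq ι] {Y : Type*} [MeasureSpace Y]

/-- The third moment `E(U_r U_s U_t)` of the score. -/
def scoreMoment3 (f l : (ι → ℝ) → Y → ℝ) (θ : ι → ℝ) (r s t : ι) : ℝ :=
  expect f θ fun y => score l r θ y * score l s θ y * score l t θ y

theorem pderiv_mul_exp {a h : (ι → ℝ) → ℝ} {θ : ι → ℝ} (ha : DifferentiableAt ℝ a θ)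
    (hh : DifferentiableAt ℝ h θ) (r : ι) :
    pderiv r (fun t => a t * Real.exp (h t)) θ
      = (pderiv r a θ + a θ * pderiv r h θ) * Real.exp (h θ) := by
  have := (hasDerivAt_pderiv (r := r) (ha.mul hh.exp)).unique
    ((hasDerivAt_pderiv (r := r) ha).mul (hasDerivAt_pderiv (r := r) hh).exp)
  simp only [zero_smul, add_zero] at this
  change pderiv r (a * fun t => Real.exp (h t)) θ = _
  rw [this]
  ring

theorem pderiv_mul {a b : (ι → ℝ) → ℝ} {θ : ι → ℝ} (ha : DifferentiableAt ℝ a θ)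
    (hb : DifferentiableAt ℝ b θ) (r : ι) :
    pderiv r (fun t => a t * b t) θ = pderiv r a θ * b θ + a θ * pderiv r b θ := by
  have := (hasDerivAt_pderiv (r := r) (ha.mul hb)).unique
    ((hasDerivAt_pderiv (r := r) ha).mul (hasDerivAt_pderiv (r := r) hb))
  simp only [zero_smul, add_zero] at this
  exact this

/-- The derivative of `E_θ(a(θ, Y))`, for a density `f = exp l`. -/
theorem hasDerivAt_expect {f l a : (ι → ℝ) → Y → ℝ} {N : Set (ι → ℝ)} (hN : IsOpen N)
    (hf : ∀ θ ∈ N, ∀ y, f θ y = Real.exp (l θ y))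
    (hlm : ∀ θ ∈ N, AEStronglyMeasurable (l θ)) (ham : ∀ θ ∈ N, AEStronglyMeasurable (a θ))
    (hl : ∀ᵐ y, ∀ θ ∈ N, DifferentiableAt ℝ (fun t => l t y) θ)
    (ha : ∀ᵐ y, ∀ θ ∈ N, DifferentiableAt ℝ (fun t => a t y) θ)
    {θ : ι → ℝ} (hθ : θ ∈ N) (hi : Integrable fun y => a θ y * f θ y) (r : ι) {G : Y → ℝ}
    (hG : Integrable G)
    (hb : ∀ᵐ y, ∀ θ ∈ N,
      |(pderiv r (fun t => a t y) θ + a θ y * score l r θ y) * f θ y| ≤ G y) :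
    HasDerivAt (fun x : ℝ => expect f (θ + x • Pi.single r (1 : ℝ))
        (a (θ + x • Pi.single r (1 : ℝ))))
      (expect f θ fun y => pderiv r (fun t => a t y) θ + a θ y * score l r θ y) 0 := by
  have hfd : ∀ᵐ y, ∀ θ ∈ N, DifferentiableAt ℝ (fun t => a t y * f t y) θ ∧
      pderiv r (fun t => a t y * f t y) θ
        = (pderiv r (fun t => a t y) θ + a θ y * score l r θ y) * f θ y := by
    filter_upwards [hl, ha] with y hly hay θ hθ
    have e : (fun t => a t y * f t y) =ᶠ[𝓝 θ] fun t => a t y * Real.exp (l t y) := by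
      filter_upwards [hN.mem_nhds hθ] with t ht
      rw [hf t ht]
    refine ⟨((hay θ hθ).mul (hly θ hθ).exp).congr_of_eventuallyEq e, ?_⟩
    rw [pderiv_congr e, pderiv_mul_exp (hay θ hθ) (hly θ hθ), hf θ hθ]
    rfl
  have := hasDerivAt_integral_pderiv (h := fun t y => a t y * f t y) hN (fun θ hθ => ?_) hθ hi
    (hfd.mono fun y hy θ hθ => (hy θ hθ).1) r hG ?_
  · refine this.congr_deriv (integral_congr_ae ?_)
    filter_upwards [hfd] with y hy using (hy θ hθ).2
  · simp only [funext (hf θ hθ)]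
    exact (ham θ hθ).mul (Real.continuous_exp.comp_aestronglyMeasurable (hlm θ hθ))
  · filter_upwards [hfd, hb] with y hy hby θ hθ
    rw [(hy θ hθ).2]
    exact hby θ hθ

omit [MeasureSpace Y] in
theorem score2_comm {l : (ι → ℝ) → Y → ℝ} {N : Set (ι → ℝ)} (hN : IsOpen N) {θ : ι → ℝ}
    (hθ : θ ∈ N) {y : Y} (h : ContDiffOn ℝ 3 (fun t => l t y) N) (r s : ι) :
    score2 l r s θ y = score2 l s r θ y := by
  refine pderiv_comm hN hθ (h.differentiableOn (by norm_num)) ?_ r s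
  exact ((h.fderiv_of_isOpen (m := 1) hN (by norm_num)).differentiableOn (by norm_num)).differentiableAt
    (hN.mem_nhds hθ)

/-- In a regular model the Cox–Snell combination `κ_{rst} / 2 + κ_{rs,t}` is determined by the
derivatives of the Fisher information and the third moments of the score. -/
theorem half_kappaThree_add_kappaTwoOne {f l : (ι → ℝ) → Y → ℝ} {θ₀ : ι → ℝ}
    (hreg : IsRegularAt f l θ₀) {N' : Set (ι → ℝ)} (hN' : IsOpen N') (hθ' : θ₀ ∈ N')
    (hf : ∀ θ ∈ N', ∀ y, f θ y = Real.exp (l θ y))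
    (hlm : ∀ θ ∈ N', AEStronglyMeasurable (l θ)) (hone : ∀ θ ∈ N', ∫ y, f θ y = 1)
    {dK : ι → ι → ι → ℝ}
    (hK : ∀ r s t, HasDerivAt (fun x : ℝ => fisherInfo f l (θ₀ + x • Pi.single t (1 : ℝ)) r s)
      (dK r s t) 0) (r s t : ι) :
    1 / 2 * kappaThree f l θ₀ r s t + kappaTwoOne f l θ₀ r s t
      = 1 / 4 * (dK s t r + dK r t s - 3 * dK r s t - scoreMoment3 f l θ₀ r s t) := by
  obtain ⟨N₀, hN₀, hθN₀, G, hG, hae⟩ := hreg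
  obtain ⟨N, hNdef⟩ : ∃ N, N = N₀ ∩ N' := ⟨_, rfl⟩
  have hN : IsOpen N := hNdef ▸ hN₀.inter hN'
  have hθ : θ₀ ∈ N := hNdef ▸ ⟨hθN₀, hθ'⟩
  have hNs : N ⊆ N' := hNdef ▸ Set.inter_subset_right
  replace hf : ∀ θ ∈ N, ∀ y, f θ y = Real.exp (l θ y) := fun θ h => hf θ (hNs h)
  replace hlm : ∀ θ ∈ N, AEStronglyMeasurable (l θ) := fun θ h => hlm θ (hNs h)
  replace hone : ∀ θ ∈ N, ∫ y, f θ y = 1 := fun θ h => hone θ (hNs h)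
  have hcd : ∀ᵐ y, ContDiffOn ℝ 3 (fun θ => l θ y) N := by
    filter_upwards [hae] with y hy using hy.1.mono (hNdef ▸ Set.inter_subset_left)
  have hbd : ∀ᵐ y, ∀ θ ∈ N, ∀ r s t : ι,
        |score l r θ y| * f θ y ≤ G y ∧
        |score2 l r s θ y| * f θ y ≤ G y ∧
        |score l r θ y * score l s θ y| * f θ y ≤ G y ∧
        |score3 l r s t θ y| * f θ y ≤ G y ∧
        |score2 l r s θ y * score l t θ y| * f θ y ≤ G y ∧
        |score l r θ y * score l s θ y * score l t θ y| * f θ y ≤ G y := by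
    filter_upwards [hae] with y hy θ hθ using hy.2 θ (by rw [hNdef] at hθ; exact hθ.1)
  have hfpos : ∀ θ ∈ N, ∀ y, 0 < f θ y := fun θ h y => by rw [hf θ h y]; exact Real.exp_pos _
  have hfm : ∀ θ ∈ N, AEStronglyMeasurable (f θ) := fun θ h => by
    rw [funext (hf θ h)]
    exact Real.continuous_exp.comp_aestronglyMeasurable (hlm θ h)
  -- differentiability and measurability of the scores
  have hdl : ∀ᵐ y, ∀ θ ∈ N, DifferentiableAt ℝ (fun t => l t y) θ := by
    filter_upwards [hcd] with y hy θ h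
    exact (hy.differentiableOn (by norm_num)).differentiableAt (hN.mem_nhds h)
  have hcd1 : ∀ᵐ y, ∀ r, ContDiffOn ℝ 2 (fun t => score l r t y) N := by
    filter_upwards [hcd] with y hy r using contDiffOn_pderiv hN hy (by norm_num) r
  have hcd2 : ∀ᵐ y, ∀ r s, ContDiffOn ℝ 1 (fun t => score2 l r s t y) N := by
    filter_upwards [hcd1] with y hy r s using contDiffOn_pderiv hN (hy r) (by norm_num) s
  have hd1 : ∀ r, ∀ᵐ y, ∀ θ ∈ N, DifferentiableAt ℝ (fun t => score l r t y) θ := by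
    intro r
    filter_upwards [hcd1] with y hy θ h
    exact ((hy r).differentiableOn (by norm_num)).differentiableAt (hN.mem_nhds h)
  have hd2 : ∀ r s, ∀ᵐ y, ∀ θ ∈ N, DifferentiableAt ℝ (fun t => score2 l r s t y) θ := by
    intro r s
    filter_upwards [hcd2] with y hy θ h
    exact ((hy r s).differentiableOn (by norm_num)).differentiableAt (hN.mem_nhds h)
  have hm1 : ∀ r, ∀ θ ∈ N, AEStronglyMeasurable (score l r θ) := fun r θ h =>
    aestronglyMeasurable_pderiv hN hlm h (hdl.mono fun y hy => hy θ h) r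
  have hm2 : ∀ r s, ∀ θ ∈ N, AEStronglyMeasurable (score2 l r s θ) := fun r s θ h =>
    aestronglyMeasurable_pderiv hN (hm1 r) h ((hd1 r).mono fun y hy => hy θ h) s
  have hm3 : ∀ r s t, ∀ θ ∈ N, AEStronglyMeasurable (score3 l r s t θ) := fun r s t θ h =>
    aestronglyMeasurable_pderiv hN (hm2 r s) h ((hd2 r s).mono fun y hy => hy θ h) t
  have hint : ∀ {a : Y → ℝ} {θ : ι → ℝ}, θ ∈ N → AEStronglyMeasurable a →
      (∀ᵐ y, |a y| * f θ y ≤ G y) → Integrable fun y => a y * f θ y := by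
    intro a θ h ha hb
    refine hG.mono' (ha.mul (hfm θ h)) (hb.mono fun y hy => ?_)
    rwa [Real.norm_eq_abs, abs_mul, abs_of_pos (hfpos θ h y)]
  have hi1 : ∀ r, ∀ θ ∈ N, Integrable fun y => score l r θ y * f θ y := fun r θ h =>
    hint h (hm1 r θ h) (hbd.mono fun y hy => (hy θ h r r r).1)
  have hi2 : ∀ r s, ∀ θ ∈ N, Integrable fun y => score2 l r s θ y * f θ y := fun r s θ h =>
    hint h (hm2 r s θ h) (hbd.mono fun y hy => (hy θ h r s s).2.1)
  have hi11 : ∀ r s, ∀ θ ∈ N, Integrable fun y => score l r θ y * score l s θ y * f θ y :=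
    fun r s θ h => hint h ((hm1 r θ h).mul (hm1 s θ h))
      (hbd.mono fun y hy => (hy θ h r s s).2.2.1)
  have hi3 : ∀ r s t, ∀ θ ∈ N, Integrable fun y => score3 l r s t θ y * f θ y :=
    fun r s t θ h => hint h (hm3 r s t θ h) (hbd.mono fun y hy => (hy θ h r s t).2.2.2.1)
  have hi21 : ∀ r s t, ∀ θ ∈ N, Integrable fun y => score2 l r s θ y * score l t θ y * f θ y :=
    fun r s t θ h => hint h ((hm2 r s θ h).mul (hm1 t θ h))
      (hbd.mono fun y hy => (hy θ h r s t).2.2.2.2.1)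
  have hi111 : ∀ r s t, ∀ θ ∈ N,
      Integrable fun y => score l r θ y * score l s θ y * score l t θ y * f θ y :=
    fun r s t θ h => hint h (((hm1 r θ h).mul (hm1 s θ h)).mul (hm1 t θ h))
      (hbd.mono fun y hy => (hy θ h r s t).2.2.2.2.2)
  -- A non-integrable function has integral `0` by convention, so total mass `1` forces
  -- integrability.
  have hone' : ∀ θ ∈ N, Integrable (f θ) := fun θ h => by
    by_contra hc
    have := hone θ h
    rw [integral_undef hc] at this
    exact zero_ne_one this
  -- first identity: the score is centred
  have hE1 : ∀ r, ∀ θ ∈ N, expect f θ (score l r θ) = 0 := by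
    intro r θ h
    have := hasDerivAt_expect (a := fun _ _ => 1) hN hf hlm
      (fun θ _ => aestronglyMeasurable_const) hdl (.of_forall fun y θ _ => by fun_prop) h
      (by simpa using hone' θ h) r hG (by
        filter_upwards [hbd] with y hy θ h
        have := (hy θ h r r r).1
        rw [abs_mul, abs_of_pos (hfpos θ h y)]
        simpa [pderiv] using this)
    -- The total mass is constantly `1` near `θ`, so the derivative just computed is that of a
    -- constant.
    have h2 : HasDerivAt (fun _ : ℝ => (1 : ℝ))
        (expect f θ fun y => pderiv r (fun _ => (1 : ℝ)) θ + 1 * score l r θ y) 0 := by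
      refine this.congr_of_eventuallyEq ?_
      filter_upwards [eventually_line_mem hN h (Pi.single r (1 : ℝ))] with x hx
      simp only [expect, one_mul]
      exact (hone _ hx).symm
    have h3 := h2.unique (hasDerivAt_const (0 : ℝ) (1 : ℝ))
    simpa [pderiv] using h3
  -- second identity: `κ_{rs} = -κ_{r,s}`
  have hE2 : ∀ r s, ∀ θ ∈ N, expect f θ (score2 l r s θ) = - fisherInfo f l θ r s := by
    intro r s θ h
    have := hasDerivAt_expect (a := score l r) hN hf hlm (hm1 r) hdl (hd1 r) h (hi1 r θ h) s
      (hG.add hG) (by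
        filter_upwards [hbd] with y hy θ h
        have h1 := (hy θ h r s s).2.1
        have h2 := (hy θ h r s s).2.2.1
        rw [abs_mul, abs_of_pos (hfpos θ h y)]
        refine (mul_le_mul_of_nonneg_right (abs_add_le _ _) (hfpos θ h y).le).trans ?_
        rw [add_mul]
        exact add_le_add h1 h2)
    have h2 : HasDerivAt (fun _ : ℝ => (0 : ℝ))
        (expect f θ fun y => score2 l r s θ y + score l r θ y * score l s θ y) 0 := by
      refine this.congr_of_eventuallyEq ?_
      filter_upwards [eventually_line_mem hN h (Pi.single s (1 : ℝ))] with x hx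
      exact (hE1 r _ hx).symm
    have h3 := h2.unique (hasDerivAt_const (0 : ℝ) (0 : ℝ))
    simp only [expect, add_mul] at h3
    rw [integral_add (hi2 r s θ h) (hi11 r s θ h)] at h3
    simp only [expect, fisherInfo, Matrix.of_apply]
    linarith
  -- third-order identities
  have hA : ∀ r s t, kappaThree f l θ₀ r s t + kappaTwoOne f l θ₀ r s t = - dK r s t := by
    intro r s t
    have := hasDerivAt_expect (a := score2 l r s) hN hf hlm (hm2 r s) hdl (hd2 r s) hθ
      (hi2 r s θ₀ hθ) t (hG.add hG) (by
        filter_upwards [hbd] with y hy θ h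
        have h1 := (hy θ h r s t).2.2.2.1
        have h2 := (hy θ h r s t).2.2.2.2.1
        rw [abs_mul, abs_of_pos (hfpos θ h y)]
        refine (mul_le_mul_of_nonneg_right (abs_add_le _ _) (hfpos θ h y).le).trans ?_
        rw [add_mul]
        exact add_le_add h1 h2)
    have he : (fun x : ℝ => fisherInfo f l (θ₀ + x • Pi.single t (1 : ℝ)) r s) =ᶠ[𝓝 0]
        fun x : ℝ => - expect f (θ₀ + x • Pi.single t (1 : ℝ))
          (score2 l r s (θ₀ + x • Pi.single t (1 : ℝ))) := by
      filter_upwards [eventually_line_mem hN hθ (Pi.single t (1 : ℝ))] with x hx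
      rw [hE2 r s _ hx, neg_neg]
    have h2 := (hK r s t).unique (this.fun_neg.congr_of_eventuallyEq he)
    rw [h2, neg_neg]
    change _ = expect f θ₀ fun y => score3 l r s t θ₀ y + score2 l r s θ₀ y * score l t θ₀ y
    simp only [kappaThree, kappaTwoOne, expect, add_mul]
    rw [integral_add (hi3 r s t θ₀ hθ) (hi21 r s t θ₀ hθ)]
  -- The same derivative of `κ_{r,s}`, now read from `E(U_r U_s)` instead of `-E(U_{rs})`; the
  -- product rule and the derivative of the density give three terms.
  have hB : ∀ r s t, dK r s t = kappaTwoOne f l θ₀ r t s + kappaTwoOne f l θ₀ s t r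
      + scoreMoment3 f l θ₀ r s t := by
    intro r s t
    have hae2 : ∀ᵐ y, ∀ θ ∈ N, pderiv t (fun τ => score l r τ y * score l s τ y) θ
        = score2 l r t θ y * score l s θ y + score2 l s t θ y * score l r θ y := by
      filter_upwards [hd1 r, hd1 s] with y h1 h2 θ h
      rw [pderiv_mul (h1 θ h) (h2 θ h), mul_comm (score l r θ y)]
      rfl
    have hm : ∀ θ ∈ N, AEStronglyMeasurable fun y => score l r θ y * score l s θ y :=
      fun θ h => (hm1 r θ h).mul (hm1 s θ h)
    have hd : ∀ᵐ y, ∀ θ ∈ N, DifferentiableAt ℝ (fun t => score l r t y * score l s t y) θ := by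
      filter_upwards [hd1 r, hd1 s] with y h1 h2 θ h
      exact (h1 θ h).mul (h2 θ h)
    have hb : ∀ᵐ y, ∀ θ ∈ N, |(pderiv t (fun τ => score l r τ y * score l s τ y) θ
        + score l r θ y * score l s θ y * score l t θ y) * f θ y| ≤ G y + G y + G y := by
      filter_upwards [hbd, hae2] with y hy he θ h
      rw [he θ h]
      have h1 := (hy θ h r t s).2.2.2.2.1
      have h2 := (hy θ h s t r).2.2.2.2.1
      have h3 := (hy θ h r s t).2.2.2.2.2
      rw [abs_mul, abs_of_pos (hfpos θ h y)]
      have h4 := mul_le_mul_of_nonneg_right (abs_add_three (score2 l r t θ y * score l s θ y)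
        (score2 l s t θ y * score l r θ y) (score l r θ y * score l s θ y * score l t θ y))
        (hfpos θ h y).le
      rw [add_mul, add_mul] at h4
      linarith
    have := hasDerivAt_expect (a := fun θ y => score l r θ y * score l s θ y) hN hf hlm
      hm hdl hd hθ (hi11 r s θ₀ hθ) t ((hG.add hG).add hG) hb
    have h2 := (hK r s t).unique this
    rw [h2]
    simp only [kappaTwoOne, scoreMoment3, expect]
    have e1 := integral_add (hi21 r t s θ₀ hθ) (hi21 s t r θ₀ hθ)
    have e2 := integral_add ((hi21 r t s θ₀ hθ).add (hi21 s t r θ₀ hθ)) (hi111 r s t θ₀ hθ)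
    simp only [Pi.add_apply] at e2
    rw [← e1, ← e2]
    refine integral_congr_ae ?_
    filter_upwards [hae2] with y he
    rw [he θ₀ hθ]
    ring
  have hsymm : ∀ r s t, kappaTwoOne f l θ₀ r s t = kappaTwoOne f l θ₀ s r t := by
    intro r s t
    simp only [kappaTwoOne, expect]
    refine integral_congr_ae ?_
    filter_upwards [hcd] with y hy
    rw [score2_comm hN hθ hy]
  have hTsymm : ∀ r s t, scoreMoment3 f l θ₀ r s t = scoreMoment3 f l θ₀ r t s := by
    intro r s t
    simp only [scoreMoment3, mul_right_comm]
  have hTsymm' : ∀ r s t, scoreMoment3 f l θ₀ r s t = scoreMoment3 f l θ₀ s r t := by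
    intro r s t
    simp only [scoreMoment3, mul_comm (score l r θ₀ _)]
  -- The three cyclic versions of `hB` determine `2 κ_{rs,t} = dK_{rts} + dK_{str} - dK_{rst} -
  -- T_{rst}`, and `a1` then eliminates `κ_{rst}`. The rewrites bring the symmetric arguments to a
  -- common order.
  have a1 := hA r s t
  have b1 := hB r s t
  have b2 := hB r t s
  have b3 := hB s t r
  rw [hsymm t s r] at b2
  rw [hsymm s r t, hsymm t r s] at b3
  rw [hTsymm' s t r, hTsymm t s r, hTsymm' t r s, hTsymm r t s] at b3
  rw [hTsymm r t s] at b2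
  linarith

end Bartlett

/-! ### Radial integrals -/

section Radial

theorem norm_toLp_sq {q : ℕ} (x : Fin q → ℝ) : ‖WithLp.toLp 2 x‖ ^ 2 = x ⬝ᵥ x := by
  rw [EuclideanSpace.norm_sq_eq]
  simp [dotProduct, sq]

/-- Polar coordinates with radius `exp t`. -/
theorem exists_radial_integral {q : ℕ} (hq : 0 < q) : ∃ c : ℝ, 0 < c ∧ ∀ φ : ℝ → ℝ,
    (Integrable (fun x : Fin q → ℝ => φ (x ⬝ᵥ x)) ↔
      Integrable fun t : ℝ => Real.exp (q * t) * φ (Real.exp (2 * t))) ∧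
    ∫ x : Fin q → ℝ, φ (x ⬝ᵥ x) = c * ∫ t : ℝ, Real.exp (q * t) * φ (Real.exp (2 * t)) := by
  have : Nonempty (Fin q) := ⟨⟨0, hq⟩⟩
  have : Nontrivial (EuclideanSpace ℝ (Fin q)) := inferInstance
  have hdim : Module.finrank ℝ (EuclideanSpace ℝ (Fin q)) = q := by simp
  have hexp : ∀ φ : ℝ → ℝ, ∀ t : ℝ,
      |Real.exp t| • (Real.exp t ^ (q - 1) • φ (Real.exp t ^ 2))
        = Real.exp (q * t) * φ (Real.exp (2 * t)) := by
    intro φ t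
    rw [abs_of_pos (Real.exp_pos t), smul_eq_mul, smul_eq_mul, ← mul_assoc, ← Real.exp_nat_mul,
      ← Real.exp_nat_mul, ← Real.exp_add]
    congr 2
    · rw [Nat.cast_sub hq]
      push_cast
      ring
  have himg : Real.exp '' Set.univ = Set.Ioi 0 := by rw [Set.image_univ, Real.range_exp]
  -- The constant is the area of the unit sphere, `q` times the volume of the unit ball. The
  -- Jacobian `e^t` of `r = e^t` raises `r^{q-1}` to `e^{qt}`.
  refine ⟨q * volume.real (Metric.ball (0 : EuclideanSpace ℝ (Fin q)) 1), ?_, fun φ => ⟨?_, ?_⟩⟩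
  · have : 0 < volume.real (Metric.ball (0 : EuclideanSpace ℝ (Fin q)) 1) := by
      rw [measureReal_def, ENNReal.toReal_pos_iff]
      exact ⟨Metric.measure_ball_pos _ _ one_pos, measure_ball_lt_top⟩
    positivity
  · have h1 := (PiLp.volume_preserving_toLp (Fin q)).integrable_comp_emb
      (MeasurableEquiv.toLp 2 (Fin q → ℝ)).measurableEmbedding
      (g := fun x : EuclideanSpace ℝ (Fin q) => φ (‖x‖ ^ 2))
    simp only [Function.comp_def, norm_toLp_sq] at h1
    rw [h1, integrable_fun_norm_addHaar volume (f := fun r : ℝ => φ (r ^ 2)), hdim, ← himg,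
      integrableOn_image_iff_integrableOn_abs_deriv_smul MeasurableSet.univ
        (fun x _ => (Real.hasDerivAt_exp x).hasDerivWithinAt) Real.exp_injective.injOn,
      integrableOn_univ]
    simp only [hexp]
  · have h1 := (PiLp.volume_preserving_toLp (Fin q)).integral_comp
      (MeasurableEquiv.toLp 2 (Fin q → ℝ)).measurableEmbedding
      (fun x : EuclideanSpace ℝ (Fin q) => φ (‖x‖ ^ 2))
    simp only [norm_toLp_sq] at h1
    rw [h1, integral_fun_norm_addHaar volume (fun r : ℝ => φ (r ^ 2)), hdim, ← himg,
      integral_image_eq_integral_abs_deriv_smul MeasurableSet.univ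
        (fun x _ => (Real.hasDerivAt_exp x).hasDerivWithinAt) Real.exp_injective.injOn,
      setIntegral_univ]
    simp only [hexp]
    simp only [nsmul_eq_mul, smul_eq_mul, mul_assoc]

theorem dotProduct_self_pos {q : ℕ} {x : Fin q → ℝ} (hx : x ≠ 0) : 0 < x ⬝ᵥ x :=
  lt_of_le_of_ne (Finset.sum_nonneg fun i _ => mul_self_nonneg (x i))
    fun h => hx (dotProduct_self_eq_zero.1 h.symm)

theorem dotProduct_self_nonneg' {q : ℕ} (x : Fin q → ℝ) : 0 ≤ x ⬝ᵥ x :=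
  Finset.sum_nonneg fun i _ => mul_self_nonneg (x i)

theorem ae_ne_zero {q : ℕ} (hq : 0 < q) : ∀ᵐ x : Fin q → ℝ, x ≠ 0 := by
  have : Nonempty (Fin q) := ⟨⟨0, hq⟩⟩
  exact Measure.ae_ne volume 0

variable {q : ℕ} {g : ℝ → ℝ}

/-- Integrability is implicit in the normalization: otherwise the integral would take its default
value `0`. -/
theorem IsGenerator.integrable (hg : IsGenerator q g) :
    Integrable fun x : Fin q → ℝ => g (x ⬝ᵥ x) := by
  by_contra h
  have := hg.integral_eq_one
  rw [integral_undef h] at this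
  exact zero_ne_one this

theorem IsGenerator.W_eq (hg : IsGenerator q g) {u : ℝ} (hu : 0 < u) :
    W g u = deriv g u / g u := by
  rw [W, deriv.log (hg.diff u hu) (hg.pos u hu.le).ne']

theorem IsGenerator.hasDerivAt_log (hg : IsGenerator q g) {u : ℝ} (hu : 0 < u) :
    HasDerivAt (fun t => Real.log (g t)) (W g u) u :=
  ((hg.diff u hu).log (hg.pos u hu.le).ne').hasDerivAt

/-- The weight `K(t) = e^{qt} g(e^{2t})` of the log-radius. -/
def logRadial (q : ℕ) (g : ℝ → ℝ) (t : ℝ) : ℝ := Real.exp (q * t) * g (Real.exp (2 * t))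

theorem IsGenerator.logRadial_pos (hg : IsGenerator q g) (t : ℝ) : 0 < logRadial q g t :=
  mul_pos (Real.exp_pos _) (hg.pos _ (Real.exp_pos _).le)

/-- The logarithmic derivative of the weight is affine in `W(r) r`. This is what turns statements
about `E(W(r) r)` and its square into statements about `K'`. -/
theorem IsGenerator.hasDerivAt_logRadial (hg : IsGenerator q g) (t : ℝ) :
    HasDerivAt (logRadial q g)
      ((q + 2 * (W g (Real.exp (2 * t)) * Real.exp (2 * t))) * logRadial q g t) t := by
  have h2 : HasDerivAt (fun t : ℝ => Real.exp (2 * t)) (Real.exp (2 * t) * 2) t := by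
    simpa using ((hasDerivAt_id t).const_mul (2 : ℝ)).exp
  have hq : HasDerivAt (fun t : ℝ => Real.exp (q * t)) (Real.exp (q * t) * q) t := by
    simpa using ((hasDerivAt_id t).const_mul (q : ℝ)).exp
  have hp := Real.exp_pos (2 * t)
  have hgc := (hg.diff _ hp).hasDerivAt.comp t h2
  refine (hq.mul hgc).congr_deriv ?_
  rw [hg.W_eq hp, logRadial]
  have := (hg.pos _ hp.le).ne'
  simp only [Function.comp_def]
  generalize Real.exp (2 * t) = u at *
  field_simp

/-- The integrand of `E(h(r))` with `r = ‖L‖²`. -/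
theorem IsGenerator.integrable_W_mul (hg : IsGenerator q g) :
    Integrable (psiIntegrand q g 1 1) := by
  have hm : AEStronglyMeasurable (psiIntegrand q g 1 1) := by
    have h1 : Measurable (W g) := measurable_deriv _
    have h2 : Measurable fun x : Fin q → ℝ => x ⬝ᵥ x := by
      simp only [dotProduct]
      fun_prop
    exact (((h1.comp h2).pow_const 1).mul (h2.pow_const 1)).aestronglyMeasurable.mul
      hg.integrable.aestronglyMeasurable
  refine (hg.integrable.add hg.psi22).mono' hm (.of_forall fun x => ?_)
  have hp := hg.pos _ (dotProduct_self_nonneg' x)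
  simp only [psiIntegrand, Pi.add_apply, pow_one, Real.norm_eq_abs]
  rw [abs_mul, abs_of_pos hp, ← mul_pow]
  -- Since `|w| ≤ 1 + w²`, the first moment is controlled by the total mass and `ψ_{(2,2)}`.
  have : |W g (x ⬝ᵥ x) * (x ⬝ᵥ x)| ≤ 1 + (W g (x ⬝ᵥ x) * (x ⬝ᵥ x)) ^ 2 := by
    nlinarith [sq_abs (W g (x ⬝ᵥ x) * (x ⬝ᵥ x)), sq_nonneg (|W g (x ⬝ᵥ x) * (x ⬝ᵥ x)| - 1),
      abs_nonneg (W g (x ⬝ᵥ x) * (x ⬝ᵥ x))]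
  nlinarith

theorem IsGenerator.integrable_logRadial (hq : 0 < q) (hg : IsGenerator q g) :
    Integrable (logRadial q g) := by
  obtain ⟨c, -, h⟩ := exists_radial_integral hq
  exact (h g).1.1 hg.integrable

theorem IsGenerator.integrable_logRadial_psi (hq : 0 < q) {l k : ℕ}
    (hi : Integrable (psiIntegrand q g l k)) :
    Integrable fun t : ℝ =>
      W g (Real.exp (2 * t)) ^ l * Real.exp (2 * t) ^ k * logRadial q g t := by
  obtain ⟨c, -, h⟩ := exists_radial_integral hq
  refine ((h fun u => W g u ^ l * u ^ k * g u).1.1 hi).congr (.of_forall fun t => ?_)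
  simp only [logRadial]
  ring

/-- One constant serves the total mass and all the `ψ`, so the normalization eliminates it. -/
theorem exists_psi_eq (hq : 0 < q) (g : ℝ → ℝ) : ∃ c : ℝ, 0 < c ∧
    (∫ x : Fin q → ℝ, g (x ⬝ᵥ x) = c * ∫ t, logRadial q g t) ∧ ∀ l k,
    psi q g l k = c * ∫ t : ℝ, W g (Real.exp (2 * t)) ^ l * Real.exp (2 * t) ^ k
      * logRadial q g t := by
  obtain ⟨c, hc, h⟩ := exists_radial_integral hq
  refine ⟨c, hc, (h g).2, fun l k => ?_⟩
  rw [psi]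
  refine ((h fun u => W g u ^ l * u ^ k * g u).2).trans ?_
  congr 2
  ext t
  simp only [logRadial]
  ring

/-- `E(W(r) r) = -q/2`. -/
theorem IsGenerator.psi_one_one (hq : 0 < q) (hg : IsGenerator q g) :
    psi q g 1 1 = -(q / 2) := by
  obtain ⟨c, hc, h1, hpsi⟩ := exists_psi_eq hq g
  have hK := hg.integrable_logRadial hq
  have hW := IsGenerator.integrable_logRadial_psi hq hg.integrable_W_mul
  -- `K` and `K'` are integrable on the whole line, so `∫ K' = 0`. No decay hypothesis on `g` is
  -- needed.
  have hz := integral_eq_zero_of_hasDerivAt_of_integrable hg.hasDerivAt_logRadial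
    (((hK.const_mul (q : ℝ)).add (hW.const_mul 2)).congr (.of_forall fun t => by
      simp only [Pi.add_apply]; ring)) hK
  have e : ∫ t, (q + 2 * (W g (Real.exp (2 * t)) * Real.exp (2 * t))) * logRadial q g t
      = q * (∫ t, logRadial q g t) + 2 * ∫ t, W g (Real.exp (2 * t)) ^ 1 * Real.exp (2 * t) ^ 1
        * logRadial q g t := by
    rw [← integral_const_mul, ← integral_const_mul, ← integral_add (hK.const_mul _)
      (hW.const_mul _)]
    congr 1
    ext t
    ring
  rw [e] at hz
  rw [hpsi 1 1]
  rw [hg.integral_eq_one] at h1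
  linear_combination (c / 2) * hz + (-(q / 2 : ℝ)) * (-h1)

/-- The log-radius is not degenerate: `E((W(r) r)²) > (q/2)²`. -/
theorem IsGenerator.lt_psi_two_two (hq : 0 < q) (hg : IsGenerator q g) :
    (q / 2 : ℝ) ^ 2 < psi q g 2 2 := by
  obtain ⟨c, hc, h1, hpsi⟩ := exists_psi_eq hq g
  have hK := hg.integrable_logRadial hq
  have hW := IsGenerator.integrable_logRadial_psi hq hg.integrable_W_mul
  have hW2 := IsGenerator.integrable_logRadial_psi hq hg.psi22
  have h11 := hg.psi_one_one hq
  rw [hpsi 1 1] at h11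
  rw [hg.integral_eq_one] at h1
  -- The integrand of the variance of `W(r) r`, centred at its mean `-q/2`.
  set F : ℝ → ℝ := fun t => (W g (Real.exp (2 * t)) * Real.exp (2 * t) + q / 2) ^ 2
    * logRadial q g t with hF
  have hFe : F = fun t => W g (Real.exp (2 * t)) ^ 2 * Real.exp (2 * t) ^ 2 * logRadial q g t
      + (q * (W g (Real.exp (2 * t)) ^ 1 * Real.exp (2 * t) ^ 1 * logRadial q g t)
        + (q / 2) ^ 2 * logRadial q g t) := by
    ext t
    simp only [hF]
    ring
  have hFi : Integrable F := by
    rw [hFe]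
    exact hW2.add ((hW.const_mul _).add (hK.const_mul _))
  have hF0 : 0 ≤ F := fun t => mul_nonneg (sq_nonneg _) (hg.logRadial_pos t).le
  have hint : c * ∫ t, F t = psi q g 2 2 - (q / 2) ^ 2 := by
    have e1 := integral_add hW2 ((hW.const_mul (q : ℝ)).add (hK.const_mul ((q / 2 : ℝ) ^ 2)))
    have e2 := integral_add (hW.const_mul (q : ℝ)) (hK.const_mul ((q / 2 : ℝ) ^ 2))
    simp only [Pi.add_apply] at e1
    rw [hFe, e1, e2, integral_const_mul, integral_const_mul, hpsi 2 2]
    linear_combination q * h11 - (q / 2 : ℝ) ^ 2 * h1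
  have hpos : 0 < ∫ t, F t := by
    refine lt_of_le_of_ne (integral_nonneg hF0) fun h0 => ?_
    have hae := (integral_eq_zero_iff_of_nonneg hF0 hFi).1 h0.symm
    have hd0 : ∀ᵐ t, (q + 2 * (W g (Real.exp (2 * t)) * Real.exp (2 * t))) * logRadial q g t
        = 0 := by
      filter_upwards [hae] with t ht
      have hk := (hg.logRadial_pos t).ne'
      simp only [hF, Pi.zero_apply, mul_eq_zero, hk, or_false] at ht
      rw [pow_eq_zero_iff two_ne_zero] at ht
      rw [mul_eq_zero]
      left
      linarith
    -- Zero variance means `K' = 0` almost everywhere. As `K` is differentiable everywhere with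
    -- integrable derivative, the fundamental theorem of calculus makes it constant; a positive
    -- constant is not integrable on the line.
    have hconst : ∀ t, logRadial q g t = logRadial q g 0 := by
      intro t
      have := intervalIntegral.integral_eq_sub_of_hasDerivAt (a := 0) (b := t)
        (fun x _ => hg.hasDerivAt_logRadial x)
        (((integrable_zero ℝ ℝ volume).congr (hd0.mono fun x hx => hx.symm)).intervalIntegrable)
      rw [intervalIntegral.integral_congr_ae (g := fun _ => 0)
        (hd0.mono fun x hx _ => hx)] at this
      simp only [intervalIntegral.integral_zero] at this
      linarith
    rw [funext hconst, integrable_const_iff] at hK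
    rcases hK with h | h
    · exact (hg.logRadial_pos 0).ne' h
    · exact absurd h.measure_univ_lt_top (by simp)
  have := mul_pos hc hpos
  linarith

/-- If `ψ_{(2,1)}` were zero, `W(r)` would vanish almost everywhere, against `E(W(r) r) = -q/2`. -/
theorem IsGenerator.psi_two_one_pos (hq : 0 < q) (hg : IsGenerator q g) :
    0 < psi q g 2 1 := by
  have h0 : 0 ≤ psiIntegrand q g 2 1 := fun x =>
    mul_nonneg (mul_nonneg (sq_nonneg _) (by simpa using dotProduct_self_nonneg' x))
      (hg.pos _ (dotProduct_self_nonneg' x)).le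
  refine lt_of_le_of_ne (integral_nonneg h0) fun h => ?_
  have hae := (integral_eq_zero_iff_of_nonneg h0 hg.psi21).1 h.symm
  have : psi q g 1 1 = 0 := by
    rw [psi, ← integral_zero (Fin q → ℝ) ℝ]
    refine integral_congr_ae ?_
    filter_upwards [hae, ae_ne_zero hq] with x hx hx0
    have hu := (dotProduct_self_pos hx0).ne'
    have hgp := (hg.pos _ (dotProduct_self_nonneg' x)).ne'
    simp only [psiIntegrand, Pi.zero_apply, pow_one, mul_eq_zero, hu, hgp, or_false,
      pow_eq_zero_iff two_ne_zero] at hx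
    simp [psiIntegrand, hx]
  rw [hg.psi_one_one hq] at this
  have : (0 : ℝ) < q := by exact_mod_cast hq
  linarith

theorem IsGenerator.lt_cC (hq : 0 < q) (hg : IsGenerator q g) :
    (q : ℝ) / (q + 2) < cC q g := by
  have h := hg.lt_psi_two_two hq
  have hq' : (0 : ℝ) < q := by exact_mod_cast hq
  rw [cC, div_lt_div_iff₀ (by positivity) (by positivity)]
  have : (q : ℝ) * (q * (q + 2)) = 4 * (q / 2) ^ 2 * (q + 2) := by ring
  rw [this]
  gcongr

theorem IsGenerator.cC_pos (hq : 0 < q) (hg : IsGenerator q g) : 0 < cC q g :=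
  lt_of_le_of_lt (by positivity) (hg.lt_cC hq)

/-- This number is the denominator in `M*`. A quarter of it is the factor by which `H̃₂` sends `vec
Σ` to `vec Σ⁻¹`, so its sign decides positivity of `H̃₂` in the direction where the rank-one term
acts. -/
theorem IsGenerator.two_cC_add_pos (hq : 0 < q) (hg : IsGenerator q g) :
    0 < 2 * cC q g + (cC q g - 1) * q := by
  have h := hg.lt_cC hq
  have hq' : (0 : ℝ) < q := by exact_mod_cast hq
  rw [div_lt_iff₀ (by positivity)] at h
  linarith

end Radial

/-! ### Moments of spherical distributions -/

section Spherical

variable {q : ℕ}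

/-- The chain rule in terms of formal partial derivatives, which makes homogeneity and Euler's
identity for polynomials available inside integrals. -/
theorem hasDerivAt_eval (P : MvPolynomial (Fin q) ℝ) {γ : ℝ → Fin q → ℝ} {γ' : Fin q → ℝ} {x : ℝ}
    (hγ : ∀ i, HasDerivAt (fun t => γ t i) (γ' i) x) :
    HasDerivAt (fun t => MvPolynomial.eval (γ t) P)
      (∑ i, γ' i * MvPolynomial.eval (γ x) (MvPolynomial.pderiv i P)) x := by
  induction P using MvPolynomial.induction_on with
  | C a => simpa using hasDerivAt_const x a
  | add P Q hP hQ =>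
    simp only [map_add, mul_add, Finset.sum_add_distrib]
    exact hP.add hQ
  | mul_X P j hP =>
    have h := hP.mul (hγ j)
    simp only [map_mul, MvPolynomial.eval_X]
    refine h.congr_deriv ?_
    simp only [MvPolynomial.pderiv_mul, map_add, map_mul, MvPolynomial.eval_X,
      MvPolynomial.pderiv_X, mul_add, Finset.sum_add_distrib, Finset.sum_mul]
    congr 1
    · exact Finset.sum_congr rfl fun i _ => by ring
    · rw [Finset.sum_eq_single j]
      · simp [mul_comm]
      · intro i _ hij
        simp [hij.symm]
      · simp

theorem abs_apply_le_sqrt (z : Fin q → ℝ) (i : Fin q) : |z i| ≤ Real.sqrt (z ⬝ᵥ z) := by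
  apply Real.abs_le_sqrt
  rw [sq]
  exact Finset.single_le_sum (f := fun i => z i * z i) (fun i _ => mul_self_nonneg (z i))
    (Finset.mem_univ i)

/-- Every coordinate is at most `|z|` in modulus, and each monomial has degree `2m`. The bound
depends on `z` only through `z ⬝ᵥ z`, so it is uniform along rotations. -/
theorem abs_eval_le {P : MvPolynomial (Fin q) ℝ} {m : ℕ} (hP : P.IsHomogeneous (2 * m))
    (z : Fin q → ℝ) :
    |MvPolynomial.eval z P| ≤ (∑ d ∈ P.support, |P.coeff d|) * (z ⬝ᵥ z) ^ m := by
  rw [MvPolynomial.eval_eq, Finset.sum_mul]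
  refine (Finset.abs_sum_le_sum_abs _ _).trans (Finset.sum_le_sum fun d hd => ?_)
  rw [abs_mul, Finset.abs_prod]
  refine mul_le_mul_of_nonneg_left ?_ (abs_nonneg _)
  calc ∏ i ∈ d.support, |z i ^ d i| ≤ ∏ i ∈ d.support, Real.sqrt (z ⬝ᵥ z) ^ d i := by
        refine Finset.prod_le_prod (fun i _ => abs_nonneg _) fun i _ => ?_
        rw [abs_pow]
        exact pow_le_pow_left₀ (abs_nonneg _) (abs_apply_le_sqrt z i) _
    _ = (z ⬝ᵥ z) ^ m := by
        rw [Finset.prod_pow_eq_pow_sum, ← hP.degree_eq_sum_deg_support hd, pow_mul,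
          Real.sq_sqrt (dotProduct_self_nonneg' z)]

theorem continuous_dotProduct_self : Continuous fun z : Fin q → ℝ => z ⬝ᵥ z := by
  simp only [dotProduct]
  fun_prop

/-- `h` itself is not assumed measurable. Away from the origin, a null set, `h p` is the given
integrable function times the measurable quotient `p / |z|^{2m}`. -/
theorem aestronglyMeasurable_radial_mul (hq : 0 < q) {h : ℝ → ℝ} {m : ℕ}
    (hh : Integrable fun z : Fin q → ℝ => h (z ⬝ᵥ z) * (z ⬝ᵥ z) ^ m) {p : (Fin q → ℝ) → ℝ}
    (hp : Continuous p) : AEStronglyMeasurable fun z : Fin q → ℝ => h (z ⬝ᵥ z) * p z := by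
  have h1 : Measurable fun z : Fin q → ℝ => p z / (z ⬝ᵥ z) ^ m :=
    hp.measurable.div (continuous_dotProduct_self.measurable.pow_const m)
  refine (hh.aestronglyMeasurable.mul h1.aestronglyMeasurable).congr ?_
  filter_upwards [ae_ne_zero hq] with z hz
  have := (dotProduct_self_pos hz).ne'
  simp only [Pi.mul_apply]
  field_simp

theorem integrable_radial_mul_eval (hq : 0 < q) {h : ℝ → ℝ} {m : ℕ}
    (hh : Integrable fun z : Fin q → ℝ => h (z ⬝ᵥ z) * (z ⬝ᵥ z) ^ m)
    {P : MvPolynomial (Fin q) ℝ} (hP : P.IsHomogeneous (2 * m)) :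
    Integrable fun z : Fin q → ℝ => h (z ⬝ᵥ z) * MvPolynomial.eval z P := by
  refine (hh.abs.const_mul (∑ d ∈ P.support, |P.coeff d|)).mono'
    (aestronglyMeasurable_radial_mul hq hh (MvPolynomial.continuous_eval P))
    (.of_forall fun z => ?_)
  rw [Real.norm_eq_abs, abs_mul, abs_mul, abs_of_nonneg (pow_nonneg (dotProduct_self_nonneg' z) m)]
  calc _ ≤ |h (z ⬝ᵥ z)| * ((∑ d ∈ P.support, |P.coeff d|) * (z ⬝ᵥ z) ^ m) :=
        mul_le_mul_of_nonneg_left (abs_eval_le hP z) (abs_nonneg _)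
    _ = _ := by ring

/-- The rotation by the angle `φ` in the coordinate plane `(a, b)`. -/
def planeRot (a b : Fin q) (φ : ℝ) : (Fin q → ℝ) →ₗ[ℝ] Fin q → ℝ where
  toFun z i := if i = a then Real.cos φ * z a - Real.sin φ * z b
    else if i = b then Real.sin φ * z a + Real.cos φ * z b else z i
  map_add' x y := by
    ext i
    simp only [Pi.add_apply]
    split_ifs <;> ring
  map_smul' c x := by
    ext i
    simp only [Pi.smul_apply, smul_eq_mul, RingHom.id_apply]
    split_ifs <;> ring

theorem planeRot_apply (a b : Fin q) (φ : ℝ) (z : Fin q → ℝ) (i : Fin q) :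
    planeRot a b φ z i = if i = a then Real.cos φ * z a - Real.sin φ * z b
    else if i = b then Real.sin φ * z a + Real.cos φ * z b else z i := rfl

theorem planeRot_zero (a b : Fin q) (z : Fin q → ℝ) : planeRot a b 0 z = z := by
  ext i
  rw [planeRot_apply]
  split_ifs with h1 h2 <;> simp_all

theorem planeRot_dotProduct {a b : Fin q} (hab : a ≠ b) (φ : ℝ) (x y : Fin q → ℝ) :
    planeRot a b φ x ⬝ᵥ planeRot a b φ y = x ⬝ᵥ y := by
  have hb : b ∈ Finset.univ.erase a := by simp [hab.symm]
  simp only [dotProduct]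
  rw [← Finset.add_sum_erase _ _ (Finset.mem_univ a), ← Finset.add_sum_erase _ _ hb,
    ← Finset.add_sum_erase _ (fun i => x i * y i) (Finset.mem_univ a),
    ← Finset.add_sum_erase _ (fun i => x i * y i) hb, ← add_assoc, ← add_assoc]
  congr 1
  · simp only [planeRot_apply, if_true, hab.symm, if_false]
    linear_combination (x a * y a + x b * y b) * Real.sin_sq_add_cos_sq φ
  · refine Finset.sum_congr rfl fun i hi => ?_
    simp only [Finset.mem_erase, Finset.mem_univ, and_true] at hi
    simp [planeRot_apply, hi.1, hi.2]

/-- The matrix is orthogonal, so its determinant is `±1`; the sign is irrelevant for Lebesgue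
measure. -/
theorem measurePreserving_planeRot {a b : Fin q} (hab : a ≠ b) (φ : ℝ) :
    MeasurePreserving (planeRot a b φ) := by
  have hM : (LinearMap.toMatrix' (planeRot a b φ))ᵀ * LinearMap.toMatrix' (planeRot a b φ)
      = 1 := by
    ext i j
    have := planeRot_dotProduct hab φ (Pi.single i 1) (Pi.single j 1)
    rw [single_one_dotProduct] at this
    rw [Matrix.mul_apply]
    simp only [Matrix.transpose_apply, LinearMap.toMatrix'_apply, Matrix.one_apply,
      Pi.single_apply] at this ⊢
    exact this
  have hdet : LinearMap.det (planeRot a b φ) * LinearMap.det (planeRot a b φ) = 1 := by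
    have := congrArg Matrix.det hM
    rwa [Matrix.det_mul, Matrix.det_transpose, LinearMap.det_toMatrix', Matrix.det_one] at this
  have h0 : LinearMap.det (planeRot a b φ) ≠ 0 := left_ne_zero_of_mul_eq_one hdet
  refine ⟨(LinearMap.continuous_on_pi _).measurable, ?_⟩
  rw [Real.map_linearMap_volume_pi_eq_smul_volume_pi h0]
  rcases mul_self_eq_one_iff.1 hdet with h | h <;> simp [h]

/-- Infinitesimal rotation invariance. -/
theorem integral_radial_mul_rot (hq : 0 < q) {h : ℝ → ℝ} {m : ℕ}
    (hh : Integrable fun z : Fin q → ℝ => h (z ⬝ᵥ z) * (z ⬝ᵥ z) ^ m)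
    {P : MvPolynomial (Fin q) ℝ} (hP : P.IsHomogeneous (2 * m)) (a b : Fin q) :
    ∫ z : Fin q → ℝ, h (z ⬝ᵥ z) * MvPolynomial.eval z
      (MvPolynomial.X a * MvPolynomial.pderiv b P - MvPolynomial.X b * MvPolynomial.pderiv a P)
      = 0 := by
  rcases eq_or_ne a b with rfl | hab
  · simp
  -- In degree zero `P` is constant and `D = 0`. This case is separated because the degree count
  -- below uses the natural number `2m - 1`.
  rcases Nat.eq_zero_or_pos m with rfl | hm
  · obtain ⟨c, rfl⟩ : ∃ c, P = MvPolynomial.C c :=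
      ⟨_, MvPolynomial.totalDegree_eq_zero_iff_eq_C.1
        ((MvPolynomial.totalDegree_zero_iff_isHomogeneous _).2 (by simpa using hP))⟩
    simp
  set D := MvPolynomial.X a * MvPolynomial.pderiv b P - MvPolynomial.X b * MvPolynomial.pderiv a P
    with hD
  have hDh : D.IsHomogeneous (2 * m) := by
    have e : 2 * m = 1 + (2 * m - 1) := by omega
    rw [e]
    exact ((MvPolynomial.isHomogeneous_X ℝ a).mul hP.pderiv).sub
      ((MvPolynomial.isHomogeneous_X ℝ b).mul hP.pderiv)
  have hcont : ∀ φ, Continuous (planeRot a b φ) := fun φ => LinearMap.continuous_on_pi _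
  -- The velocity of the rotation at a point is `-z_b e_a + z_a e_b`, and `D` is the derivative of
  -- `P` along this field.
  have hderiv : ∀ (z : Fin q → ℝ) (φ : ℝ),
      HasDerivAt (fun φ => MvPolynomial.eval (planeRot a b φ z) P)
        (MvPolynomial.eval (planeRot a b φ z) D) φ := by
    intro z φ
    have := hasDerivAt_eval P (γ := fun φ => planeRot a b φ z) (x := φ)
      (γ' := fun i => if i = a then - planeRot a b φ z b else
        if i = b then planeRot a b φ z a else 0) ?_
    · refine this.congr_deriv ?_
      have hb : b ∈ Finset.univ.erase a := by simp [hab.symm]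
      rw [← Finset.add_sum_erase _ _ (Finset.mem_univ a), ← Finset.add_sum_erase _ _ hb,
        Finset.sum_eq_zero]
      · simp only [if_true, hab.symm, if_false, hD, map_sub, map_mul, MvPolynomial.eval_X]
        ring
      · intro i hi
        simp only [Finset.mem_erase, Finset.mem_univ, and_true] at hi
        simp [hi.1, hi.2]
    · intro i
      have hc := Real.hasDerivAt_cos φ
      have hs := Real.hasDerivAt_sin φ
      simp only [planeRot_apply]
      rcases eq_or_ne i a with rfl | hia
      · simp only [if_true, hab.symm, if_false]
        exact ((hc.mul_const _).sub (hs.mul_const _)).congr_deriv (by ring)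
      · rcases eq_or_ne i b with rfl | hib
        · simp only [if_true, hia, if_false]
          exact ((hs.mul_const _).add (hc.mul_const _)).congr_deriv (by ring)
        · simp only [hia, hib, if_false]
          exact hasDerivAt_const _ _
  have hconst : ∀ φ, ∫ z : Fin q → ℝ, h (z ⬝ᵥ z) * MvPolynomial.eval (planeRot a b φ z) P
      = ∫ z : Fin q → ℝ, h (z ⬝ᵥ z) * MvPolynomial.eval z P := by
    intro φ
    have hmp := measurePreserving_planeRot hab φ
    have e := integral_map (φ := planeRot a b φ) hmp.measurable.aemeasurable
      (f := fun z : Fin q → ℝ => h (z ⬝ᵥ z) * MvPolynomial.eval z P) (by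
        rw [hmp.map_eq]
        exact (integrable_radial_mul_eval hq hh hP).aestronglyMeasurable)
    rw [hmp.map_eq] at e
    simp only [planeRot_dotProduct hab] at e
    exact e.symm
  -- Rotations preserve `z ⬝ᵥ z`, so the bound on `D` is independent of the angle. The integral is
  -- constant in the angle, and its derivative at `0` is the claimed integral.
  have key := (hasDerivAt_integral_of_dominated_loc_of_deriv_le (μ := (volume : Measure (Fin q → ℝ)))
    (x₀ := (0 : ℝ)) (F := fun φ z => h (z ⬝ᵥ z) * MvPolynomial.eval (planeRot a b φ z) P)
    (F' := fun φ z => h (z ⬝ᵥ z) * MvPolynomial.eval (planeRot a b φ z) D)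
    (bound := fun z => (∑ d ∈ D.support, |D.coeff d|) * |h (z ⬝ᵥ z) * (z ⬝ᵥ z) ^ m|)
    univ_mem (.of_forall fun φ => aestronglyMeasurable_radial_mul hq hh
      ((MvPolynomial.continuous_eval P).comp (hcont φ)))
    (by simpa only [planeRot_zero] using integrable_radial_mul_eval hq hh hP)
    (aestronglyMeasurable_radial_mul hq hh ((MvPolynomial.continuous_eval D).comp (hcont 0)))
    (.of_forall fun z φ _ => by
      rw [Real.norm_eq_abs, abs_mul, abs_mul,
        abs_of_nonneg (pow_nonneg (dotProduct_self_nonneg' z) m)]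
      have := abs_eval_le hDh (planeRot a b φ z)
      rw [planeRot_dotProduct hab] at this
      calc _ ≤ |h (z ⬝ᵥ z)| * ((∑ d ∈ D.support, |D.coeff d|) * (z ⬝ᵥ z) ^ m) :=
            mul_le_mul_of_nonneg_left this (abs_nonneg _)
        _ = _ := by ring)
    (hh.abs.const_mul _)
    (.of_forall fun z φ _ => (hderiv z φ).const_mul _)).2
  simp only [hconst, planeRot_zero] at key
  exact key.unique (hasDerivAt_const _ _)

/-- `(q + d - 1) E(h z_a Q) = E(h |z|² ∂_a Q)` for a homogeneous polynomial `Q` of degree `d`. -/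
theorem integral_radial_mul_X (hq : 0 < q) {h : ℝ → ℝ} {m d : ℕ} (hd : d + 1 = 2 * m)
    (hh : Integrable fun z : Fin q → ℝ => h (z ⬝ᵥ z) * (z ⬝ᵥ z) ^ m)
    {Q : MvPolynomial (Fin q) ℝ} (hQ : Q.IsHomogeneous d) (a : Fin q) :
    (q + d - 1 : ℝ) * ∫ z : Fin q → ℝ, h (z ⬝ᵥ z) * (z a * MvPolynomial.eval z Q)
      = ∫ z : Fin q → ℝ, h (z ⬝ᵥ z) *
        ((z ⬝ᵥ z) * MvPolynomial.eval z (MvPolynomial.pderiv a Q)) := by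
  classical
  have hXQ : ∀ b, (MvPolynomial.X b * Q).IsHomogeneous (2 * m) := fun b => by
    rw [← hd, add_comm]
    exact (MvPolynomial.isHomogeneous_X ℝ b).mul hQ
  have hDh : ∀ b, (MvPolynomial.X a * MvPolynomial.pderiv b (MvPolynomial.X b * Q)
      - MvPolynomial.X b * MvPolynomial.pderiv a (MvPolynomial.X b * Q)).IsHomogeneous (2 * m) := by
    intro b
    have e : 2 * m = 1 + (2 * m - 1) := by omega
    conv => arg 2; rw [e]
    exact ((MvPolynomial.isHomogeneous_X ℝ a).mul (hXQ b).pderiv).sub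
      ((MvPolynomial.isHomogeneous_X ℝ b).mul (hXQ b).pderiv)
  -- Rotation invariance in the plane `(a, b)` is applied to `z_b Q` and summed over `b`.
  have hsum := Finset.sum_congr rfl fun b (_ : b ∈ Finset.univ) =>
    integral_radial_mul_rot hq hh (hXQ b) a b
  rw [← integral_finsetSum _ fun b _ => integrable_radial_mul_eval hq hh (hDh b),
    Finset.sum_const_zero] at hsum
  have hE : ∀ z : Fin q → ℝ, ∑ b, z b * MvPolynomial.eval z (MvPolynomial.pderiv b Q)
      = d * MvPolynomial.eval z Q := by
    intro z
    have := congrArg (MvPolynomial.eval z) hQ.sum_X_mul_pderiv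
    simpa using this
  -- In the factor `q + d - 1`, the `q` counts the terms `∂_b z_b = 1`, the `d` comes from Euler's
  -- identity, and the `-1` from `∂_a z_b`, which is nonzero only for `b = a`.
  have hpt : ∀ z : Fin q → ℝ, ∑ b, h (z ⬝ᵥ z) * MvPolynomial.eval z
      (MvPolynomial.X a * MvPolynomial.pderiv b (MvPolynomial.X b * Q)
        - MvPolynomial.X b * MvPolynomial.pderiv a (MvPolynomial.X b * Q))
      = (q + d - 1 : ℝ) * (h (z ⬝ᵥ z) * (z a * MvPolynomial.eval z Q))
        - h (z ⬝ᵥ z) * ((z ⬝ᵥ z) * MvPolynomial.eval z (MvPolynomial.pderiv a Q)) := by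
    intro z
    have e1 : ∀ b, MvPolynomial.eval z
        (MvPolynomial.X a * MvPolynomial.pderiv b (MvPolynomial.X b * Q)
          - MvPolynomial.X b * MvPolynomial.pderiv a (MvPolynomial.X b * Q))
        = z a * (MvPolynomial.eval z Q + z b * MvPolynomial.eval z (MvPolynomial.pderiv b Q))
          - ((if b = a then z a else 0) * MvPolynomial.eval z Q
            + z b * z b * MvPolynomial.eval z (MvPolynomial.pderiv a Q)) := by
      intro b
      simp only [MvPolynomial.pderiv_mul, MvPolynomial.pderiv_X, Pi.single_apply, map_sub, map_mul,
        map_add, MvPolynomial.eval_X, if_true, map_one]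
      split_ifs with h1
      · subst h1
        simp
        ring
      · simp
        ring
    rw [← Finset.mul_sum]
    simp only [e1, Finset.sum_sub_distrib, Finset.sum_add_distrib, ← Finset.mul_sum, hE,
      ← Finset.sum_mul, Finset.sum_const, Finset.card_univ, Fintype.card_fin, nsmul_eq_mul,
      Finset.sum_ite_eq', Finset.mem_univ, if_true]
    simp only [dotProduct]
    ring
  simp only [hpt] at hsum
  have hXa := integrable_radial_mul_eval hq hh (hXQ a)
  simp only [map_mul, MvPolynomial.eval_X] at hXa
  have hY : Integrable fun z : Fin q → ℝ => h (z ⬝ᵥ z) *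
        ((z ⬝ᵥ z) * MvPolynomial.eval z (MvPolynomial.pderiv a Q)) := by
    have h1 := integrable_finsetSum (μ := (volume : Measure (Fin q → ℝ))) Finset.univ
      fun b _ => integrable_radial_mul_eval hq hh (hDh b)
    simp only [hpt] at h1
    refine (((hXa.const_mul (q + d - 1 : ℝ))).sub h1).congr (.of_forall fun z => ?_)
    simp
  rw [integral_sub (hXa.const_mul _) hY, integral_const_mul] at hsum
  linarith

/-- The quadratic form `zᵀ B z` as a polynomial. -/
def quadPoly (B : Matrix (Fin q) (Fin q) ℝ) : MvPolynomial (Fin q) ℝ :=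
  ∑ i, ∑ j, MvPolynomial.C (B i j) * (MvPolynomial.X i * MvPolynomial.X j)

/-- The linear form `(B z)_a` as a polynomial. -/
def linPoly (B : Matrix (Fin q) (Fin q) ℝ) (a : Fin q) : MvPolynomial (Fin q) ℝ :=
  ∑ j, MvPolynomial.C (B a j) * MvPolynomial.X j

theorem eval_linPoly (B : Matrix (Fin q) (Fin q) ℝ) (a : Fin q) (z : Fin q → ℝ) :
    MvPolynomial.eval z (linPoly B a) = (B *ᵥ z) a := by
  simp [linPoly, Matrix.mulVec, dotProduct]

theorem eval_quadPoly (B : Matrix (Fin q) (Fin q) ℝ) (z : Fin q → ℝ) :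
    MvPolynomial.eval z (quadPoly B) = z ⬝ᵥ (B *ᵥ z) := by
  simp only [quadPoly, map_sum, map_mul, MvPolynomial.eval_C, MvPolynomial.eval_X, Matrix.mulVec,
    dotProduct, Finset.mul_sum]
  exact Finset.sum_congr rfl fun i _ => Finset.sum_congr rfl fun j _ => by ring

theorem isHomogeneous_linPoly (B : Matrix (Fin q) (Fin q) ℝ) (a : Fin q) :
    (linPoly B a).IsHomogeneous 1 :=
  MvPolynomial.IsHomogeneous.sum _ _ _ fun _ _ => MvPolynomial.isHomogeneous_C_mul_X _ _

theorem isHomogeneous_quadPoly (B : Matrix (Fin q) (Fin q) ℝ) : (quadPoly B).IsHomogeneous 2 :=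
  MvPolynomial.IsHomogeneous.sum _ _ _ fun i _ => MvPolynomial.IsHomogeneous.sum _ _ _ fun j _ =>
    ((MvPolynomial.isHomogeneous_X ℝ i).mul (MvPolynomial.isHomogeneous_X ℝ j)).C_mul _

theorem pderiv_linPoly (B : Matrix (Fin q) (Fin q) ℝ) (a b : Fin q) :
    MvPolynomial.pderiv b (linPoly B a) = MvPolynomial.C (B a b) := by
  classical
  simp only [linPoly, map_sum, MvPolynomial.pderiv_C_mul, MvPolynomial.pderiv_X]
  rw [Finset.sum_eq_single b]
  · simp
  · intro i _ hi
    simp [hi]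
  · simp

theorem quadPoly_eq_sum (B : Matrix (Fin q) (Fin q) ℝ) :
    quadPoly B = ∑ i, MvPolynomial.X i * linPoly B i := by
  simp only [quadPoly, linPoly, Finset.mul_sum]
  exact Finset.sum_congr rfl fun i _ => Finset.sum_congr rfl fun j _ => by ring

theorem eval_pderiv_quadPoly {D : Matrix (Fin q) (Fin q) ℝ} (hD : D.IsSymm) (a : Fin q)
    (z : Fin q → ℝ) :
    MvPolynomial.eval z (MvPolynomial.pderiv a (quadPoly D)) = 2 * (D *ᵥ z) a := by
  classical
  have e : ∀ i, MvPolynomial.eval z (MvPolynomial.pderiv a (MvPolynomial.X i * linPoly D i))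
      = (if i = a then (D *ᵥ z) i else 0) + z i * D i a := by
    intro i
    rw [MvPolynomial.pderiv_mul, pderiv_linPoly, MvPolynomial.pderiv_X, map_add, map_mul, map_mul,
      eval_linPoly, MvPolynomial.eval_X, MvPolynomial.eval_C, Pi.single_apply]
    by_cases h : i = a
    · simp [h]
    · simp [h]
  rw [quadPoly_eq_sum, map_sum, map_sum, Finset.sum_congr rfl fun i _ => e i,
    Finset.sum_add_distrib, Finset.sum_ite_eq' Finset.univ a, if_pos (Finset.mem_univ a), two_mul]
  congr 1
  simp only [Matrix.mulVec, dotProduct]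
  exact Finset.sum_congr rfl fun i _ => by rw [← hD.apply, mul_comm]

/-- Removal of a quadratic form from a radial moment. -/
theorem integral_radial_mul_quadPoly (hq : 0 < q) {h : ℝ → ℝ} {m d : ℕ} (hd : d + 2 = 2 * m)
    (hh : Integrable fun z : Fin q → ℝ => h (z ⬝ᵥ z) * (z ⬝ᵥ z) ^ m)
    (B : Matrix (Fin q) (Fin q) ℝ) {R : MvPolynomial (Fin q) ℝ} (hR : R.IsHomogeneous d) :
    (q + d : ℝ) * ∫ z : Fin q → ℝ, h (z ⬝ᵥ z) * ((z ⬝ᵥ (B *ᵥ z)) * MvPolynomial.eval z R)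
      = ∫ z : Fin q → ℝ, (h (z ⬝ᵥ z) * (z ⬝ᵥ z)) * (B.trace * MvPolynomial.eval z R
          + ∑ a, (B *ᵥ z) a * MvPolynomial.eval z (MvPolynomial.pderiv a R)) := by
  have hQ : ∀ a, (linPoly B a * R).IsHomogeneous (d + 1) := fun a => by
    rw [add_comm]
    exact (isHomogeneous_linPoly B a).mul hR
  -- With `zᵀ B z = ∑ z_a (B z)_a`, the coordinate `z_a` is removed against `(B z)_a R`, which has
  -- degree `d + 1`. This gives the factor `q + (d + 1) - 1 = q + d`.
  have h1 := Finset.sum_congr rfl fun a (_ : a ∈ Finset.univ) =>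
    integral_radial_mul_X hq (by omega) hh (hQ a) a
  have hi1 : ∀ a, Integrable fun z : Fin q → ℝ =>
      h (z ⬝ᵥ z) * (z a * MvPolynomial.eval z (linPoly B a * R)) := by
    intro a
    have := integrable_radial_mul_eval hq hh (P := MvPolynomial.X a * (linPoly B a * R)) (by
      rw [← hd, add_comm d 2, show 2 + d = 1 + (d + 1) by ring]
      exact (MvPolynomial.isHomogeneous_X ℝ a).mul (hQ a))
    simpa only [map_mul, MvPolynomial.eval_X] using this
  have hi2 : ∀ a, Integrable fun z : Fin q → ℝ => h (z ⬝ᵥ z) *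
      ((z ⬝ᵥ z) * MvPolynomial.eval z (MvPolynomial.pderiv a (linPoly B a * R))) := by
    intro a
    have := integrable_radial_mul_eval hq hh
      (P := quadPoly 1 * MvPolynomial.pderiv a (linPoly B a * R)) (by
      rw [← hd, add_comm d 2]
      exact (isHomogeneous_quadPoly 1).mul (hQ a).pderiv)
    simpa only [map_mul, eval_quadPoly, Matrix.one_mulVec] using this
  rw [← Finset.mul_sum, ← integral_finsetSum _ fun a _ => hi1 a,
    ← integral_finsetSum _ fun a _ => hi2 a] at h1
  have e : (q + d : ℝ) = q + (d + 1 : ℕ) - 1 := by push_cast; ring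
  rw [e]
  refine Eq.trans ?_ (h1.trans ?_)
  · congr 2
    ext z
    rw [← Finset.mul_sum]
    congr 1
    simp only [map_mul, eval_linPoly]
    generalize B *ᵥ z = w
    rw [dotProduct, Finset.sum_mul]
    exact Finset.sum_congr rfl fun a _ => by ring
  · congr 1
    ext z
    rw [← Finset.mul_sum, ← Finset.mul_sum, mul_assoc]
    congr 2
    rw [Matrix.trace, Finset.sum_mul, ← Finset.sum_add_distrib]
    refine Finset.sum_congr rfl fun a _ => ?_
    rw [MvPolynomial.pderiv_mul, pderiv_linPoly, map_add, map_mul, map_mul, eval_linPoly,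
      MvPolynomial.eval_C, Matrix.diag_apply]

theorem integrable_quad_one (hq : 0 < q) {h : ℝ → ℝ}
    (hh : Integrable fun z : Fin q → ℝ => h (z ⬝ᵥ z) * (z ⬝ᵥ z) ^ 1)
    (B : Matrix (Fin q) (Fin q) ℝ) :
    Integrable fun z : Fin q → ℝ => h (z ⬝ᵥ z) * (z ⬝ᵥ (B *ᵥ z)) := by
  have := integrable_radial_mul_eval hq hh (P := quadPoly B) (isHomogeneous_quadPoly B)
  simpa only [eval_quadPoly] using this

theorem integrable_quad_two (hq : 0 < q) {h : ℝ → ℝ}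
    (hh : Integrable fun z : Fin q → ℝ => h (z ⬝ᵥ z) * (z ⬝ᵥ z) ^ 2)
    (B D : Matrix (Fin q) (Fin q) ℝ) :
    Integrable fun z : Fin q → ℝ => h (z ⬝ᵥ z) * ((z ⬝ᵥ (B *ᵥ z)) * (z ⬝ᵥ (D *ᵥ z))) := by
  have := integrable_radial_mul_eval hq hh (P := quadPoly B * quadPoly D)
    ((isHomogeneous_quadPoly B).mul (isHomogeneous_quadPoly D))
  simpa only [eval_quadPoly, map_mul] using this

theorem integrable_quad_three (hq : 0 < q) {h : ℝ → ℝ}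
    (hh : Integrable fun z : Fin q → ℝ => h (z ⬝ᵥ z) * (z ⬝ᵥ z) ^ 3)
    (B D E : Matrix (Fin q) (Fin q) ℝ) :
    Integrable fun z : Fin q → ℝ =>
      h (z ⬝ᵥ z) * ((z ⬝ᵥ (B *ᵥ z)) * (z ⬝ᵥ (D *ᵥ z)) * (z ⬝ᵥ (E *ᵥ z))) := by
  have := integrable_radial_mul_eval hq hh (P := quadPoly B * quadPoly D * quadPoly E)
    (((isHomogeneous_quadPoly B).mul (isHomogeneous_quadPoly D)).mul (isHomogeneous_quadPoly E))
  simpa only [eval_quadPoly, map_mul] using this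

theorem integral_quad_one (hq : 0 < q) {h : ℝ → ℝ}
    (hh : Integrable fun z : Fin q → ℝ => h (z ⬝ᵥ z) * (z ⬝ᵥ z) ^ 1)
    (B : Matrix (Fin q) (Fin q) ℝ) :
    ∫ z : Fin q → ℝ, h (z ⬝ᵥ z) * (z ⬝ᵥ (B *ᵥ z))
      = (∫ z : Fin q → ℝ, h (z ⬝ᵥ z) * (z ⬝ᵥ z) ^ 1) / q * B.trace := by
  have := integral_radial_mul_quadPoly hq (d := 0) rfl hh B (MvPolynomial.isHomogeneous_one _ _)
  simp only [map_one, mul_one, Nat.cast_zero, add_zero, map_zero, MvPolynomial.pderiv_one,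
    mul_zero, Finset.sum_const_zero, integral_mul_const] at this
  have hq' : (q : ℝ) ≠ 0 := by exact_mod_cast hq.ne'
  simp only [pow_one]
  field_simp
  linarith

theorem mulVec_dotProduct_mulVec (B D : Matrix (Fin q) (Fin q) ℝ) (z : Fin q → ℝ) :
    (B *ᵥ z) ⬝ᵥ (D *ᵥ z) = z ⬝ᵥ ((Bᵀ * D) *ᵥ z) := by
  rw [← Matrix.mulVec_mulVec, Matrix.dotProduct_mulVec z, Matrix.vecMul_transpose]

/-- Removing `zᵀ B z` gives the factor `q + 2` and leaves single quadratic forms against `u ↦ h(u)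
u`. Only `D` is differentiated, so only `D` has to be symmetric; a non-symmetric `B` is needed later
for products of two linear forms. -/
theorem integral_quad_two (hq : 0 < q) {h : ℝ → ℝ}
    (hh : Integrable fun z : Fin q → ℝ => h (z ⬝ᵥ z) * (z ⬝ᵥ z) ^ 2)
    (B : Matrix (Fin q) (Fin q) ℝ) {D : Matrix (Fin q) (Fin q) ℝ} (hD : D.IsSymm) :
    ∫ z : Fin q → ℝ, h (z ⬝ᵥ z) * ((z ⬝ᵥ (B *ᵥ z)) * (z ⬝ᵥ (D *ᵥ z)))
      = (∫ z : Fin q → ℝ, h (z ⬝ᵥ z) * (z ⬝ᵥ z) ^ 2) / (q * (q + 2)) *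
        (B.trace * D.trace + 2 * (Bᵀ * D).trace) := by
  have h1 := integral_radial_mul_quadPoly hq (d := 2) rfl hh B (isHomogeneous_quadPoly D)
  simp only [eval_quadPoly, eval_pderiv_quadPoly hD, mul_left_comm _ (2 : ℝ), ← Finset.mul_sum]
    at h1
  have hh1 : Integrable fun z : Fin q → ℝ => (fun u => h u * u) (z ⬝ᵥ z) * (z ⬝ᵥ z) ^ 1 :=
    hh.congr (.of_forall fun z => by simp only []; ring)
  have e : (fun z : Fin q → ℝ => (h (z ⬝ᵥ z) * (z ⬝ᵥ z)) * (B.trace * (z ⬝ᵥ (D *ᵥ z))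
      + 2 * ∑ a, (B *ᵥ z) a * (D *ᵥ z) a))
      = fun z : Fin q → ℝ => B.trace * ((h (z ⬝ᵥ z) * (z ⬝ᵥ z)) * (z ⬝ᵥ (D *ᵥ z)))
        + 2 * ((h (z ⬝ᵥ z) * (z ⬝ᵥ z)) * (z ⬝ᵥ ((Bᵀ * D) *ᵥ z))) := by
    ext z
    rw [← mulVec_dotProduct_mulVec]
    simp only [dotProduct]
    ring
  rw [e, integral_add ((integrable_quad_one hq (h := fun u => h u * u) hh1 D).const_mul _)
    ((integrable_quad_one hq (h := fun u => h u * u) hh1 _).const_mul _),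
    integral_const_mul, integral_const_mul,
    integral_quad_one hq (h := fun u => h u * u) hh1 D,
    integral_quad_one hq (h := fun u => h u * u) hh1 (Bᵀ * D)] at h1
  have e2 : ∫ z : Fin q → ℝ, h (z ⬝ᵥ z) * (z ⬝ᵥ z) * (z ⬝ᵥ z) ^ 1
      = ∫ z : Fin q → ℝ, h (z ⬝ᵥ z) * (z ⬝ᵥ z) ^ 2 := by
    congr 1
    ext z
    ring
  simp only [e2] at h1
  have hq' : (0 : ℝ) < q := by exact_mod_cast hq
  push_cast at h1
  field_simp
  field_simp at h1
  linarith

/-- One removal gives the factor `q + 4` and reduces to products of two forms. The coefficient `8`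
arises as `2 · 2 + 2 · 2`, both cubic traces being `tr(B D E)` for symmetric matrices. -/
theorem integral_quad_three (hq : 0 < q) {h : ℝ → ℝ}
    (hh : Integrable fun z : Fin q → ℝ => h (z ⬝ᵥ z) * (z ⬝ᵥ z) ^ 3)
    {B D E : Matrix (Fin q) (Fin q) ℝ} (hB : B.IsSymm) (hD : D.IsSymm) (hE : E.IsSymm) :
    ∫ z : Fin q → ℝ, h (z ⬝ᵥ z) * ((z ⬝ᵥ (B *ᵥ z)) * (z ⬝ᵥ (D *ᵥ z)) * (z ⬝ᵥ (E *ᵥ z)))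
      = (∫ z : Fin q → ℝ, h (z ⬝ᵥ z) * (z ⬝ᵥ z) ^ 3) / (q * (q + 2) * (q + 4)) *
        (B.trace * D.trace * E.trace + 2 * (B.trace * (D * E).trace + D.trace * (B * E).trace
          + E.trace * (B * D).trace) + 8 * (B * D * E).trace) := by
  have h1 := integral_radial_mul_quadPoly hq (d := 4) rfl hh B
    ((isHomogeneous_quadPoly D).mul (isHomogeneous_quadPoly E))
  simp only [MvPolynomial.pderiv_mul, map_mul, map_add, eval_quadPoly, eval_pderiv_quadPoly hD,
    eval_pderiv_quadPoly hE] at h1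
  have hh1 : Integrable fun z : Fin q → ℝ => (fun u => h u * u) (z ⬝ᵥ z) * (z ⬝ᵥ z) ^ 2 :=
    hh.congr (.of_forall fun z => by simp only []; ring)
  have hsum : ∀ z : Fin q → ℝ, ∑ a, (B *ᵥ z) a *
      (2 * (D *ᵥ z) a * (z ⬝ᵥ (E *ᵥ z)) + (z ⬝ᵥ (D *ᵥ z)) * (2 * (E *ᵥ z) a))
      = 2 * ((z ⬝ᵥ ((B * D) *ᵥ z)) * (z ⬝ᵥ (E *ᵥ z)))
        + 2 * ((z ⬝ᵥ ((B * E) *ᵥ z)) * (z ⬝ᵥ (D *ᵥ z))) := by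
    intro z
    have e1 := mulVec_dotProduct_mulVec B D z
    have e2 := mulVec_dotProduct_mulVec B E z
    rw [hB.eq] at e1 e2
    rw [← e1, ← e2]
    generalize z ⬝ᵥ (D *ᵥ z) = x
    generalize z ⬝ᵥ (E *ᵥ z) = y
    simp only [dotProduct, Finset.sum_mul, Finset.mul_sum, ← Finset.sum_add_distrib]
    exact Finset.sum_congr rfl fun a _ => by ring
  simp only [hsum] at h1
  have e : (fun z : Fin q → ℝ => (h (z ⬝ᵥ z) * (z ⬝ᵥ z)) * (B.trace * ((z ⬝ᵥ (D *ᵥ z)) *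
        (z ⬝ᵥ (E *ᵥ z))) + (2 * ((z ⬝ᵥ ((B * D) *ᵥ z)) * (z ⬝ᵥ (E *ᵥ z)))
        + 2 * ((z ⬝ᵥ ((B * E) *ᵥ z)) * (z ⬝ᵥ (D *ᵥ z))))))
      = fun z : Fin q → ℝ =>
        B.trace * ((h (z ⬝ᵥ z) * (z ⬝ᵥ z)) * ((z ⬝ᵥ (D *ᵥ z)) * (z ⬝ᵥ (E *ᵥ z))))
        + (2 * ((h (z ⬝ᵥ z) * (z ⬝ᵥ z)) * ((z ⬝ᵥ ((B * D) *ᵥ z)) * (z ⬝ᵥ (E *ᵥ z))))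
        + 2 * ((h (z ⬝ᵥ z) * (z ⬝ᵥ z)) * ((z ⬝ᵥ ((B * E) *ᵥ z)) * (z ⬝ᵥ (D *ᵥ z))))) := by
    ext z
    ring
  have i1 := (integrable_quad_two hq (h := fun u => h u * u) hh1 D E).const_mul B.trace
  have i2 := (integrable_quad_two hq (h := fun u => h u * u) hh1 (B * D) E).const_mul 2
  have i3 := (integrable_quad_two hq (h := fun u => h u * u) hh1 (B * E) D).const_mul 2
  have a1 := integral_add i1 (i2.add i3)
  have a2 := integral_add i2 i3
  simp only [Pi.add_apply] at a1
  rw [e, a1, a2, integral_const_mul, integral_const_mul, integral_const_mul,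
    integral_quad_two hq (h := fun u => h u * u) hh1 D hE, integral_quad_two hq (h := fun u => h u * u) hh1 (B * D) hE,
    integral_quad_two hq (h := fun u => h u * u) hh1 (B * E) hD] at h1
  have e2 : ∫ z : Fin q → ℝ, h (z ⬝ᵥ z) * (z ⬝ᵥ z) * (z ⬝ᵥ z) ^ 2
      = ∫ z : Fin q → ℝ, h (z ⬝ᵥ z) * (z ⬝ᵥ z) ^ 3 := by
    congr 1
    ext z
    ring
  have t1 : ((B * D)ᵀ * E).trace = (B * D * E).trace := by
    rw [← Matrix.trace_transpose, Matrix.transpose_mul, Matrix.transpose_transpose, hE.eq,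
      Matrix.trace_mul_comm]
  have t2 : ((B * E)ᵀ * D).trace = (B * D * E).trace := by
    rw [Matrix.transpose_mul, hB.eq, hE.eq, Matrix.mul_assoc, Matrix.trace_mul_comm]
  rw [hD.eq, t1, t2] at h1
  simp only [e2] at h1
  have hq' : (0 : ℝ) < q := by exact_mod_cast hq
  push_cast at h1
  field_simp
  field_simp at h1
  linarith

end Spherical

/-! ### Elliptical densities: change of variables and moments -/

section Elliptical

variable {q : ℕ}

section SquareRoot

open scoped MatrixOrder Matrix.Norms.L2Operator

/-- Positivity in the C*-algebra of matrices supplies a factorization. Any factor will do; symmetry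
of `R` is never used. -/
theorem exists_mul_transpose_eq {S : Matrix (Fin q) (Fin q) ℝ} (hS : S.PosDef) :
    ∃ R : Matrix (Fin q) (Fin q) ℝ, R * Rᵀ = S := by
  obtain ⟨B, hB⟩ := CStarAlgebra.nonneg_iff_eq_star_mul_self.mp hS.posSemidef.nonneg
  refine ⟨Bᵀ, ?_⟩
  rw [hB, Matrix.star_eq_conjTranspose, Matrix.conjTranspose_eq_transpose_of_trivial,
    Matrix.transpose_transpose]

end SquareRoot

theorem map_mulVec_volume {R : Matrix (Fin q) (Fin q) ℝ} (hR : R.det ≠ 0) :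
    Measure.map (fun z => R *ᵥ z) volume
      = ENNReal.ofReal |R.det|⁻¹ • (volume : Measure (Fin q → ℝ)) := by
  have := Real.map_linearMap_volume_pi_eq_smul_volume_pi (f := Matrix.toLin' R)
    (by rwa [LinearMap.det_toLin'])
  rw [LinearMap.det_toLin', abs_inv] at this
  exact this

theorem measurableEmbedding_mulVec {R : Matrix (Fin q) (Fin q) ℝ} (hR : R.det ≠ 0) :
    MeasurableEmbedding fun z : Fin q → ℝ => R *ᵥ z := by
  refine Continuous.measurableEmbedding ?_ ?_
  · exact (Matrix.toLin' R).continuous_on_pi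
  · exact Matrix.mulVec_injective_iff_isUnit.2
      ((Matrix.isUnit_iff_isUnit_det R).2 (isUnit_iff_ne_zero.2 hR))

variable {S : Matrix (Fin q) (Fin q) ℝ} {m : Fin q → ℝ} {g : ℝ → ℝ}

theorem mahal_add_mulVec {R : Matrix (Fin q) (Fin q) ℝ} (hRS : R * Rᵀ = S) (hR : R.det ≠ 0)
    (z : Fin q → ℝ) : mahal m S (R *ᵥ z + m) = z ⬝ᵥ z := by
  have hu : IsUnit R.det := isUnit_iff_ne_zero.2 hR
  have hut : IsUnit Rᵀ.det := by rwa [Matrix.det_transpose]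
  rw [mahal, add_sub_cancel_right, ← hRS, Matrix.mul_inv_rev, Matrix.mulVec_mulVec,
    Matrix.mul_assoc, Matrix.nonsing_inv_mul _ hu, Matrix.mul_one, dotProduct_comm,
    ← Matrix.vecMul_transpose, ← Matrix.dotProduct_mulVec, Matrix.mulVec_mulVec,
    Matrix.transpose_nonsing_inv, Matrix.transpose_transpose, Matrix.nonsing_inv_mul _ hu,
    Matrix.one_mulVec]

theorem ellipticalDensity_add_mulVec {R : Matrix (Fin q) (Fin q) ℝ} (hRS : R * Rᵀ = S)
    (hR : R.det ≠ 0) (z : Fin q → ℝ) :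
    ellipticalDensity g m S (R *ᵥ z + m) = |R.det|⁻¹ * g (z ⬝ᵥ z) := by
  rw [ellipticalDensity, mahal_add_mulVec hRS hR]
  congr 1
  rw [← hRS, Matrix.det_mul, Matrix.det_transpose, ← abs_mul_abs_self, ← sq,
    Real.rpow_neg (by positivity), ← Real.sqrt_eq_rpow, Real.sqrt_sq (abs_nonneg _)]

theorem det_ne_zero_of_mul_transpose {R : Matrix (Fin q) (Fin q) ℝ} (hRS : R * Rᵀ = S)
    (hS : S.PosDef) : R.det ≠ 0 := by
  intro h
  have := hS.det_pos
  rw [← hRS, Matrix.det_mul, h, zero_mul] at this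
  exact this.false

/-- Standardization `y = R z + m` of an elliptical integral. -/
theorem integral_elliptical {R : Matrix (Fin q) (Fin q) ℝ} (hRS : R * Rᵀ = S)
    (hR : R.det ≠ 0) (F : (Fin q → ℝ) → ℝ) :
    ∫ y, F y * ellipticalDensity g m S y = ∫ z, F (R *ᵥ z + m) * g (z ⬝ᵥ z) := by
  -- The map is a measurable embedding, so the change of variables holds for arbitrary `F`,
  -- integrable or not.
  have h1 := (measurableEmbedding_mulVec hR).integral_map (μ := volume)
    (fun v => F (v + m) * ellipticalDensity g m S (v + m))
  rw [map_mulVec_volume hR, integral_smul_measure,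
    integral_add_right_eq_self (fun y => F y * ellipticalDensity g m S y) m,
    ENNReal.toReal_ofReal (by positivity)] at h1
  simp only [ellipticalDensity_add_mulVec hRS hR, mul_left_comm _ |R.det|⁻¹,
    integral_const_mul, smul_eq_mul] at h1
  exact mul_left_cancel₀ (inv_ne_zero (abs_ne_zero.2 hR)) h1

theorem integrable_elliptical_iff {R : Matrix (Fin q) (Fin q) ℝ} (hRS : R * Rᵀ = S)
    (hR : R.det ≠ 0) (F : (Fin q → ℝ) → ℝ) :
    Integrable (fun y => F y * ellipticalDensity g m S y) ↔
      Integrable fun z => F (R *ᵥ z + m) * g (z ⬝ᵥ z) := by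
  have h1 := (measurableEmbedding_mulVec hR).integrable_map_iff (μ := volume)
    (g := fun v => F (v + m) * ellipticalDensity g m S (v + m))
  rw [map_mulVec_volume hR, integrable_smul_measure (by simpa using hR) (by simp)] at h1
  have h2 := (measurePreserving_add_right (volume : Measure (Fin q → ℝ)) m).integrable_comp_emb
    (measurableEmbedding_addRight m) (g := fun y => F y * ellipticalDensity g m S y)
  rw [← h2]
  refine h1.trans ?_
  simp only [Function.comp_def, ellipticalDensity_add_mulVec hRS hR, mul_left_comm _ |R.det|⁻¹]
  exact integrable_const_mul_iff (isUnit_iff_ne_zero.2 (inv_ne_zero (abs_ne_zero.2 hR))) _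

theorem dotProduct_mulVec_mulVec (R B : Matrix (Fin q) (Fin q) ℝ) (z : Fin q → ℝ) :
    (R *ᵥ z) ⬝ᵥ (B *ᵥ (R *ᵥ z)) = z ⬝ᵥ ((Rᵀ * B * R) *ᵥ z) := by
  rw [← Matrix.mulVec_mulVec, ← Matrix.mulVec_mulVec, Matrix.dotProduct_mulVec z,
    Matrix.vecMul_transpose]

theorem integrable_ellipticalDensity (hg : IsGenerator q g) (hS : S.PosDef) :
    Integrable (ellipticalDensity g m S) := by
  obtain ⟨R, hRS⟩ := exists_mul_transpose_eq hS
  have := (integrable_elliptical_iff (g := g) (m := m) hRS (det_ne_zero_of_mul_transpose hRS hS)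
    fun _ => 1).2 (by simpa using hg.integrable)
  simpa using this

theorem integral_ellipticalDensity (hg : IsGenerator q g) (hS : S.PosDef) :
    ∫ y, ellipticalDensity g m S y = 1 := by
  obtain ⟨R, hRS⟩ := exists_mul_transpose_eq hS
  have := integral_elliptical (g := g) (m := m) hRS (det_ne_zero_of_mul_transpose hRS hS)
    fun _ => 1
  simpa [hg.integral_eq_one] using this

theorem ellipticalDensity_pos (hg : IsGenerator q g) (hS : S.PosDef) (y : Fin q → ℝ) :
    0 < ellipticalDensity g m S y := by
  refine mul_pos (Real.rpow_pos_of_pos hS.det_pos _) (hg.pos _ ?_)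
  exact hS.inv.posSemidef.dotProduct_mulVec_nonneg (y - m)

theorem trace_transpose_mul_mul (R B : Matrix (Fin q) (Fin q) ℝ) :
    (Rᵀ * B * R).trace = (B * (R * Rᵀ)).trace := by
  rw [Matrix.trace_mul_comm, ← Matrix.mul_assoc, Matrix.trace_mul_comm]

theorem isSymm_transpose_mul_mul (R : Matrix (Fin q) (Fin q) ℝ) {B : Matrix (Fin q) (Fin q) ℝ}
    (hB : B.IsSymm) : (Rᵀ * B * R).IsSymm := by
  rw [Matrix.IsSymm, Matrix.transpose_mul, Matrix.transpose_mul, Matrix.transpose_transpose,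
    hB.eq, Matrix.mul_assoc]

/-- This exhibits the integrand as `h(|z|²) |z|^{2k}` with `h = W^l g`, the shape of the spherical
moment formulas. -/
theorem psiIntegrand_eq (l k : ℕ) : psiIntegrand q g l k
    = fun z : Fin q → ℝ => (fun u => W g u ^ l * g u) (z ⬝ᵥ z) * (z ⬝ᵥ z) ^ k := by
  ext z
  simp only [psiIntegrand]
  ring

/-- Second-order elliptical moments. -/
theorem elliptical_moment_one (hq : 0 < q) (hS : S.PosDef) {l : ℕ}
    (hi : Integrable (psiIntegrand q g l 1)) (B : Matrix (Fin q) (Fin q) ℝ) :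
    Integrable (fun y => W g (mahal m S y) ^ l * ((y - m) ⬝ᵥ (B *ᵥ (y - m)))
      * ellipticalDensity g m S y) ∧
    ∫ y, W g (mahal m S y) ^ l * ((y - m) ⬝ᵥ (B *ᵥ (y - m))) * ellipticalDensity g m S y
      = psi q g l 1 / q * (B * S).trace := by
  obtain ⟨R, hRS⟩ := exists_mul_transpose_eq hS
  have hR := det_ne_zero_of_mul_transpose hRS hS
  have hh := hi
  rw [psiIntegrand_eq] at hh
  have e : (fun z : Fin q → ℝ => W g (mahal m S (R *ᵥ z + m)) ^ l
      * ((R *ᵥ z + m - m) ⬝ᵥ (B *ᵥ (R *ᵥ z + m - m))) * g (z ⬝ᵥ z))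
      = fun z => W g (z ⬝ᵥ z) ^ l * g (z ⬝ᵥ z) * (z ⬝ᵥ ((Rᵀ * B * R) *ᵥ z)) := by
    ext z
    rw [mahal_add_mulVec hRS hR, add_sub_cancel_right, dotProduct_mulVec_mulVec]
    ring
  rw [integrable_elliptical_iff hRS hR fun y => W g (mahal m S y) ^ l *
    ((y - m) ⬝ᵥ (B *ᵥ (y - m))), integral_elliptical hRS hR fun y => W g (mahal m S y) ^ l *
    ((y - m) ⬝ᵥ (B *ᵥ (y - m))), e]
  refine ⟨integrable_quad_one hq (h := fun u => W g u ^ l * g u) hh _, (integral_quad_one hq (h := fun u => W g u ^ l * g u) hh _).trans ?_⟩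
  rw [psi, psiIntegrand_eq, trace_transpose_mul_mul, hRS]

/-- Fourth-order elliptical moments. -/
theorem elliptical_moment_two (hq : 0 < q) (hS : S.PosDef) {l : ℕ}
    (hi : Integrable (psiIntegrand q g l 2)) (B : Matrix (Fin q) (Fin q) ℝ)
    {D : Matrix (Fin q) (Fin q) ℝ} (hD : D.IsSymm) :
    Integrable (fun y => W g (mahal m S y) ^ l * (((y - m) ⬝ᵥ (B *ᵥ (y - m)))
      * ((y - m) ⬝ᵥ (D *ᵥ (y - m)))) * ellipticalDensity g m S y) ∧
    ∫ y, W g (mahal m S y) ^ l * (((y - m) ⬝ᵥ (B *ᵥ (y - m))) * ((y - m) ⬝ᵥ (D *ᵥ (y - m))))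
      * ellipticalDensity g m S y
      = psi q g l 2 / (q * (q + 2)) * ((B * S).trace * (D * S).trace
        + 2 * (Bᵀ * S * D * S).trace) := by
  obtain ⟨R, hRS⟩ := exists_mul_transpose_eq hS
  have hR := det_ne_zero_of_mul_transpose hRS hS
  have hh := hi
  rw [psiIntegrand_eq] at hh
  have e : (fun z : Fin q → ℝ => W g (mahal m S (R *ᵥ z + m)) ^ l
      * (((R *ᵥ z + m - m) ⬝ᵥ (B *ᵥ (R *ᵥ z + m - m)))
        * ((R *ᵥ z + m - m) ⬝ᵥ (D *ᵥ (R *ᵥ z + m - m)))) * g (z ⬝ᵥ z))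
      = fun z => W g (z ⬝ᵥ z) ^ l * g (z ⬝ᵥ z) * ((z ⬝ᵥ ((Rᵀ * B * R) *ᵥ z))
        * (z ⬝ᵥ ((Rᵀ * D * R) *ᵥ z))) := by
    ext z
    rw [mahal_add_mulVec hRS hR, add_sub_cancel_right, dotProduct_mulVec_mulVec,
      dotProduct_mulVec_mulVec]
    ring
  rw [integrable_elliptical_iff hRS hR fun y => W g (mahal m S y) ^ l *
    (((y - m) ⬝ᵥ (B *ᵥ (y - m))) * ((y - m) ⬝ᵥ (D *ᵥ (y - m)))),
    integral_elliptical hRS hR fun y => W g (mahal m S y) ^ l *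
    (((y - m) ⬝ᵥ (B *ᵥ (y - m))) * ((y - m) ⬝ᵥ (D *ᵥ (y - m)))), e]
  refine ⟨integrable_quad_two hq (h := fun u => W g u ^ l * g u) hh _ _,
    (integral_quad_two hq (h := fun u => W g u ^ l * g u) hh _ (isSymm_transpose_mul_mul R hD)).trans ?_⟩
  have t : ((Rᵀ * B * R)ᵀ * (Rᵀ * D * R)).trace = (Bᵀ * S * D * S).trace := by
    have : (Rᵀ * B * R)ᵀ * (Rᵀ * D * R) = Rᵀ * (Bᵀ * (R * Rᵀ) * D) * R := by
      simp only [Matrix.transpose_mul, Matrix.transpose_transpose, Matrix.mul_assoc]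
    rw [this, trace_transpose_mul_mul, hRS]
  rw [psi, psiIntegrand_eq, t, trace_transpose_mul_mul, trace_transpose_mul_mul, hRS]

/-- Sixth-order elliptical moments. -/
theorem elliptical_moment_three (hq : 0 < q) (hS : S.PosDef) {l : ℕ}
    (hi : Integrable (psiIntegrand q g l 3)) {B D E : Matrix (Fin q) (Fin q) ℝ}
    (hB : B.IsSymm) (hD : D.IsSymm) (hE : E.IsSymm) :
    Integrable (fun y => W g (mahal m S y) ^ l * (((y - m) ⬝ᵥ (B *ᵥ (y - m)))
      * ((y - m) ⬝ᵥ (D *ᵥ (y - m))) * ((y - m) ⬝ᵥ (E *ᵥ (y - m)))) * ellipticalDensity g m S y) ∧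
    ∫ y, W g (mahal m S y) ^ l * (((y - m) ⬝ᵥ (B *ᵥ (y - m))) * ((y - m) ⬝ᵥ (D *ᵥ (y - m)))
      * ((y - m) ⬝ᵥ (E *ᵥ (y - m)))) * ellipticalDensity g m S y
      = psi q g l 3 / (q * (q + 2) * (q + 4)) *
        ((B * S).trace * (D * S).trace * (E * S).trace
          + 2 * ((B * S).trace * (D * S * E * S).trace + (D * S).trace * (B * S * E * S).trace
            + (E * S).trace * (B * S * D * S).trace) + 8 * (B * S * D * S * E * S).trace) := by
  obtain ⟨R, hRS⟩ := exists_mul_transpose_eq hS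
  have hR := det_ne_zero_of_mul_transpose hRS hS
  have hh := hi
  rw [psiIntegrand_eq] at hh
  have e : (fun z : Fin q → ℝ => W g (mahal m S (R *ᵥ z + m)) ^ l
      * (((R *ᵥ z + m - m) ⬝ᵥ (B *ᵥ (R *ᵥ z + m - m)))
        * ((R *ᵥ z + m - m) ⬝ᵥ (D *ᵥ (R *ᵥ z + m - m)))
        * ((R *ᵥ z + m - m) ⬝ᵥ (E *ᵥ (R *ᵥ z + m - m)))) * g (z ⬝ᵥ z))
      = fun z => W g (z ⬝ᵥ z) ^ l * g (z ⬝ᵥ z) * ((z ⬝ᵥ ((Rᵀ * B * R) *ᵥ z))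
        * (z ⬝ᵥ ((Rᵀ * D * R) *ᵥ z)) * (z ⬝ᵥ ((Rᵀ * E * R) *ᵥ z))) := by
    ext z
    rw [mahal_add_mulVec hRS hR, add_sub_cancel_right, dotProduct_mulVec_mulVec,
      dotProduct_mulVec_mulVec, dotProduct_mulVec_mulVec]
    ring
  rw [integrable_elliptical_iff hRS hR fun y => W g (mahal m S y) ^ l *
    (((y - m) ⬝ᵥ (B *ᵥ (y - m))) * ((y - m) ⬝ᵥ (D *ᵥ (y - m))) * ((y - m) ⬝ᵥ (E *ᵥ (y - m)))),
    integral_elliptical hRS hR fun y => W g (mahal m S y) ^ l *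
    (((y - m) ⬝ᵥ (B *ᵥ (y - m))) * ((y - m) ⬝ᵥ (D *ᵥ (y - m))) * ((y - m) ⬝ᵥ (E *ᵥ (y - m)))), e]
  refine ⟨integrable_quad_three hq (h := fun u => W g u ^ l * g u) hh _ _ _,
    (integral_quad_three hq (h := fun u => W g u ^ l * g u) hh (isSymm_transpose_mul_mul R hB) (isSymm_transpose_mul_mul R hD)
      (isSymm_transpose_mul_mul R hE)).trans ?_⟩
  have t : ∀ M N : Matrix (Fin q) (Fin q) ℝ,
      ((Rᵀ * M * R) * (Rᵀ * N * R)).trace = (M * S * N * S).trace := by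
    intro M N
    have : (Rᵀ * M * R) * (Rᵀ * N * R) = Rᵀ * (M * (R * Rᵀ) * N) * R := by
      simp only [Matrix.mul_assoc]
    rw [this, trace_transpose_mul_mul, hRS]
  have t3 : ((Rᵀ * B * R) * (Rᵀ * D * R) * (Rᵀ * E * R)).trace
      = (B * S * D * S * E * S).trace := by
    have : (Rᵀ * B * R) * (Rᵀ * D * R) * (Rᵀ * E * R)
        = Rᵀ * (B * (R * Rᵀ) * D * (R * Rᵀ) * E) * R := by
      simp only [Matrix.mul_assoc]
    rw [this, trace_transpose_mul_mul, hRS]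
  rw [psi, psiIntegrand_eq]
  simp only [t, t3, trace_transpose_mul_mul, hRS]

end Elliptical

/-! ### The scores of one elliptical observation -/

section ComponentScore

variable {q : ℕ}

/-- The derivative of the log-density when the location moves in the direction `a`. -/
def locScore (g : ℝ → ℝ) (m : Fin q → ℝ) (S : Matrix (Fin q) (Fin q) ℝ) (a y : Fin q → ℝ) : ℝ :=
  -2 * (W g (mahal m S y) * (a ⬝ᵥ (S⁻¹ *ᵥ (y - m))))

/-- The derivative of the log-density when the scale matrix moves in the direction `C`. -/
def scaleScore (g : ℝ → ℝ) (m : Fin q → ℝ) (S C : Matrix (Fin q) (Fin q) ℝ) (y : Fin q → ℝ) : ℝ :=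
  -(1 / 2) * (S⁻¹ * C).trace
    - W g (mahal m S y) * ((y - m) ⬝ᵥ ((S⁻¹ * C * S⁻¹) *ᵥ (y - m)))

theorem continuous_mahal (m : Fin q → ℝ) (S : Matrix (Fin q) (Fin q) ℝ) :
    Continuous (mahal m S) := by
  change Continuous fun y => (y - m) ⬝ᵥ (S⁻¹ *ᵥ (y - m))
  simp only [ dotProduct, Matrix.mulVec]
  fun_prop

theorem measurable_W_mahal (g : ℝ → ℝ) (m : Fin q → ℝ) (S : Matrix (Fin q) (Fin q) ℝ) :
    Measurable fun y => W g (mahal m S y) :=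
  Measurable.comp (g := W g) (measurable_deriv _) (continuous_mahal m S).measurable

theorem measurable_locScore (g : ℝ → ℝ) (m : Fin q → ℝ) (S : Matrix (Fin q) (Fin q) ℝ)
    (a : Fin q → ℝ) : Measurable (locScore g m S a) := by
  refine ((measurable_W_mahal g m S).mul ?_).const_mul _
  simp only [dotProduct, Matrix.mulVec]
  fun_prop

theorem measurable_scaleScore (g : ℝ → ℝ) (m : Fin q → ℝ) (S C : Matrix (Fin q) (Fin q) ℝ) :
    Measurable (scaleScore g m S C) := by
  refine ((measurable_W_mahal g m S).mul ?_).const_sub _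
  simp only [dotProduct, Matrix.mulVec]
  fun_prop

/-- From `|XY| ≤ X² + Y²`. It covers the mixed products of location and scale scores, for which no
moment has to be computed. -/
theorem integrable_mul_of_sq {α : Type*} [MeasurableSpace α] {ν : Measure α} {X Y d : α → ℝ}
    (hX : Measurable X) (hY : Measurable Y) (hd : ∀ y, 0 ≤ d y) (hdm : AEStronglyMeasurable d ν)
    (hXi : Integrable (fun y => X y * X y * d y) ν) (hYi : Integrable (fun y => Y y * Y y * d y) ν) :
    Integrable (fun y => X y * Y y * d y) ν := by
  refine (hXi.add hYi).mono' ((hX.mul hY).aestronglyMeasurable.mul hdm) (.of_forall fun y => ?_)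
  rw [Real.norm_eq_abs, abs_mul, abs_of_nonneg (hd y), Pi.add_apply, ← add_mul]
  refine mul_le_mul_of_nonneg_right ?_ (hd y)
  rw [abs_le]
  constructor <;> nlinarith [sq_nonneg (X y + Y y), sq_nonneg (X y - Y y)]

/-- A function that is odd about the centre has mean zero. -/
theorem integral_eq_zero_of_reflect {E : Type*} [NormedAddCommGroup E] [MeasurableSpace E]
    [BorelSpace E] {ν : Measure E} [ν.IsAddLeftInvariant] [ν.IsNegInvariant] (F : E → ℝ) (c : E)
    (hF : ∀ y, F (c - y) = -F y) : ∫ y, F y ∂ν = 0 := by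
  have h := integral_sub_left_eq_self F ν c
  simp only [hF, integral_neg] at h
  linarith

variable {m : Fin q → ℝ} {S : Matrix (Fin q) (Fin q) ℝ} {g : ℝ → ℝ}

theorem sub_reflect (m y : Fin q → ℝ) : (2 : ℝ) • m - y - m = -(y - m) := by
  rw [two_smul]
  abel

theorem mahal_reflect (m : Fin q → ℝ) (S : Matrix (Fin q) (Fin q) ℝ) (y : Fin q → ℝ) :
    mahal m S ((2 : ℝ) • m - y) = mahal m S y := by
  rw [mahal, mahal, sub_reflect, Matrix.mulVec_neg, neg_dotProduct_neg]

theorem ellipticalDensity_reflect (y : Fin q → ℝ) :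
    ellipticalDensity g m S ((2 : ℝ) • m - y) = ellipticalDensity g m S y := by
  rw [ellipticalDensity, ellipticalDensity, mahal_reflect]

/-- Location scores are odd about the centre, while the density and the scale scores are even. This
parity kills every moment with an odd number of location scores. -/
theorem locScore_reflect (a y : Fin q → ℝ) :
    locScore g m S a ((2 : ℝ) • m - y) = -locScore g m S a y := by
  rw [locScore, locScore, mahal_reflect, sub_reflect, Matrix.mulVec_neg, dotProduct_neg]
  ring

theorem scaleScore_reflect (C : Matrix (Fin q) (Fin q) ℝ) (y : Fin q → ℝ) :
    scaleScore g m S C ((2 : ℝ) • m - y) = scaleScore g m S C y := by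
  rw [scaleScore, scaleScore, mahal_reflect, sub_reflect, Matrix.mulVec_neg, neg_dotProduct_neg]

theorem isSymm_of_posDef (hS : S.PosDef) : S.IsSymm := by
  have := hS.isHermitian
  rwa [Matrix.IsHermitian, Matrix.conjTranspose_eq_transpose_of_trivial] at this

theorem isUnit_det_of_posDef (hS : S.PosDef) : IsUnit S.det :=
  isUnit_iff_ne_zero.2 hS.det_pos.ne'

theorem isSymm_sandwich (hS : S.PosDef) {C : Matrix (Fin q) (Fin q) ℝ} (hC : C.IsSymm) :
    (S⁻¹ * C * S⁻¹).IsSymm := by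
  have h := (isSymm_of_posDef hS.inv)
  have := isSymm_transpose_mul_mul S⁻¹ hC
  rwa [h.eq] at this

/-- A product of two linear forms is a quadratic form of rank one, so moments of location scores
fall under the quadratic moment formulas. -/
theorem dotProduct_mul_dotProduct (a b v : Fin q → ℝ) :
    (a ⬝ᵥ v) * (b ⬝ᵥ v) = v ⬝ᵥ (Matrix.vecMulVec a b *ᵥ v) := by
  rw [Matrix.vecMulVec_mulVec]
  simp [dotProduct_comm a v, mul_comm]

theorem dotProduct_inv_mulVec (hS : S.PosDef) (a v : Fin q → ℝ) :
    a ⬝ᵥ (S⁻¹ *ᵥ v) = (S⁻¹ *ᵥ a) ⬝ᵥ v := by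
  rw [Matrix.dotProduct_mulVec, ← Matrix.mulVec_transpose, (isSymm_of_posDef hS.inv).eq]

theorem sandwich_mul (hS : S.PosDef) (C : Matrix (Fin q) (Fin q) ℝ) :
    S⁻¹ * C * S⁻¹ * S = S⁻¹ * C := by
  rw [Matrix.mul_assoc _ S⁻¹ S, Matrix.nonsing_inv_mul _ (isUnit_det_of_posDef hS), Matrix.mul_one]

/-- The matrix of the quadratic form `(a ⬝ S⁻¹ v) (b ⬝ S⁻¹ v)`. -/
theorem locScore_mul_locScore (hS : S.PosDef) (a b y : Fin q → ℝ) :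
    locScore g m S a y * locScore g m S b y = 4 * (W g (mahal m S y) ^ 2 *
      ((y - m) ⬝ᵥ (Matrix.vecMulVec (S⁻¹ *ᵥ a) (S⁻¹ *ᵥ b) *ᵥ (y - m)))) := by
  rw [locScore, locScore, ← dotProduct_mul_dotProduct, dotProduct_inv_mulVec hS,
    dotProduct_inv_mulVec hS]
  ring

theorem trace_vecMulVec_inv_mul (hS : S.PosDef) (a b : Fin q → ℝ) :
    (Matrix.vecMulVec (S⁻¹ *ᵥ a) (S⁻¹ *ᵥ b) * S).trace = a ⬝ᵥ (S⁻¹ *ᵥ b) := by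
  rw [Matrix.vecMulVec_mul, Matrix.trace_vecMulVec, ← Matrix.mulVec_transpose,
    (isSymm_of_posDef hS).eq, Matrix.mulVec_mulVec,
    Matrix.mul_nonsing_inv _ (isUnit_det_of_posDef hS), Matrix.one_mulVec, dotProduct_inv_mulVec hS]

theorem trace_vecMulVec_inv_sandwich (hS : S.PosDef) {C : Matrix (Fin q) (Fin q) ℝ}
    (hC : C.IsSymm) (a b : Fin q → ℝ) :
    ((Matrix.vecMulVec (S⁻¹ *ᵥ a) (S⁻¹ *ᵥ b))ᵀ * S * (S⁻¹ * C * S⁻¹) * S).trace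
      = a ⬝ᵥ ((S⁻¹ * C * S⁻¹) *ᵥ b) := by
  have e : (Matrix.vecMulVec (S⁻¹ *ᵥ a) (S⁻¹ *ᵥ b))ᵀ * S * (S⁻¹ * C * S⁻¹) * S
      = (Matrix.vecMulVec (S⁻¹ *ᵥ a) (S⁻¹ *ᵥ b))ᵀ * C := by
    rw [Matrix.mul_assoc _ _ S, sandwich_mul hS, Matrix.mul_assoc, ← Matrix.mul_assoc S,
      Matrix.mul_nonsing_inv _ (isUnit_det_of_posDef hS), Matrix.one_mul]
  rw [e, Matrix.transpose_vecMulVec, Matrix.vecMulVec_mul, Matrix.trace_vecMulVec,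
    ← Matrix.mulVec_transpose, hC.eq, Matrix.mulVec_mulVec, dotProduct_comm,
    dotProduct_inv_mulVec hS, Matrix.mulVec_mulVec, ← Matrix.mul_assoc, dotProduct_comm,
    Matrix.dotProduct_mulVec,
    ← Matrix.mulVec_transpose, (isSymm_sandwich hS hC).eq, dotProduct_comm]

theorem integrable_locScore_mul (hq : 0 < q) (hg : IsGenerator q g) (hS : S.PosDef)
    (a b : Fin q → ℝ) :
    Integrable fun y => locScore g m S a y * locScore g m S b y * ellipticalDensity g m S y := by
  have h := (elliptical_moment_one (m := m) hq hS hg.psi21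
    (Matrix.vecMulVec (S⁻¹ *ᵥ a) (S⁻¹ *ᵥ b))).1.const_mul 4
  refine h.congr (.of_forall fun y => ?_)
  simp only [locScore_mul_locScore hS]
  ring

theorem integral_locScore_mul (hq : 0 < q) (hg : IsGenerator q g) (hS : S.PosDef)
    (a b : Fin q → ℝ) :
    ∫ y, locScore g m S a y * locScore g m S b y * ellipticalDensity g m S y
      = 4 * psi q g 2 1 / q * (a ⬝ᵥ (S⁻¹ *ᵥ b)) := by
  have h := (elliptical_moment_one (m := m) hq hS hg.psi21
    (Matrix.vecMulVec (S⁻¹ *ᵥ a) (S⁻¹ *ᵥ b))).2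
  simp only [locScore_mul_locScore hS, mul_assoc (4 : ℝ), integral_const_mul]
  rw [h, trace_vecMulVec_inv_mul hS]
  ring

theorem integral_locScore (a : Fin q → ℝ) :
    ∫ y, locScore g m S a y * ellipticalDensity g m S y = 0 := by
  refine integral_eq_zero_of_reflect _ ((2 : ℝ) • m) fun y => ?_
  rw [locScore_reflect, ellipticalDensity_reflect, neg_mul]

theorem integrable_scaleScore (hq : 0 < q) (hg : IsGenerator q g) (hS : S.PosDef)
    (C : Matrix (Fin q) (Fin q) ℝ) :
    Integrable fun y => scaleScore g m S C y * ellipticalDensity g m S y := by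
  have h := (elliptical_moment_one (m := m) hq hS hg.integrable_W_mul (S⁻¹ * C * S⁻¹)).1
  refine (((integrable_ellipticalDensity (m := m) hg hS).const_mul
    (-(1 / 2) * (S⁻¹ * C).trace)).sub h).congr (.of_forall fun y => ?_)
  simp only [Pi.sub_apply, scaleScore, pow_one]
  ring

/-- The mean of the quadratic term is `ψ_{(1,1)}/q · tr(Σ⁻¹ C)`. The identity `ψ_{(1,1)} = -q/2`
makes it cancel the determinant term exactly. -/
theorem integral_scaleScore (hq : 0 < q) (hg : IsGenerator q g) (hS : S.PosDef)
    (C : Matrix (Fin q) (Fin q) ℝ) :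
    ∫ y, scaleScore g m S C y * ellipticalDensity g m S y = 0 := by
  have h := elliptical_moment_one (m := m) hq hS hg.integrable_W_mul (S⁻¹ * C * S⁻¹)
  simp only [pow_one] at h
  simp only [scaleScore, sub_mul]
  rw [integral_sub ((integrable_ellipticalDensity hg hS).const_mul _) h.1, integral_const_mul,
    integral_ellipticalDensity hg hS, h.2, hg.psi_one_one hq, sandwich_mul hS]
  have hq' : (q : ℝ) ≠ 0 := by exact_mod_cast hq.ne'
  field_simp
  ring

/-- The quadratic moment contributes `c/4` to the product of traces and `c/2` to the trace of the
product. The constant and the two cross terms contribute `1/4 - 1/4 - 1/4` to the former. -/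
theorem scaleScore_mul_scaleScore_integral (hq : 0 < q) (hg : IsGenerator q g) (hS : S.PosDef)
    {C D : Matrix (Fin q) (Fin q) ℝ} (hC : C.IsSymm) (hD : D.IsSymm) :
    Integrable (fun y => scaleScore g m S C y * scaleScore g m S D y
      * ellipticalDensity g m S y) ∧
    ∫ y, scaleScore g m S C y * scaleScore g m S D y * ellipticalDensity g m S y
      = cC q g / 2 * (S⁻¹ * C * (S⁻¹ * D)).trace
        + (cC q g - 1) / 4 * ((S⁻¹ * C).trace * (S⁻¹ * D).trace) := by
  have h0 := integrable_ellipticalDensity (m := m) hg hS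
  have hC1 := elliptical_moment_one (m := m) hq hS hg.integrable_W_mul (S⁻¹ * C * S⁻¹)
  have hD1 := elliptical_moment_one (m := m) hq hS hg.integrable_W_mul (S⁻¹ * D * S⁻¹)
  have h2 := elliptical_moment_two (m := m) hq hS hg.psi22 (S⁻¹ * C * S⁻¹)
    (isSymm_sandwich hS hD)
  rw [hg.psi_one_one hq] at hC1 hD1
  have e : (fun y => scaleScore g m S C y * scaleScore g m S D y * ellipticalDensity g m S y)
      = fun y => ((1 / 4 * (S⁻¹ * C).trace * (S⁻¹ * D).trace) * ellipticalDensity g m S y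
        + (1 / 2 * (S⁻¹ * D).trace) * (W g (mahal m S y) ^ 1 *
          ((y - m) ⬝ᵥ ((S⁻¹ * C * S⁻¹) *ᵥ (y - m))) * ellipticalDensity g m S y)
        + (1 / 2 * (S⁻¹ * C).trace) * (W g (mahal m S y) ^ 1 *
          ((y - m) ⬝ᵥ ((S⁻¹ * D * S⁻¹) *ᵥ (y - m))) * ellipticalDensity g m S y)
        + W g (mahal m S y) ^ 2 * (((y - m) ⬝ᵥ ((S⁻¹ * C * S⁻¹) *ᵥ (y - m)))
          * ((y - m) ⬝ᵥ ((S⁻¹ * D * S⁻¹) *ᵥ (y - m)))) * ellipticalDensity g m S y) := by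
    ext y
    simp only [scaleScore]
    ring
  have i0 := h0.const_mul (1 / 4 * (S⁻¹ * C).trace * (S⁻¹ * D).trace)
  have i1 := hC1.1.const_mul (1 / 2 * (S⁻¹ * D).trace)
  have i2 := hD1.1.const_mul (1 / 2 * (S⁻¹ * C).trace)
  have j1 := i0.fun_add i1
  have j2 := j1.fun_add i2
  rw [e]
  refine ⟨j2.add h2.1, ?_⟩
  have ht : ((S⁻¹ * C * S⁻¹)ᵀ * S * (S⁻¹ * D * S⁻¹) * S).trace = (S⁻¹ * C * (S⁻¹ * D)).trace := by
    rw [(isSymm_sandwich hS hC).eq, Matrix.mul_assoc _ _ S, sandwich_mul hS, sandwich_mul hS]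
  rw [integral_add j2 h2.1, integral_add j1 i2, integral_add i0 i1, integral_const_mul,
    integral_const_mul, integral_const_mul, integral_ellipticalDensity hg hS, hC1.2, hD1.2, h2.2,
    sandwich_mul hS, sandwich_mul hS, ht, cC]
  have hq' : (0 : ℝ) < q := by exact_mod_cast hq
  field_simp
  ring

theorem integrable_locScore_mul_scaleScore (hq : 0 < q) (hg : IsGenerator q g) (hS : S.PosDef)
    (a : Fin q → ℝ) {C : Matrix (Fin q) (Fin q) ℝ} (hC : C.IsSymm) :
    Integrable fun y => locScore g m S a y * scaleScore g m S C y * ellipticalDensity g m S y :=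
  integrable_mul_of_sq (measurable_locScore g m S a) (measurable_scaleScore g m S C)
    (fun y => (ellipticalDensity_pos hg hS y).le)
    (integrable_ellipticalDensity hg hS).aestronglyMeasurable
    (integrable_locScore_mul hq hg hS a a) (scaleScore_mul_scaleScore_integral hq hg hS hC hC).1

theorem integrable_locScore (hq : 0 < q) (hg : IsGenerator q g) (hS : S.PosDef)
    (a : Fin q → ℝ) :
    Integrable fun y => locScore g m S a y * ellipticalDensity g m S y := by
  have := integrable_mul_of_sq (measurable_locScore g m S a)
    (measurable_const (a := (1 : ℝ))) (fun y => (ellipticalDensity_pos hg hS y).le)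
    (integrable_ellipticalDensity (m := m) hg hS).aestronglyMeasurable
    (integrable_locScore_mul hq hg hS a a)
    (by simpa using integrable_ellipticalDensity (m := m) hg hS)
  simpa using this

/-- The determinant term of the scale score brings in `ψ_{(2,1)}` and its quadratic term brings in
`ψ_{(3,2)}`. Their contributions to the product with `tr(Σ⁻¹ C)` combine into `η₁/2`. -/
theorem locScore_mul_locScore_mul_scaleScore_integral (hq : 0 < q) (hg : IsGenerator q g)
    (hS : S.PosDef) (a b : Fin q → ℝ) {C : Matrix (Fin q) (Fin q) ℝ} (hC : C.IsSymm) :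
    Integrable (fun y => locScore g m S a y * locScore g m S b y * scaleScore g m S C y
      * ellipticalDensity g m S y) ∧
    ∫ y, locScore g m S a y * locScore g m S b y * scaleScore g m S C y
      * ellipticalDensity g m S y
      = -(1 / 2 * eta1 q g * (a ⬝ᵥ (S⁻¹ *ᵥ b)) * (S⁻¹ * C).trace
        + cStar q g * (a ⬝ᵥ ((S⁻¹ * C * S⁻¹) *ᵥ b))) := by
  have h1 := elliptical_moment_one (m := m) hq hS hg.psi21
    (Matrix.vecMulVec (S⁻¹ *ᵥ a) (S⁻¹ *ᵥ b))
  have h2 := elliptical_moment_two (m := m) hq hS hg.psi32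
    (Matrix.vecMulVec (S⁻¹ *ᵥ a) (S⁻¹ *ᵥ b)) (isSymm_sandwich hS hC)
  have e : (fun y => locScore g m S a y * locScore g m S b y * scaleScore g m S C y
      * ellipticalDensity g m S y)
      = fun y => (-2 * (S⁻¹ * C).trace) * (W g (mahal m S y) ^ 2 *
          ((y - m) ⬝ᵥ (Matrix.vecMulVec (S⁻¹ *ᵥ a) (S⁻¹ *ᵥ b) *ᵥ (y - m)))
            * ellipticalDensity g m S y)
        + (-4) * (W g (mahal m S y) ^ 3 *
          (((y - m) ⬝ᵥ (Matrix.vecMulVec (S⁻¹ *ᵥ a) (S⁻¹ *ᵥ b) *ᵥ (y - m)))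
          * ((y - m) ⬝ᵥ ((S⁻¹ * C * S⁻¹) *ᵥ (y - m)))) * ellipticalDensity g m S y) := by
    ext y
    rw [locScore_mul_locScore hS]
    simp only [scaleScore]
    ring
  have i1 := h1.1.const_mul (-2 * (S⁻¹ * C).trace)
  have i2 := h2.1.const_mul (-4)
  rw [e]
  refine ⟨i1.add i2, ?_⟩
  rw [integral_add i1 i2, integral_const_mul, integral_const_mul, h1.2, h2.2,
    trace_vecMulVec_inv_mul hS, trace_vecMulVec_inv_sandwich hS hC, sandwich_mul hS, eta1, cStar]
  have hq' : (0 : ℝ) < q := by exact_mod_cast hq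
  field_simp
  ring

/-- Expanding the cube gives eight terms. For the product of three traces they contribute `-1/8`,
`3/8`, `-3c/8` and `-ω̃` by order in `W`; the mixed traces receive `-c/4 - 2ω̃`, and the cubic trace
`-8ω̃`. -/
theorem scaleScore_cube_integral (hq : 0 < q) (hg : IsGenerator q g) (hS : S.PosDef)
    {C D E : Matrix (Fin q) (Fin q) ℝ} (hC : C.IsSymm) (hD : D.IsSymm) (hE : E.IsSymm) :
    Integrable (fun y => scaleScore g m S C y * scaleScore g m S D y * scaleScore g m S E y
      * ellipticalDensity g m S y) ∧
    ∫ y, scaleScore g m S C y * scaleScore g m S D y * scaleScore g m S E y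
      * ellipticalDensity g m S y
      = -((omegaT q g + 3 / 8 * cC q g - 1 / 4)
          * ((S⁻¹ * C).trace * (S⁻¹ * D).trace * (S⁻¹ * E).trace)
        + (cC q g / 4 + 2 * omegaT q g) * ((S⁻¹ * C).trace * (S⁻¹ * D * (S⁻¹ * E)).trace
          + (S⁻¹ * D).trace * (S⁻¹ * C * (S⁻¹ * E)).trace
          + (S⁻¹ * E).trace * (S⁻¹ * C * (S⁻¹ * D)).trace)
        + 8 * omegaT q g * (S⁻¹ * C * (S⁻¹ * D) * (S⁻¹ * E)).trace) := by
  have h0 := integrable_ellipticalDensity (m := m) hg hS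
  have h1 := fun X => elliptical_moment_one (m := m) hq hS hg.integrable_W_mul (S⁻¹ * X * S⁻¹)
  have h2 := fun X {Y : Matrix (Fin q) (Fin q) ℝ} (hY : Y.IsSymm) =>
    elliptical_moment_two (m := m) hq hS hg.psi22 (S⁻¹ * X * S⁻¹) (isSymm_sandwich hS hY)
  have h3 := elliptical_moment_three (m := m) hq hS hg.psi33 (isSymm_sandwich hS hC)
    (isSymm_sandwich hS hD) (isSymm_sandwich hS hE)
  simp only [hg.psi_one_one hq, sandwich_mul hS] at h1
  have e : (fun y => scaleScore g m S C y * scaleScore g m S D y * scaleScore g m S E y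
      * ellipticalDensity g m S y)
      = fun y => ((((((((-(1 / 8) * (S⁻¹ * C).trace * (S⁻¹ * D).trace * (S⁻¹ * E).trace)
          * ellipticalDensity g m S y
        + (-(1 / 4) * (S⁻¹ * D).trace * (S⁻¹ * E).trace) * (W g (mahal m S y) ^ 1 *
          ((y - m) ⬝ᵥ ((S⁻¹ * C * S⁻¹) *ᵥ (y - m))) * ellipticalDensity g m S y))
        + (-(1 / 4) * (S⁻¹ * C).trace * (S⁻¹ * E).trace) * (W g (mahal m S y) ^ 1 *
          ((y - m) ⬝ᵥ ((S⁻¹ * D * S⁻¹) *ᵥ (y - m))) * ellipticalDensity g m S y))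
        + (-(1 / 4) * (S⁻¹ * C).trace * (S⁻¹ * D).trace) * (W g (mahal m S y) ^ 1 *
          ((y - m) ⬝ᵥ ((S⁻¹ * E * S⁻¹) *ᵥ (y - m))) * ellipticalDensity g m S y))
        + (-(1 / 2) * (S⁻¹ * C).trace) * (W g (mahal m S y) ^ 2 *
          (((y - m) ⬝ᵥ ((S⁻¹ * D * S⁻¹) *ᵥ (y - m)))
          * ((y - m) ⬝ᵥ ((S⁻¹ * E * S⁻¹) *ᵥ (y - m)))) * ellipticalDensity g m S y))
        + (-(1 / 2) * (S⁻¹ * D).trace) * (W g (mahal m S y) ^ 2 *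
          (((y - m) ⬝ᵥ ((S⁻¹ * C * S⁻¹) *ᵥ (y - m)))
          * ((y - m) ⬝ᵥ ((S⁻¹ * E * S⁻¹) *ᵥ (y - m)))) * ellipticalDensity g m S y))
        + (-(1 / 2) * (S⁻¹ * E).trace) * (W g (mahal m S y) ^ 2 *
          (((y - m) ⬝ᵥ ((S⁻¹ * C * S⁻¹) *ᵥ (y - m)))
          * ((y - m) ⬝ᵥ ((S⁻¹ * D * S⁻¹) *ᵥ (y - m)))) * ellipticalDensity g m S y))
        + (-1) * (W g (mahal m S y) ^ 3 * (((y - m) ⬝ᵥ ((S⁻¹ * C * S⁻¹) *ᵥ (y - m)))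
          * ((y - m) ⬝ᵥ ((S⁻¹ * D * S⁻¹) *ᵥ (y - m)))
          * ((y - m) ⬝ᵥ ((S⁻¹ * E * S⁻¹) *ᵥ (y - m)))) * ellipticalDensity g m S y)) := by
    ext y
    simp only [scaleScore]
    ring
  have i0 := h0.const_mul (-(1 / 8) * (S⁻¹ * C).trace * (S⁻¹ * D).trace * (S⁻¹ * E).trace)
  have i1 := (h1 C).1.const_mul (-(1 / 4) * (S⁻¹ * D).trace * (S⁻¹ * E).trace)
  have i2 := (h1 D).1.const_mul (-(1 / 4) * (S⁻¹ * C).trace * (S⁻¹ * E).trace)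
  have i3 := (h1 E).1.const_mul (-(1 / 4) * (S⁻¹ * C).trace * (S⁻¹ * D).trace)
  have i4 := (h2 D hE).1.const_mul (-(1 / 2) * (S⁻¹ * C).trace)
  have i5 := (h2 C hE).1.const_mul (-(1 / 2) * (S⁻¹ * D).trace)
  have i6 := (h2 C hD).1.const_mul (-(1 / 2) * (S⁻¹ * E).trace)
  have i7 := h3.1.const_mul (-1)
  have j1 := i0.fun_add i1
  have j2 := j1.fun_add i2
  have j3 := j2.fun_add i3
  have j4 := j3.fun_add i4
  have j5 := j4.fun_add i5
  have j6 := j5.fun_add i6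
  rw [e]
  refine ⟨j6.add i7, ?_⟩
  have ht : ∀ {X Y : Matrix (Fin q) (Fin q) ℝ}, X.IsSymm →
      ((S⁻¹ * X * S⁻¹)ᵀ * S * (S⁻¹ * Y * S⁻¹) * S).trace = (S⁻¹ * X * (S⁻¹ * Y)).trace := by
    intro X Y hX
    rw [(isSymm_sandwich hS hX).eq, Matrix.mul_assoc _ _ S, sandwich_mul hS, sandwich_mul hS]
  have hs : ∀ X Y : Matrix (Fin q) (Fin q) ℝ,
      S⁻¹ * X * S⁻¹ * S * (S⁻¹ * Y * S⁻¹) * S = S⁻¹ * X * (S⁻¹ * Y) := by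
    intro X Y
    rw [Matrix.mul_assoc _ _ S, sandwich_mul hS, sandwich_mul hS]
  have hs3 : S⁻¹ * C * S⁻¹ * S * (S⁻¹ * D * S⁻¹) * S * (S⁻¹ * E * S⁻¹) * S
      = S⁻¹ * C * (S⁻¹ * D) * (S⁻¹ * E) := by
    rw [hs, Matrix.mul_assoc _ _ S, sandwich_mul hS]
  rw [integral_add j6 i7, integral_add j5 i6, integral_add j4 i5, integral_add j3 i4,
    integral_add j2 i3, integral_add j1 i2, integral_add i0 i1]
  simp only [integral_const_mul]
  rw [integral_ellipticalDensity hg hS, (h1 C).2, (h1 D).2, (h1 E).2, (h2 D hE).2, (h2 C hE).2,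
    (h2 C hD).2, h3.2, ht hC, ht hC, ht hD, hs3, hs, hs, hs]
  simp only [sandwich_mul hS, cC, omegaT]
  have hq' : (0 : ℝ) < q := by exact_mod_cast hq
  field_simp
  ring

end ComponentScore

/-! ### Derivatives of determinants, inverses and quadratic forms along curves -/

section MatrixCurves

variable {q : ℕ}

theorem differentiable_det : Differentiable ℝ fun M : Fin q → Fin q → ℝ => (Matrix.of M).det := by
  simp only [Matrix.det_apply, Matrix.of_apply]
  fun_prop

/-- By Cramer's rule an entry of the inverse is a quotient of determinants, each polynomial in the
entries. -/
theorem differentiableAt_inv_apply {A : Matrix (Fin q) (Fin q) ℝ} (hA : A.det ≠ 0)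
    (i j : Fin q) :
    DifferentiableAt ℝ (fun M : Fin q → Fin q → ℝ => (Matrix.of M)⁻¹ i j) A := by
  have e : (fun M : Fin q → Fin q → ℝ => (Matrix.of M)⁻¹ i j)
      = fun M => ((Matrix.of M).det)⁻¹ * ((Matrix.of M).updateRow j (Pi.single i 1)).det := by
    ext M
    rw [Matrix.inv_def, Matrix.smul_apply, Matrix.adjugate_apply, Ring.inverse_eq_inv', smul_eq_mul]
  rw [e]
  refine ((differentiable_det A).inv hA).mul ?_
  have hu : Differentiable ℝ fun M : Fin q → Fin q → ℝ =>
      (fun a b => if a = j then Pi.single (M := fun _ => ℝ) i 1 b else M a b :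
        Fin q → Fin q → ℝ) := by
    refine differentiable_pi.2 fun a => differentiable_pi.2 fun b => ?_
    split_ifs <;> fun_prop
  have := differentiable_det.comp hu
  refine (this A).congr_of_eventuallyEq (.of_forall fun M => ?_)
  simp only [Function.comp_def]
  congr 1
  ext a b
  simp [Matrix.updateRow_apply]

variable {A : ℝ → Matrix (Fin q) (Fin q) ℝ} {C : Matrix (Fin q) (Fin q) ℝ} {x : ℝ}

theorem hasDerivAt_curve (hA : ∀ i j, HasDerivAt (fun t => A t i j) (C i j) x) :
    HasDerivAt (fun t => (fun i j => A t i j : Fin q → Fin q → ℝ)) (fun i j => C i j) x :=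
  hasDerivAt_pi.2 fun i => hasDerivAt_pi.2 fun j => hA i j

/-- Jacobi's formula. -/
theorem hasDerivAt_det (hdet : (A x).det ≠ 0)
    (hA : ∀ i j, HasDerivAt (fun t => A t i j) (C i j) x) :
    HasDerivAt (fun t => (A t).det) ((A x).det * ((A x)⁻¹ * C).trace) x := by
  have hu : IsUnit (A x).det := isUnit_iff_ne_zero.2 hdet
  have h1 := (differentiable_det (fun i j => A x i j)).hasFDerivAt.comp_hasDerivAt x
    (hasDerivAt_curve hA)
  -- The determinant is differentiable, so its derivative along the curve depends only on the point
  -- `A x` and the velocity `C`. The curve may be replaced by the line `A x + t C`.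
  have hl : ∀ i j, HasDerivAt (fun t : ℝ => (A x + t • C) i j) (C i j) 0 := by
    intro i j
    simpa using ((hasDerivAt_id (0 : ℝ)).mul_const (C i j)).const_add (A x i j)
  have h2 := (differentiable_det (fun i j => (A x + (0 : ℝ) • C) i j)).hasFDerivAt.comp_hasDerivAt 0
    (hasDerivAt_curve hl)
  have h3 : HasDerivAt (fun t : ℝ => (A x + t • C).det) ((A x).det * ((A x)⁻¹ * C).trace) 0 := by
    -- Factor out `A x`; then `det(1 + t M) = 1 + t tr M + O(t²)` with a polynomial remainder.
    have e : (fun t : ℝ => (A x + t • C).det)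
        = fun t => (A x).det * (1 + ((A x)⁻¹ * C).trace * t
          + ((1 + (Polynomial.X : Polynomial ℝ) • ((A x)⁻¹ * C).map Polynomial.C).det.divX.divX).eval t
            * t ^ 2) := by
      ext t
      rw [← Matrix.det_one_add_smul, ← Matrix.det_mul, Matrix.mul_add, Matrix.mul_one,
        Matrix.mul_smul, ← Matrix.mul_assoc, Matrix.mul_nonsing_inv _ hu, Matrix.one_mul]
    rw [e]
    set p := (1 + (Polynomial.X : Polynomial ℝ) • ((A x)⁻¹ * C).map Polynomial.C).det.divX.divX
    refine ((((hasDerivAt_id (0 : ℝ)).const_mul ((A x)⁻¹ * C).trace).const_add 1).add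
      ((p.hasDerivAt 0).mul ((hasDerivAt_id (0 : ℝ)).pow 2))).const_mul (A x).det |>.congr_deriv ?_
    simp
  have h4 := h2.unique h3
  simp only [zero_smul, add_zero] at h4
  exact h1.congr_deriv h4

/-- Cramer's rule shows that the derivative exists. Its value follows from differentiating `A A⁻¹ =
1`, valid near `x` because the determinant stays nonzero. -/
theorem hasDerivAt_inv (hdet : (A x).det ≠ 0)
    (hA : ∀ i j, HasDerivAt (fun t => A t i j) (C i j) x) (i j : Fin q) :
    HasDerivAt (fun t => (A t)⁻¹ i j) (-((A x)⁻¹ * C * (A x)⁻¹) i j) x := by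
  have hu : IsUnit (A x).det := isUnit_iff_ne_zero.2 hdet
  obtain ⟨D, hD⟩ : ∃ D : Matrix (Fin q) (Fin q) ℝ,
      ∀ i j, HasDerivAt (fun t => (A t)⁻¹ i j) (D i j) x := by
    have h : ∀ i j, ∃ c, HasDerivAt (fun t => (A t)⁻¹ i j) c x := fun i j =>
      ⟨_, (differentiableAt_inv_apply hdet i j).hasFDerivAt.comp_hasDerivAt x (hasDerivAt_curve hA)⟩
    choose D hD using h
    exact ⟨D, hD⟩
  have hev : ∀ᶠ t in 𝓝 x, (A t).det ≠ 0 :=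
    (hasDerivAt_det hdet hA).continuousAt.eventually_ne hdet
  have hz : C * (A x)⁻¹ + A x * D = 0 := by
    ext i j
    have h1 : HasDerivAt (fun t => ∑ k, A t i k * (A t)⁻¹ k j)
        (∑ k, (C i k * (A x)⁻¹ k j + A x i k * D k j)) x :=
      HasDerivAt.fun_sum fun k _ => (hA i k).mul (hD k j)
    have h2 : HasDerivAt (fun t => ∑ k, A t i k * (A t)⁻¹ k j) 0 x := by
      refine (hasDerivAt_const x ((1 : Matrix (Fin q) (Fin q) ℝ) i j)).congr_of_eventuallyEq ?_
      filter_upwards [hev] with t ht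
      rw [← Matrix.mul_apply, Matrix.mul_nonsing_inv _ (isUnit_iff_ne_zero.2 ht)]
    have h3 := h1.unique h2
    rw [Finset.sum_add_distrib, ← Matrix.mul_apply, ← Matrix.mul_apply] at h3
    exact h3
  have hDe : D = -((A x)⁻¹ * C * (A x)⁻¹) := by
    have h4 := congrArg (fun M => (A x)⁻¹ * M) hz
    simp only [Matrix.mul_add, Matrix.mul_zero, ← Matrix.mul_assoc, Matrix.nonsing_inv_mul _ hu,
      Matrix.one_mul] at h4
    exact eq_neg_of_add_eq_zero_right h4
  have := hD i j
  rwa [hDe] at this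

theorem hasDerivAt_bilin {B : ℝ → Matrix (Fin q) (Fin q) ℝ} {B' : Matrix (Fin q) (Fin q) ℝ}
    {v w : ℝ → Fin q → ℝ} {v' w' : Fin q → ℝ}
    (hB : ∀ i j, HasDerivAt (fun t => B t i j) (B' i j) x)
    (hv : ∀ i, HasDerivAt (fun t => v t i) (v' i) x)
    (hw : ∀ i, HasDerivAt (fun t => w t i) (w' i) x) :
    HasDerivAt (fun t => v t ⬝ᵥ (B t *ᵥ w t))
      (v' ⬝ᵥ (B x *ᵥ w x) + v x ⬝ᵥ (B' *ᵥ w x) + v x ⬝ᵥ (B x *ᵥ w')) x := by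
  have h : HasDerivAt (fun t => ∑ i, v t i * ∑ j, B t i j * w t j)
      (∑ i, (v' i * (∑ j, B x i j * w x j)
        + v x i * ∑ j, (B' i j * w x j + B x i j * w' j))) x :=
    HasDerivAt.fun_sum fun i _ => (hv i).fun_mul
      (HasDerivAt.fun_sum fun j _ => (hB i j).fun_mul (hw j))
  refine (show HasDerivAt (fun t => v t ⬝ᵥ (B t *ᵥ w t)) _ x from h).congr_deriv ?_
  simp only [dotProduct, Matrix.mulVec, Finset.sum_add_distrib, mul_add, add_assoc]

end MatrixCurves

/-! ### The score of one observation -/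

section LogDensityDerivatives

variable {q : ℕ} {g : ℝ → ℝ} {x : ℝ}

theorem mahal_pos {m : Fin q → ℝ} {S : Matrix (Fin q) (Fin q) ℝ} (hS : S.PosDef)
    {y : Fin q → ℝ} (hy : y ≠ m) : 0 < mahal m S y := by
  have := hS.inv.dotProduct_mulVec_pos (sub_ne_zero.2 hy)
  simpa [mahal] using this

/-- The point `y = m x` is excluded because `g` is differentiable only on `(0, ∞)`. -/
theorem hasDerivAt_logDensity_loc (hg : IsGenerator q g) {m : ℝ → Fin q → ℝ} {a : Fin q → ℝ}
    {S : Matrix (Fin q) (Fin q) ℝ} (hS : S.PosDef)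
    (hm : ∀ i, HasDerivAt (fun t => m t i) (a i) x) {y : Fin q → ℝ} (hy : y ≠ m x) :
    HasDerivAt (fun t => -(1 / 2) * Real.log S.det + Real.log (g (mahal (m t) S y)))
      (locScore g (m x) S a y) x := by
  have hv : ∀ i, HasDerivAt (fun t => (y - m t) i) ((-a) i) x := fun i =>
    (hm i).const_sub (y i)
  have hu := hasDerivAt_bilin (x := x) (B := fun _ => S⁻¹) (B' := 0)
    (fun i j => hasDerivAt_const x _) hv hv
  have h := (HasDerivAt.comp x (h₂ := fun t => Real.log (g t))
    (hg.hasDerivAt_log (mahal_pos hS hy)) hu).const_add (-(1 / 2) * Real.log S.det)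
  refine h.congr_deriv ?_
  rw [Matrix.zero_mulVec, dotProduct_zero, add_zero, Matrix.mulVec_neg, dotProduct_neg,
    neg_dotProduct, dotProduct_inv_mulVec hS (y - m x) a, dotProduct_comm (S⁻¹ *ᵥ (y - m x)) a,
    locScore, mahal]
  ring

theorem hasDerivAt_logDensity_scale (hg : IsGenerator q g) {m : Fin q → ℝ}
    {S : ℝ → Matrix (Fin q) (Fin q) ℝ} {C : Matrix (Fin q) (Fin q) ℝ} (hS : (S x).PosDef)
    (hC : ∀ i j, HasDerivAt (fun t => S t i j) (C i j) x) {y : Fin q → ℝ} (hy : y ≠ m) :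
    HasDerivAt (fun t => -(1 / 2) * Real.log (S t).det + Real.log (g (mahal m (S t) y)))
      (scaleScore g m (S x) C y) x := by
  have hdet := hS.det_pos.ne'
  have hu := hasDerivAt_bilin (x := x) (B := fun t => (S t)⁻¹)
    (B' := -((S x)⁻¹ * C * (S x)⁻¹)) (v := fun _ => y - m) (w := fun _ => y - m) (v' := 0)
    (w' := 0) (hasDerivAt_inv hdet hC) (fun i => hasDerivAt_const x _)
    (fun i => hasDerivAt_const x _)
  have h := (((hasDerivAt_det hdet hC).log hdet).const_mul (-(1 / 2))).add
    (HasDerivAt.comp x (h₂ := fun t => Real.log (g t)) (hg.hasDerivAt_log (mahal_pos hS hy)) hu)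
  refine h.congr_deriv ?_
  rw [Matrix.mulVec_zero, dotProduct_zero, add_zero, zero_dotProduct, zero_add, Matrix.neg_mulVec,
    dotProduct_neg, mul_div_cancel_left₀ _ hdet, scaleScore, mahal]
  ring

end LogDensityDerivatives

/-! ### Independence -/

section Independence

variable {κ : Type*} [Fintype κ] [DecidableEq κ] {E : κ → Type*} [∀ i, MeasureSpace (E i)]
  [∀ i, SigmaFinite (volume : Measure (E i))]

/-- After expansion each term is a product over coordinates. If `i ≠ j`, coordinate `i` carries the
factor `∫ A_i d_i = 0`; it is enough that one of the two families is centred. -/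
theorem integral_sum_mul_sum {d A B : ∀ i, E i → ℝ} (hd : ∀ i, Integrable (d i))
    (hA : ∀ i, Integrable fun x => A i x * d i x) (hB : ∀ i, Integrable fun x => B i x * d i x)
    (hAB : ∀ i, Integrable fun x => A i x * B i x * d i x) (hd1 : ∀ i, ∫ x, d i x = 1)
    (hA0 : ∀ i, ∫ x, A i x * d i x = 0) :
    ∫ y : (∀ i, E i), (∑ i, A i (y i)) * (∑ i, B i (y i)) * ∏ i, d i (y i)
      = ∑ i, ∫ x, A i x * B i x * d i x := by
  -- The factor of the `(i, j)` term in coordinate `l`: `A` is inserted at `l = i`, `B` at `l = j`,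
  -- and only the density elsewhere.
  let φ : κ → κ → ∀ l, E l → ℝ := fun i j l x =>
    (if l = i then A l x else 1) * (if l = j then B l x else 1) * d l x
  have hφ : ∀ i j l, Integrable (φ i j l) := by
    intro i j l
    simp only [φ]
    split_ifs <;> (try simp only [one_mul, mul_one]) <;>
      first | exact hAB l | exact hA l | exact hB l | exact hd l
  have hprod : ∀ i j (y : ∀ i, E i), ∏ l, φ i j l (y l)
      = A i (y i) * B j (y j) * ∏ l, d l (y l) := by
    intro i j y
    simp only [φ, Finset.prod_mul_distrib, Finset.prod_ite_eq', Finset.mem_univ, if_true]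
  have hpi : ∀ i j, Integrable fun y : (∀ i, E i) => A i (y i) * B j (y j) * ∏ l, d l (y l) := by
    intro i j
    simp only [← hprod]
    exact Integrable.fintype_prod_dep (hφ i j)
  have hval : ∀ i j, ∫ y : (∀ i, E i), A i (y i) * B j (y j) * ∏ l, d l (y l)
      = if i = j then ∫ x, A i x * B i x * d i x else 0 := by
    intro i j
    simp only [← hprod]
    rw [integral_fintype_prod_volume_eq_prod (φ i j)]
    split_ifs with h
    · subst h
      rw [Finset.prod_eq_single i]
      · simp [φ]
      · intro l _ hl
        simp [φ, hl, hd1]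
      · simp
    · refine Finset.prod_eq_zero (Finset.mem_univ i) ?_
      simp [φ, h, hA0]
  have e : ∀ y : (∀ i, E i), (∑ i, A i (y i)) * (∑ i, B i (y i)) * ∏ i, d i (y i)
      = ∑ i, ∑ j, A i (y i) * B j (y j) * ∏ l, d l (y l) := by
    intro y
    rw [Finset.sum_mul_sum, Finset.sum_mul]
    exact Finset.sum_congr rfl fun i _ => Finset.sum_mul _ _ _
  simp only [e]
  rw [integral_finsetSum _ fun i _ => integrable_finsetSum _ fun j _ => hpi i j]
  refine Finset.sum_congr rfl fun i _ => ?_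
  rw [integral_finsetSum _ fun j _ => hpi i j]
  simp [hval]

/-- Among three indices that are not all equal, one occurs exactly once, and its centred factor
makes the term vanish. Three factors therefore behave like two; for four, pairs of equal indices
would survive. -/
theorem integral_sum_mul_sum_mul_sum {d A B C : ∀ i, E i → ℝ} (hd : ∀ i, Integrable (d i))
    (hA : ∀ i, Integrable fun x => A i x * d i x) (hB : ∀ i, Integrable fun x => B i x * d i x)
    (hC : ∀ i, Integrable fun x => C i x * d i x)
    (hAB : ∀ i, Integrable fun x => A i x * B i x * d i x)
    (hAC : ∀ i, Integrable fun x => A i x * C i x * d i x)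
    (hBC : ∀ i, Integrable fun x => B i x * C i x * d i x)
    (hABC : ∀ i, Integrable fun x => A i x * B i x * C i x * d i x) (hd1 : ∀ i, ∫ x, d i x = 1)
    (hA0 : ∀ i, ∫ x, A i x * d i x = 0) (hB0 : ∀ i, ∫ x, B i x * d i x = 0)
    (hC0 : ∀ i, ∫ x, C i x * d i x = 0) :
    ∫ y : (∀ i, E i), (∑ i, A i (y i)) * (∑ i, B i (y i)) * (∑ i, C i (y i)) * ∏ i, d i (y i)
      = ∑ i, ∫ x, A i x * B i x * C i x * d i x := by
  let φ : κ → κ → κ → ∀ l, E l → ℝ := fun i j k l x =>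
    (if l = i then A l x else 1) * (if l = j then B l x else 1) * (if l = k then C l x else 1)
      * d l x
  have hφ : ∀ i j k l, Integrable (φ i j k l) := by
    intro i j k l
    simp only [φ]
    split_ifs <;> (try simp only [one_mul, mul_one]) <;>
      first | exact hABC l | exact hAB l | exact hAC l | exact hBC l | exact hA l | exact hB l
            | exact hC l | exact hd l
  have hprod : ∀ i j k (y : ∀ i, E i), ∏ l, φ i j k l (y l)
      = A i (y i) * B j (y j) * C k (y k) * ∏ l, d l (y l) := by
    intro i j k y
    simp only [φ, Finset.prod_mul_distrib, Finset.prod_ite_eq', Finset.mem_univ, if_true]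
  have hpi : ∀ i j k, Integrable fun y : (∀ i, E i) =>
      A i (y i) * B j (y j) * C k (y k) * ∏ l, d l (y l) := by
    intro i j k
    simp only [← hprod]
    exact Integrable.fintype_prod_dep (hφ i j k)
  have hval : ∀ i j k, ∫ y : (∀ i, E i), A i (y i) * B j (y j) * C k (y k) * ∏ l, d l (y l)
      = if j = i then (if k = i then ∫ x, A i x * B i x * C i x * d i x else 0) else 0 := by
    intro i j k
    simp only [← hprod]
    rw [integral_fintype_prod_volume_eq_prod (φ i j k)]
    by_cases hji : j = i <;> by_cases hki : k = i
    · subst hji hki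
      simp only [if_true]
      rw [Finset.prod_eq_single k]
      · simp [φ]
      · intro l _ hl
        simp [φ, hl, hd1]
      · simp
    · rw [if_pos hji, if_neg hki]
      refine Finset.prod_eq_zero (Finset.mem_univ k) ?_
      have : k ≠ j := fun h => hki (h.trans hji)
      simp [φ, hki, this, hC0]
    · rw [if_neg hji]
      refine Finset.prod_eq_zero (Finset.mem_univ j) ?_
      have : j ≠ k := fun h => hji (h.trans hki)
      simp [φ, hji, this, hB0]
    · rw [if_neg hji]
      refine Finset.prod_eq_zero (Finset.mem_univ i) ?_
      simp [φ, Ne.symm hji, Ne.symm hki, hA0]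
  have e : ∀ y : (∀ i, E i),
      (∑ i, A i (y i)) * (∑ i, B i (y i)) * (∑ i, C i (y i)) * ∏ i, d i (y i)
      = ∑ i, ∑ j, ∑ k, A i (y i) * B j (y j) * C k (y k) * ∏ l, d l (y l) := by
    intro y
    rw [Finset.sum_mul_sum, Finset.sum_mul, Finset.sum_mul]
    refine Finset.sum_congr rfl fun i _ => ?_
    rw [Finset.sum_mul_sum, Finset.sum_mul]
    exact Finset.sum_congr rfl fun j _ => Finset.sum_mul _ _ _
  simp only [e]
  rw [integral_finsetSum _ fun i _ => integrable_finsetSum _ fun j _ =>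
    integrable_finsetSum _ fun k _ => hpi i j k]
  refine Finset.sum_congr rfl fun i _ => ?_
  rw [integral_finsetSum _ fun j _ => integrable_finsetSum _ fun k _ => hpi i j k]
  have e2 : ∀ j, ∫ y : (∀ i, E i), ∑ k, A i (y i) * B j (y j) * C k (y k) * ∏ l, d l (y l)
      = if j = i then ∫ x, A i x * B i x * C i x * d i x else 0 := by
    intro j
    rw [integral_finsetSum _ fun k _ => hpi i j k]
    simp only [hval]
    split_ifs <;> simp
  simp only [e2, Finset.sum_ite_eq', Finset.mem_univ, if_true]

end Independence

/-! ### The likelihood of the sample -/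

section ModelLikelihood

variable {n p₁ p₂ : ℕ} {q : Fin n → ℕ} {ι : Type*} {g : Fin n → ℝ → ℝ}

theorem log_ellipticalDensity {q : ℕ} {g : ℝ → ℝ} (hg : IsGenerator q g) {m : Fin q → ℝ}
    {S : Matrix (Fin q) (Fin q) ℝ} (hS : S.PosDef) (y : Fin q → ℝ) :
    Real.log (ellipticalDensity g m S y) = -(1 / 2) * Real.log S.det
      + Real.log (g (mahal m S y)) := by
  have h := hg.pos (mahal m S y) (hS.inv.posSemidef.dotProduct_mulVec_nonneg (y - m))
  rw [ellipticalDensity, Real.log_mul (Real.rpow_pos_of_pos hS.det_pos _).ne' h.ne',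
    Real.log_rpow hS.det_pos]

variable {μ : ∀ i, (ι → ℝ) → Fin (q i) → ℝ} {S : ∀ i, (ι → ℝ) → Matrix (Fin (q i)) (Fin (q i)) ℝ}
  {θ : ι → ℝ}

theorem logLik_eq_sum_log (hg : ∀ i, IsGenerator (q i) (g i)) (hS : ∀ i, (S i θ).PosDef)
    (y : ∀ i, Fin (q i) → ℝ) :
    logLik g μ S θ y = ∑ i, Real.log (ellipticalDensity (g i) (μ i θ) (S i θ) (y i)) :=
  Finset.sum_congr rfl fun i _ => (log_ellipticalDensity (hg i) (hS i) (y i)).symm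

theorem jointDensity_eq_exp (hg : ∀ i, IsGenerator (q i) (g i)) (hS : ∀ i, (S i θ).PosDef)
    (y : ∀ i, Fin (q i) → ℝ) : jointDensity g μ S θ y = Real.exp (logLik g μ S θ y) := by
  rw [logLik_eq_sum_log hg hS, Real.exp_sum]
  exact Finset.prod_congr rfl fun i _ =>
    (Real.exp_log (ellipticalDensity_pos (hg i) (hS i) (y i))).symm

theorem aestronglyMeasurable_logLik (hg : ∀ i, IsGenerator (q i) (g i))
    (hS : ∀ i, (S i θ).PosDef) : AEStronglyMeasurable (logLik g μ S θ) := by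
  rw [funext (logLik_eq_sum_log hg hS)]
  refine Finset.aestronglyMeasurable_fun_sum _ fun i _ => ?_
  have h1 : AEStronglyMeasurable fun y : Fin (q i) → ℝ =>
      Real.log (ellipticalDensity (g i) (μ i θ) (S i θ) y) :=
    (Real.measurable_log.comp_aemeasurable
      (integrable_ellipticalDensity (hg i) (hS i)).aestronglyMeasurable.aemeasurable).aestronglyMeasurable
  exact h1.comp_quasiMeasurePreserving
    (Measure.quasiMeasurePreserving_eval (fun i => (volume : Measure (Fin (q i) → ℝ))) i)

theorem integral_jointDensity (hg : ∀ i, IsGenerator (q i) (g i)) (hS : ∀ i, (S i θ).PosDef) :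
    ∫ y, jointDensity g μ S θ y = 1 := by
  simp only [jointDensity]
  rw [integral_fintype_prod_volume_eq_prod fun i => ellipticalDensity (g i) (μ i θ) (S i θ)]
  exact Finset.prod_eq_one fun i _ => integral_ellipticalDensity (hg i) (hS i)

theorem ae_forall_ne (hq : ∀ i, 0 < q i) (m : ∀ i, Fin (q i) → ℝ) :
    ∀ᵐ y : (∀ i, Fin (q i) → ℝ), ∀ i, y i ≠ m i := by
  refine ae_all_iff.2 fun i => ?_
  have : Nonempty (Fin (q i)) := ⟨⟨0, hq i⟩⟩
  exact (Measure.quasiMeasurePreserving_eval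
    (fun i => (volume : Measure (Fin (q i) → ℝ))) i).ae (Measure.ae_ne volume (m i))

theorem inl_line {p₁ p₂ : ℕ} (θ : Fin p₁ ⊕ Fin p₂ → ℝ) (r : Fin p₁) (x : ℝ) :
    (θ + x • Pi.single (Sum.inl r) (1 : ℝ)) ∘ Sum.inl = θ ∘ Sum.inl + x • Pi.single r (1 : ℝ) ∧
    (θ + x • Pi.single (Sum.inl r) (1 : ℝ)) ∘ Sum.inr = θ ∘ Sum.inr := by
  constructor <;> ext k <;> simp [Pi.single_apply]

theorem inr_line {p₁ p₂ : ℕ} (θ : Fin p₁ ⊕ Fin p₂ → ℝ) (s : Fin p₂) (x : ℝ) :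
    (θ + x • Pi.single (Sum.inr s) (1 : ℝ)) ∘ Sum.inl = θ ∘ Sum.inl ∧
    (θ + x • Pi.single (Sum.inr s) (1 : ℝ)) ∘ Sum.inr = θ ∘ Sum.inr + x • Pi.single s (1 : ℝ) := by
  constructor <;> ext k <;> simp [Pi.single_apply]

end ModelLikelihood

/-! ### The score components in the location and scale parameters. -/

section ModelScore

variable {n p₁ p₂ : ℕ} {q : Fin n → ℕ} {g : Fin n → ℝ → ℝ}
  {μ : ∀ i, (Fin p₁ → ℝ) → Fin (q i) → ℝ}
  {S : ∀ i, (Fin p₂ → ℝ) → Matrix (Fin (q i)) (Fin (q i)) ℝ} {θ : Fin p₁ ⊕ Fin p₂ → ℝ}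

/-- The joint density as a function of `θ = (θ₁, θ₂)`. -/
abbrev modelDensity (g : Fin n → ℝ → ℝ) (μ : ∀ i, (Fin p₁ → ℝ) → Fin (q i) → ℝ)
    (S : ∀ i, (Fin p₂ → ℝ) → Matrix (Fin (q i)) (Fin (q i)) ℝ) :
    (Fin p₁ ⊕ Fin p₂ → ℝ) → (∀ i, Fin (q i) → ℝ) → ℝ :=
  jointDensity g (fun i t => μ i (t ∘ Sum.inl)) (fun i t => S i (t ∘ Sum.inr))

/-- The log-likelihood as a function of `θ = (θ₁, θ₂)`. -/
abbrev modelLogLik (g : Fin n → ℝ → ℝ) (μ : ∀ i, (Fin p₁ → ℝ) → Fin (q i) → ℝ)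
    (S : ∀ i, (Fin p₂ → ℝ) → Matrix (Fin (q i)) (Fin (q i)) ℝ) :
    (Fin p₁ ⊕ Fin p₂ → ℝ) → (∀ i, Fin (q i) → ℝ) → ℝ :=
  logLik g (fun i t => μ i (t ∘ Sum.inl)) (fun i t => S i (t ∘ Sum.inr))

/-- The score of the location parameter `θ_{1(r)}`. -/
def sampleLocScore (g : Fin n → ℝ → ℝ) (μ : ∀ i, (Fin p₁ → ℝ) → Fin (q i) → ℝ)
    (S : ∀ i, (Fin p₂ → ℝ) → Matrix (Fin (q i)) (Fin (q i)) ℝ) (θ₁ : Fin p₁ → ℝ)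
    (θ₂ : Fin p₂ → ℝ) (r : Fin p₁) (y : ∀ i, Fin (q i) → ℝ) : ℝ :=
  ∑ i, locScore (g i) (μ i θ₁) (S i θ₂) (locDeriv (μ i) θ₁ r) (y i)

/-- The score of the scale parameter `θ_{2(s)}`. -/
def sampleScaleScore (g : Fin n → ℝ → ℝ) (μ : ∀ i, (Fin p₁ → ℝ) → Fin (q i) → ℝ)
    (S : ∀ i, (Fin p₂ → ℝ) → Matrix (Fin (q i)) (Fin (q i)) ℝ) (θ₁ : Fin p₁ → ℝ)
    (θ₂ : Fin p₂ → ℝ) (s : Fin p₂) (y : ∀ i, Fin (q i) → ℝ) : ℝ :=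
  ∑ i, scaleScore (g i) (μ i θ₁) (S i θ₂) (scaleDeriv (S i) θ₂ s) (y i)

/-- Differentiability of the log-likelihood at `θ` reduces the partial derivative to a derivative
along a coordinate line, on which every `Σ_i` is constant. -/
theorem score_inl (hg : ∀ i, IsGenerator (q i) (g i)) (hS : ∀ i, (S i (θ ∘ Sum.inr)).PosDef)
    (hμ : ∀ i a, DifferentiableAt ℝ (fun t => μ i t a) (θ ∘ Sum.inl))
    {y : ∀ i, Fin (q i) → ℝ} (hy : ∀ i, y i ≠ μ i (θ ∘ Sum.inl))
    (hd : DifferentiableAt ℝ (fun t => modelLogLik g μ S t y) θ) (r : Fin p₁) :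
    score (modelLogLik g μ S) (Sum.inl r) θ y
      = sampleLocScore g μ S (θ ∘ Sum.inl) (θ ∘ Sum.inr) r y := by
  have h1 := hasDerivAt_pderiv (r := Sum.inl r) hd
  have h2 : HasDerivAt (fun x : ℝ => modelLogLik g μ S (θ + x • Pi.single (Sum.inl r) (1 : ℝ)) y)
      (sampleLocScore g μ S (θ ∘ Sum.inl) (θ ∘ Sum.inr) r y) 0 := by
    simp only [logLik, (inl_line θ r _).1, (inl_line θ r _).2]
    refine HasDerivAt.fun_sum fun i _ => ?_
    have := hasDerivAt_logDensity_loc (x := 0) (hg i)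
      (m := fun x => μ i (θ ∘ Sum.inl + x • Pi.single r (1 : ℝ)))
      (a := locDeriv (μ i) (θ ∘ Sum.inl) r) (hS i)
      (fun a => hasDerivAt_pderiv (h := fun t => μ i t a) (hμ i a))
      (y := y i) (by simpa using hy i)
    simpa using this
  exact h1.unique h2

theorem score_inr (hg : ∀ i, IsGenerator (q i) (g i)) (hS : ∀ i, (S i (θ ∘ Sum.inr)).PosDef)
    (hSd : ∀ i a b, DifferentiableAt ℝ (fun t => S i t a b) (θ ∘ Sum.inr))
    {y : ∀ i, Fin (q i) → ℝ} (hy : ∀ i, y i ≠ μ i (θ ∘ Sum.inl))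
    (hd : DifferentiableAt ℝ (fun t => modelLogLik g μ S t y) θ) (s : Fin p₂) :
    score (modelLogLik g μ S) (Sum.inr s) θ y
      = sampleScaleScore g μ S (θ ∘ Sum.inl) (θ ∘ Sum.inr) s y := by
  have h1 := hasDerivAt_pderiv (r := Sum.inr s) hd
  have h2 : HasDerivAt (fun x : ℝ => modelLogLik g μ S (θ + x • Pi.single (Sum.inr s) (1 : ℝ)) y)
      (sampleScaleScore g μ S (θ ∘ Sum.inl) (θ ∘ Sum.inr) s y) 0 := by
    simp only [logLik, (inr_line θ s _).1, (inr_line θ s _).2]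
    refine HasDerivAt.fun_sum fun i _ => ?_
    have := hasDerivAt_logDensity_scale (x := 0) (hg i) (m := μ i (θ ∘ Sum.inl))
      (S := fun x => S i (θ ∘ Sum.inr + x • Pi.single s (1 : ℝ)))
      (C := scaleDeriv (S i) (θ ∘ Sum.inr) s) (by simpa using hS i)
      (fun a b => hasDerivAt_pderiv (h := fun t => S i t a b) (hSd i a b))
      (y := y i) (hy i)
    simpa using this
  exact h1.unique h2

/-- `Σ` is symmetric on an open set, so its entries `(a, b)` and `(b, a)` have the same derivatives.
-/
theorem scaleDeriv_isSymm {p q : ℕ} {S : (Fin p → ℝ) → Matrix (Fin q) (Fin q) ℝ}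
    {Θ : Set (Fin p → ℝ)} (hΘ : IsOpen Θ) (hS : ∀ t ∈ Θ, (S t).PosDef) {θ : Fin p → ℝ}
    (hθ : θ ∈ Θ) (s : Fin p) : (scaleDeriv S θ s).IsSymm := by
  ext a b
  simp only [Matrix.transpose_apply, scaleDeriv, Matrix.of_apply]
  refine pderiv_congr ?_
  filter_upwards [hΘ.mem_nhds hθ] with t ht
  exact (isSymm_of_posDef (hS t ht)).apply a b

end ModelScore

/-! ### Fisher information and third moments of the score -/

section ModelMoments

variable {n p₁ p₂ : ℕ} {q : Fin n → ℕ} {g : Fin n → ℝ → ℝ}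
  {μ : ∀ i, (Fin p₁ → ℝ) → Fin (q i) → ℝ}
  {S : ∀ i, (Fin p₂ → ℝ) → Matrix (Fin (q i)) (Fin (q i)) ℝ} {θ : Fin p₁ ⊕ Fin p₂ → ℝ}

theorem expect_congr_score {ι Y : Type*} [MeasureSpace Y] {f : (ι → ℝ) → Y → ℝ} {θ : ι → ℝ}
    {h k : Y → ℝ} (H : ∀ᵐ y, h y = k y) : expect f θ h = expect f θ k :=
  integral_congr_ae (H.mono fun y hy => by simp only [hy])

theorem modelDensity_reflect (y : ∀ i, Fin (q i) → ℝ) :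
    modelDensity g μ S θ ((fun i => (2 : ℝ) • μ i (θ ∘ Sum.inl)) - y) = modelDensity g μ S θ y :=
  Finset.prod_congr rfl fun _ _ => ellipticalDensity_reflect _

theorem sampleLocScore_reflect (θ₁ : Fin p₁ → ℝ) (θ₂ : Fin p₂ → ℝ) (r : Fin p₁)
    (y : ∀ i, Fin (q i) → ℝ) :
    sampleLocScore g μ S θ₁ θ₂ r ((fun i => (2 : ℝ) • μ i θ₁) - y)
      = -sampleLocScore g μ S θ₁ θ₂ r y := by
  rw [sampleLocScore, sampleLocScore, ← Finset.sum_neg_distrib]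
  exact Finset.sum_congr rfl fun _ _ => locScore_reflect _ _

theorem sampleScaleScore_reflect (θ₁ : Fin p₁ → ℝ) (θ₂ : Fin p₂ → ℝ) (s : Fin p₂)
    (y : ∀ i, Fin (q i) → ℝ) :
    sampleScaleScore g μ S θ₁ θ₂ s ((fun i => (2 : ℝ) • μ i θ₁) - y)
      = sampleScaleScore g μ S θ₁ θ₂ s y :=
  Finset.sum_congr rfl fun _ _ => scaleScore_reflect _ _

/-- Reflecting all observations simultaneously preserves both Lebesgue measure and the joint
density. -/
theorem expect_eq_zero_of_odd {h : (∀ i, Fin (q i) → ℝ) → ℝ}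
    (hh : ∀ y, h ((fun i => (2 : ℝ) • μ i (θ ∘ Sum.inl)) - y) = -h y) :
    expect (modelDensity g μ S) θ h = 0 := by
  have : (volume : Measure (∀ i, Fin (q i) → ℝ)).IsNegInvariant :=
    Measure.pi.isNegInvariant fun i => (volume : Measure (Fin (q i) → ℝ))
  refine integral_eq_zero_of_reflect _ (fun i => (2 : ℝ) • μ i (θ ∘ Sum.inl)) fun y => ?_
  rw [hh, modelDensity_reflect, neg_mul]

/-- The parameter point `θ` at which the scores are given by the explicit formulas. -/
structure HasExplicitScore (g : Fin n → ℝ → ℝ) (μ : ∀ i, (Fin p₁ → ℝ) → Fin (q i) → ℝ)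
    (S : ∀ i, (Fin p₂ → ℝ) → Matrix (Fin (q i)) (Fin (q i)) ℝ) (θ : Fin p₁ ⊕ Fin p₂ → ℝ) :
    Prop where
  posDef : ∀ i, (S i (θ ∘ Sum.inr)).PosDef
  symm : ∀ i s, (scaleDeriv (S i) (θ ∘ Sum.inr) s).IsSymm
  inl : ∀ᵐ y, ∀ r, score (modelLogLik g μ S) (Sum.inl r) θ y
    = sampleLocScore g μ S (θ ∘ Sum.inl) (θ ∘ Sum.inr) r y
  inr : ∀ᵐ y, ∀ s, score (modelLogLik g μ S) (Sum.inr s) θ y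
    = sampleScaleScore g μ S (θ ∘ Sum.inl) (θ ∘ Sum.inr) s y

/-- The location block of the Fisher information. -/
def locInfo (g : Fin n → ℝ → ℝ) (μ : ∀ i, (Fin p₁ → ℝ) → Fin (q i) → ℝ)
    (S : ∀ i, (Fin p₂ → ℝ) → Matrix (Fin (q i)) (Fin (q i)) ℝ) (θ₁ : Fin p₁ → ℝ)
    (θ₂ : Fin p₂ → ℝ) (r s : Fin p₁) : ℝ :=
  ∑ i, 4 * psi (q i) (g i) 2 1 / q i *
    (locDeriv (μ i) θ₁ r ⬝ᵥ ((S i θ₂)⁻¹ *ᵥ locDeriv (μ i) θ₁ s))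

/-- The scale block of the Fisher information. -/
def scaleInfo (g : Fin n → ℝ → ℝ)
    (S : ∀ i, (Fin p₂ → ℝ) → Matrix (Fin (q i)) (Fin (q i)) ℝ)
    (θ₂ : Fin p₂ → ℝ) (r s : Fin p₂) : ℝ :=
  ∑ i, (cC (q i) (g i) / 2 *
      ((S i θ₂)⁻¹ * scaleDeriv (S i) θ₂ r * ((S i θ₂)⁻¹ * scaleDeriv (S i) θ₂ s)).trace
    + (cC (q i) (g i) - 1) / 4 * (((S i θ₂)⁻¹ * scaleDeriv (S i) θ₂ r).trace
      * ((S i θ₂)⁻¹ * scaleDeriv (S i) θ₂ s).trace))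

variable (hq : ∀ i, 0 < q i) (hg : ∀ i, IsGenerator (q i) (g i))
  (hθ : HasExplicitScore g μ S θ)

include hθ

theorem fisherInfo_inl_inr (r : Fin p₁) (s : Fin p₂) :
    fisherInfo (modelDensity g μ S) (modelLogLik g μ S) θ (Sum.inl r) (Sum.inr s) = 0 := by
  rw [fisherInfo, Matrix.of_apply, expect_congr_score (k := fun y =>
    sampleLocScore g μ S (θ ∘ Sum.inl) (θ ∘ Sum.inr) r y
      * sampleScaleScore g μ S (θ ∘ Sum.inl) (θ ∘ Sum.inr) s y)
    (by filter_upwards [hθ.inl, hθ.inr] with y h1 h2; rw [h1, h2])]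
  refine expect_eq_zero_of_odd fun y => ?_
  rw [sampleLocScore_reflect, sampleScaleScore_reflect, neg_mul]

theorem fisherInfo_inr_inl (r : Fin p₁) (s : Fin p₂) :
    fisherInfo (modelDensity g μ S) (modelLogLik g μ S) θ (Sum.inr s) (Sum.inl r) = 0 := by
  rw [← fisherInfo_inl_inr hθ r s]
  simp only [fisherInfo, Matrix.of_apply, mul_comm]

theorem scoreMoment3_inl_inl_inl (r s t : Fin p₁) :
    scoreMoment3 (modelDensity g μ S) (modelLogLik g μ S) θ (Sum.inl r) (Sum.inl s) (Sum.inl t)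
      = 0 := by
  rw [scoreMoment3, expect_congr_score (k := fun y =>
    sampleLocScore g μ S (θ ∘ Sum.inl) (θ ∘ Sum.inr) r y
      * sampleLocScore g μ S (θ ∘ Sum.inl) (θ ∘ Sum.inr) s y
      * sampleLocScore g μ S (θ ∘ Sum.inl) (θ ∘ Sum.inr) t y)
    (by filter_upwards [hθ.inl] with y h1; rw [h1, h1, h1])]
  refine expect_eq_zero_of_odd fun y => ?_
  rw [sampleLocScore_reflect, sampleLocScore_reflect, sampleLocScore_reflect]
  ring

theorem scoreMoment3_inl_inr_inr (r : Fin p₁) (s t : Fin p₂) :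
    scoreMoment3 (modelDensity g μ S) (modelLogLik g μ S) θ (Sum.inl r) (Sum.inr s) (Sum.inr t)
      = 0 := by
  rw [scoreMoment3, expect_congr_score (k := fun y =>
    sampleLocScore g μ S (θ ∘ Sum.inl) (θ ∘ Sum.inr) r y
      * sampleScaleScore g μ S (θ ∘ Sum.inl) (θ ∘ Sum.inr) s y
      * sampleScaleScore g μ S (θ ∘ Sum.inl) (θ ∘ Sum.inr) t y)
    (by filter_upwards [hθ.inl, hθ.inr] with y h1 h2; rw [h1, h2, h2])]
  refine expect_eq_zero_of_odd fun y => ?_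
  rw [sampleLocScore_reflect, sampleScaleScore_reflect, sampleScaleScore_reflect]
  ring

include hq hg

theorem fisherInfo_inl_inl (r s : Fin p₁) :
    fisherInfo (modelDensity g μ S) (modelLogLik g μ S) θ (Sum.inl r) (Sum.inl s)
      = locInfo g μ S (θ ∘ Sum.inl) (θ ∘ Sum.inr) r s := by
  rw [fisherInfo, Matrix.of_apply, expect_congr_score (k := fun y =>
    sampleLocScore g μ S (θ ∘ Sum.inl) (θ ∘ Sum.inr) r y
      * sampleLocScore g μ S (θ ∘ Sum.inl) (θ ∘ Sum.inr) s y)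
    (by filter_upwards [hθ.inl] with y h1; rw [h1, h1])]
  refine (integral_sum_mul_sum
    (fun i => integrable_ellipticalDensity (hg i) (hθ.posDef i))
    (fun i => integrable_locScore (hq i) (hg i) (hθ.posDef i) _)
    (fun i => integrable_locScore (hq i) (hg i) (hθ.posDef i) _)
    (fun i => integrable_locScore_mul (hq i) (hg i) (hθ.posDef i) _ _)
    (fun i => integral_ellipticalDensity (hg i) (hθ.posDef i))
    (fun i => integral_locScore _)).trans ?_
  exact Finset.sum_congr rfl fun i _ => integral_locScore_mul (hq i) (hg i) (hθ.posDef i) _ _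

theorem fisherInfo_inr_inr (r s : Fin p₂) :
    fisherInfo (modelDensity g μ S) (modelLogLik g μ S) θ (Sum.inr r) (Sum.inr s)
      = scaleInfo g S (θ ∘ Sum.inr) r s := by
  rw [fisherInfo, Matrix.of_apply, expect_congr_score (k := fun y =>
    sampleScaleScore g μ S (θ ∘ Sum.inl) (θ ∘ Sum.inr) r y
      * sampleScaleScore g μ S (θ ∘ Sum.inl) (θ ∘ Sum.inr) s y)
    (by filter_upwards [hθ.inr] with y h1; rw [h1, h1])]
  refine (integral_sum_mul_sum
    (fun i => integrable_ellipticalDensity (hg i) (hθ.posDef i))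
    (fun i => integrable_scaleScore (hq i) (hg i) (hθ.posDef i) _)
    (fun i => integrable_scaleScore (hq i) (hg i) (hθ.posDef i) _)
    (fun i => (scaleScore_mul_scaleScore_integral (hq i) (hg i) (hθ.posDef i)
      (hθ.symm i r) (hθ.symm i s)).1)
    (fun i => integral_ellipticalDensity (hg i) (hθ.posDef i))
    (fun i => integral_scaleScore (hq i) (hg i) (hθ.posDef i) _)).trans ?_
  exact Finset.sum_congr rfl fun i _ => (scaleScore_mul_scaleScore_integral (hq i) (hg i)
    (hθ.posDef i) (hθ.symm i r) (hθ.symm i s)).2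

theorem scoreMoment3_inr_inl_inl (r : Fin p₂) (s t : Fin p₁) :
    scoreMoment3 (modelDensity g μ S) (modelLogLik g μ S) θ (Sum.inr r) (Sum.inl s) (Sum.inl t)
      = ∑ i, -(1 / 2 * eta1 (q i) (g i) * (locDeriv (μ i) (θ ∘ Sum.inl) s ⬝ᵥ
          ((S i (θ ∘ Sum.inr))⁻¹ *ᵥ locDeriv (μ i) (θ ∘ Sum.inl) t))
          * ((S i (θ ∘ Sum.inr))⁻¹ * scaleDeriv (S i) (θ ∘ Sum.inr) r).trace
        + cStar (q i) (g i) * (locDeriv (μ i) (θ ∘ Sum.inl) s ⬝ᵥ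
          (((S i (θ ∘ Sum.inr))⁻¹ * scaleDeriv (S i) (θ ∘ Sum.inr) r * (S i (θ ∘ Sum.inr))⁻¹)
            *ᵥ locDeriv (μ i) (θ ∘ Sum.inl) t))) := by
  rw [scoreMoment3, expect_congr_score (k := fun y =>
    sampleLocScore g μ S (θ ∘ Sum.inl) (θ ∘ Sum.inr) s y
      * sampleLocScore g μ S (θ ∘ Sum.inl) (θ ∘ Sum.inr) t y
      * sampleScaleScore g μ S (θ ∘ Sum.inl) (θ ∘ Sum.inr) r y)
    (by filter_upwards [hθ.inl, hθ.inr] with y h1 h2; rw [h1, h1, h2]; ring)]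
  refine (integral_sum_mul_sum_mul_sum
    (fun i => integrable_ellipticalDensity (hg i) (hθ.posDef i))
    (fun i => integrable_locScore (hq i) (hg i) (hθ.posDef i) _)
    (fun i => integrable_locScore (hq i) (hg i) (hθ.posDef i) _)
    (fun i => integrable_scaleScore (hq i) (hg i) (hθ.posDef i) _)
    (fun i => integrable_locScore_mul (hq i) (hg i) (hθ.posDef i) _ _)
    (fun i => integrable_locScore_mul_scaleScore (hq i) (hg i) (hθ.posDef i) _ (hθ.symm i r))
    (fun i => integrable_locScore_mul_scaleScore (hq i) (hg i) (hθ.posDef i) _ (hθ.symm i r))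
    (fun i => (locScore_mul_locScore_mul_scaleScore_integral (hq i) (hg i) (hθ.posDef i) _ _
      (hθ.symm i r)).1)
    (fun i => integral_ellipticalDensity (hg i) (hθ.posDef i))
    (fun i => integral_locScore _) (fun i => integral_locScore _)
    (fun i => integral_scaleScore (hq i) (hg i) (hθ.posDef i) _)).trans ?_
  exact Finset.sum_congr rfl fun i _ => (locScore_mul_locScore_mul_scaleScore_integral (hq i)
    (hg i) (hθ.posDef i) _ _ (hθ.symm i r)).2

theorem scoreMoment3_inr_inr_inr (r s t : Fin p₂) :
    scoreMoment3 (modelDensity g μ S) (modelLogLik g μ S) θ (Sum.inr r) (Sum.inr s) (Sum.inr t)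
      = ∑ i, -((omegaT (q i) (g i) + 3 / 8 * cC (q i) (g i) - 1 / 4)
          * (((S i (θ ∘ Sum.inr))⁻¹ * scaleDeriv (S i) (θ ∘ Sum.inr) r).trace
            * ((S i (θ ∘ Sum.inr))⁻¹ * scaleDeriv (S i) (θ ∘ Sum.inr) s).trace
            * ((S i (θ ∘ Sum.inr))⁻¹ * scaleDeriv (S i) (θ ∘ Sum.inr) t).trace)
        + (cC (q i) (g i) / 4 + 2 * omegaT (q i) (g i))
          * (((S i (θ ∘ Sum.inr))⁻¹ * scaleDeriv (S i) (θ ∘ Sum.inr) r).trace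
              * ((S i (θ ∘ Sum.inr))⁻¹ * scaleDeriv (S i) (θ ∘ Sum.inr) s
                * ((S i (θ ∘ Sum.inr))⁻¹ * scaleDeriv (S i) (θ ∘ Sum.inr) t)).trace
            + ((S i (θ ∘ Sum.inr))⁻¹ * scaleDeriv (S i) (θ ∘ Sum.inr) s).trace
              * ((S i (θ ∘ Sum.inr))⁻¹ * scaleDeriv (S i) (θ ∘ Sum.inr) r
                * ((S i (θ ∘ Sum.inr))⁻¹ * scaleDeriv (S i) (θ ∘ Sum.inr) t)).trace
            + ((S i (θ ∘ Sum.inr))⁻¹ * scaleDeriv (S i) (θ ∘ Sum.inr) t).trace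
              * ((S i (θ ∘ Sum.inr))⁻¹ * scaleDeriv (S i) (θ ∘ Sum.inr) r
                * ((S i (θ ∘ Sum.inr))⁻¹ * scaleDeriv (S i) (θ ∘ Sum.inr) s)).trace)
        + 8 * omegaT (q i) (g i) * ((S i (θ ∘ Sum.inr))⁻¹ * scaleDeriv (S i) (θ ∘ Sum.inr) r
            * ((S i (θ ∘ Sum.inr))⁻¹ * scaleDeriv (S i) (θ ∘ Sum.inr) s)
            * ((S i (θ ∘ Sum.inr))⁻¹ * scaleDeriv (S i) (θ ∘ Sum.inr) t)).trace) := by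
  rw [scoreMoment3, expect_congr_score (k := fun y =>
    sampleScaleScore g μ S (θ ∘ Sum.inl) (θ ∘ Sum.inr) r y
      * sampleScaleScore g μ S (θ ∘ Sum.inl) (θ ∘ Sum.inr) s y
      * sampleScaleScore g μ S (θ ∘ Sum.inl) (θ ∘ Sum.inr) t y)
    (by filter_upwards [hθ.inr] with y h1; rw [h1, h1, h1])]
  have hs := fun i => integrable_scaleScore (m := μ i (θ ∘ Sum.inl)) (hq i) (hg i) (hθ.posDef i)
  have hss := fun i a b => (scaleScore_mul_scaleScore_integral (m := μ i (θ ∘ Sum.inl)) (hq i)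
    (hg i) (hθ.posDef i) (hθ.symm i a) (hθ.symm i b)).1
  have h0 := fun i => integral_scaleScore (m := μ i (θ ∘ Sum.inl)) (hq i) (hg i) (hθ.posDef i)
  refine (integral_sum_mul_sum_mul_sum
    (fun i => integrable_ellipticalDensity (hg i) (hθ.posDef i))
    (fun i => hs i _) (fun i => hs i _) (fun i => hs i _)
    (fun i => hss i _ _) (fun i => hss i _ _) (fun i => hss i _ _)
    (fun i => (scaleScore_cube_integral (hq i) (hg i) (hθ.posDef i) (hθ.symm i r)
      (hθ.symm i s) (hθ.symm i t)).1)
    (fun i => integral_ellipticalDensity (hg i) (hθ.posDef i))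
    (fun i => h0 i _) (fun i => h0 i _) (fun i => h0 i _)).trans ?_
  exact Finset.sum_congr rfl fun i _ => (scaleScore_cube_integral (hq i)
    (hg i) (hθ.posDef i) (hθ.symm i r) (hθ.symm i s) (hθ.symm i t)).2

end ModelMoments

/-! ### Derivatives of the Fisher information -/

section InfoDerivatives

theorem differentiableAt_pderiv {ι : Type*} [Fintype ι] [DecidableEq ι] {h : (ι → ℝ) → ℝ}
    {θ : ι → ℝ} (hd : DifferentiableAt ℝ (fderiv ℝ h) θ) (r : ι) :
    DifferentiableAt ℝ (pderiv r h) θ :=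
  hd.clm_apply (differentiableAt_const _)

theorem hasDerivAt_matrix_mul {q : ℕ} {A B : ℝ → Matrix (Fin q) (Fin q) ℝ}
    {A' B' : Matrix (Fin q) (Fin q) ℝ} {x : ℝ}
    (hA : ∀ i j, HasDerivAt (fun t => A t i j) (A' i j) x)
    (hB : ∀ i j, HasDerivAt (fun t => B t i j) (B' i j) x) (i j : Fin q) :
    HasDerivAt (fun t => (A t * B t) i j) ((A' * B x + A x * B') i j) x := by
  have h : HasDerivAt (fun t => ∑ k, A t i k * B t k j)
      (∑ k, (A' i k * B x k j + A x i k * B' k j)) x :=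
    HasDerivAt.fun_sum fun k _ => (hA i k).fun_mul (hB k j)
  refine (show HasDerivAt (fun t => (A t * B t) i j) _ x from h).congr_deriv ?_
  rw [Finset.sum_add_distrib, Matrix.add_apply, Matrix.mul_apply, Matrix.mul_apply]

theorem hasDerivAt_trace {q : ℕ} {A : ℝ → Matrix (Fin q) (Fin q) ℝ}
    {A' : Matrix (Fin q) (Fin q) ℝ} {x : ℝ}
    (hA : ∀ i j, HasDerivAt (fun t => A t i j) (A' i j) x) :
    HasDerivAt (fun t => (A t).trace) A'.trace x :=
  HasDerivAt.fun_sum fun i _ => hA i i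

/-- The second derivative `∂²m/∂θ_t∂θ_r`. -/
def locDeriv2 {p q : ℕ} (m : (Fin p → ℝ) → Fin q → ℝ) (θ : Fin p → ℝ) (r t : Fin p) :
    Fin q → ℝ :=
  fun a => pderiv t (fun τ => locDeriv m τ r a) θ

/-- The second derivative `∂²S/∂θ_t∂θ_r`. -/
def scaleDeriv2 {p q : ℕ} (S : (Fin p → ℝ) → Matrix (Fin q) (Fin q) ℝ) (θ : Fin p → ℝ)
    (r t : Fin p) : Matrix (Fin q) (Fin q) ℝ :=
  Matrix.of fun a b => pderiv t (fun τ => scaleDeriv S τ r a b) θ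

theorem locDeriv2_comm {p q : ℕ} {m : (Fin p → ℝ) → Fin q → ℝ} {Θ : Set (Fin p → ℝ)}
    (hΘ : IsOpen Θ) (hm : ∀ a, TwiceDifferentiableOn (fun t => m t a) Θ) {θ : Fin p → ℝ}
    (hθ : θ ∈ Θ) (r t : Fin p) : locDeriv2 m θ r t = locDeriv2 m θ t r :=
  funext fun a => pderiv_comm hΘ hθ (hm a).1 ((hm a).2.differentiableAt (hΘ.mem_nhds hθ)) r t

theorem scaleDeriv2_comm {p q : ℕ} {S : (Fin p → ℝ) → Matrix (Fin q) (Fin q) ℝ}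
    {Θ : Set (Fin p → ℝ)} (hΘ : IsOpen Θ)
    (hS : ∀ a b, TwiceDifferentiableOn (fun t => S t a b) Θ) {θ : Fin p → ℝ} (hθ : θ ∈ Θ)
    (r t : Fin p) : scaleDeriv2 S θ r t = scaleDeriv2 S θ t r := by
  ext a b
  exact pderiv_comm hΘ hθ (hS a b).1 ((hS a b).2.differentiableAt (hΘ.mem_nhds hθ)) r t

variable {n p₁ p₂ : ℕ} {q : Fin n → ℕ} {g : Fin n → ℝ → ℝ}
  {μ : ∀ i, (Fin p₁ → ℝ) → Fin (q i) → ℝ}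
  {S : ∀ i, (Fin p₂ → ℝ) → Matrix (Fin (q i)) (Fin (q i)) ℝ}
  {θ₁ : Fin p₁ → ℝ} {θ₂ : Fin p₂ → ℝ}

theorem hasDerivAt_locInfo_loc
    (hμ : ∀ i a, DifferentiableAt ℝ (fderiv ℝ fun t => μ i t a) θ₁) (r s t : Fin p₁) :
    HasDerivAt (fun x : ℝ => locInfo g μ S (θ₁ + x • Pi.single t (1 : ℝ)) θ₂ r s)
      (∑ i, 4 * psi (q i) (g i) 2 1 / q i *
        (locDeriv2 (μ i) θ₁ r t ⬝ᵥ ((S i θ₂)⁻¹ *ᵥ locDeriv (μ i) θ₁ s)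
          + locDeriv (μ i) θ₁ r ⬝ᵥ ((S i θ₂)⁻¹ *ᵥ locDeriv2 (μ i) θ₁ s t))) 0 := by
  refine HasDerivAt.fun_sum fun i _ => HasDerivAt.const_mul _ ?_
  have hd : ∀ r a, HasDerivAt (fun x : ℝ => locDeriv (μ i) (θ₁ + x • Pi.single t (1 : ℝ)) r a)
      (locDeriv2 (μ i) θ₁ r t a) 0 := fun r a =>
    hasDerivAt_pderiv (h := fun τ => locDeriv (μ i) τ r a) (differentiableAt_pderiv (hμ i a) r)
  have := hasDerivAt_bilin (x := 0) (B := fun _ => (S i θ₂)⁻¹) (B' := 0)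
    (fun a b => hasDerivAt_const _ _) (hd r) (hd s)
  simpa using this

theorem hasDerivAt_locInfo_scale (hS : ∀ i, (S i θ₂).PosDef)
    (hSd : ∀ i a b, DifferentiableAt ℝ (fun t => S i t a b) θ₂) (r s : Fin p₁) (t : Fin p₂) :
    HasDerivAt (fun x : ℝ => locInfo g μ S θ₁ (θ₂ + x • Pi.single t (1 : ℝ)) r s)
      (∑ i, 4 * psi (q i) (g i) 2 1 / q i *
        -(locDeriv (μ i) θ₁ r ⬝ᵥ (((S i θ₂)⁻¹ * scaleDeriv (S i) θ₂ t * (S i θ₂)⁻¹)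
          *ᵥ locDeriv (μ i) θ₁ s))) 0 := by
  refine HasDerivAt.fun_sum fun i _ => HasDerivAt.const_mul _ ?_
  have hC : ∀ a b, HasDerivAt (fun x : ℝ => S i (θ₂ + x • Pi.single t (1 : ℝ)) a b)
      (scaleDeriv (S i) θ₂ t a b) 0 := fun a b =>
    hasDerivAt_pderiv (h := fun τ => S i τ a b) (hSd i a b)
  have hI := hasDerivAt_inv (x := 0) (by simpa using (hS i).det_pos.ne') hC
  have := hasDerivAt_bilin (x := 0) (B := fun x : ℝ => (S i (θ₂ + x • Pi.single t (1 : ℝ)))⁻¹)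
    (B' := -((S i θ₂)⁻¹ * scaleDeriv (S i) θ₂ t * (S i θ₂)⁻¹)) (by simpa using hI)
    (v := fun _ => locDeriv (μ i) θ₁ r) (w := fun _ => locDeriv (μ i) θ₁ s) (v' := 0) (w' := 0)
    (fun a => hasDerivAt_const _ _) (fun a => hasDerivAt_const _ _)
  simpa [Matrix.neg_mulVec] using this

/-- With `A_r = Σ⁻¹ C_r`, the product rule gives `∂_t A_r = -A_t A_r + Σ⁻¹ ∂_t C_r`; everything else
is the product rule for traces. -/
theorem hasDerivAt_scaleInfo (hS : ∀ i, (S i θ₂).PosDef)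
    (hSd : ∀ i a b, DifferentiableAt ℝ (fun t => S i t a b) θ₂)
    (hSd2 : ∀ i a b, DifferentiableAt ℝ (fderiv ℝ fun t => S i t a b) θ₂) (r s t : Fin p₂) :
    HasDerivAt (fun x : ℝ => scaleInfo g S (θ₂ + x • Pi.single t (1 : ℝ)) r s)
      (∑ i, (cC (q i) (g i) / 2 *
        (((-((S i θ₂)⁻¹ * scaleDeriv (S i) θ₂ t) * ((S i θ₂)⁻¹ * scaleDeriv (S i) θ₂ r)
            + (S i θ₂)⁻¹ * scaleDeriv2 (S i) θ₂ r t) * ((S i θ₂)⁻¹ * scaleDeriv (S i) θ₂ s)).trace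
          + (((S i θ₂)⁻¹ * scaleDeriv (S i) θ₂ r) *
            (-((S i θ₂)⁻¹ * scaleDeriv (S i) θ₂ t) * ((S i θ₂)⁻¹ * scaleDeriv (S i) θ₂ s)
            + (S i θ₂)⁻¹ * scaleDeriv2 (S i) θ₂ s t)).trace)
        + (cC (q i) (g i) - 1) / 4 *
          ((-((S i θ₂)⁻¹ * scaleDeriv (S i) θ₂ t) * ((S i θ₂)⁻¹ * scaleDeriv (S i) θ₂ r)
            + (S i θ₂)⁻¹ * scaleDeriv2 (S i) θ₂ r t).trace * ((S i θ₂)⁻¹ * scaleDeriv (S i) θ₂ s).trace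
          + ((S i θ₂)⁻¹ * scaleDeriv (S i) θ₂ r).trace *
            (-((S i θ₂)⁻¹ * scaleDeriv (S i) θ₂ t) * ((S i θ₂)⁻¹ * scaleDeriv (S i) θ₂ s)
            + (S i θ₂)⁻¹ * scaleDeriv2 (S i) θ₂ s t).trace))) 0 := by
  refine HasDerivAt.fun_sum fun i _ => ?_
  have hC : ∀ a b, HasDerivAt (fun x : ℝ => S i (θ₂ + x • Pi.single t (1 : ℝ)) a b)
      (scaleDeriv (S i) θ₂ t a b) 0 := fun a b =>
    hasDerivAt_pderiv (h := fun τ => S i τ a b) (hSd i a b)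
  have hI := hasDerivAt_inv (x := 0) (by simpa using (hS i).det_pos.ne') hC
  simp only [zero_smul, add_zero] at hI
  have hC2 : ∀ r a b, HasDerivAt (fun x : ℝ => scaleDeriv (S i) (θ₂ + x • Pi.single t (1 : ℝ)) r a b)
      (scaleDeriv2 (S i) θ₂ r t a b) 0 := fun r a b =>
    hasDerivAt_pderiv (h := fun τ => scaleDeriv (S i) τ r a b) (differentiableAt_pderiv (hSd2 i a b) r)
  have hX : ∀ r a b, HasDerivAt (fun x : ℝ => ((S i (θ₂ + x • Pi.single t (1 : ℝ)))⁻¹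
        * scaleDeriv (S i) (θ₂ + x • Pi.single t (1 : ℝ)) r) a b)
      ((-((S i θ₂)⁻¹ * scaleDeriv (S i) θ₂ t) * ((S i θ₂)⁻¹ * scaleDeriv (S i) θ₂ r)
            + (S i θ₂)⁻¹ * scaleDeriv2 (S i) θ₂ r t) a b) 0 := by
    intro r a b
    have := hasDerivAt_matrix_mul (x := 0)
      (A' := -((S i θ₂)⁻¹ * scaleDeriv (S i) θ₂ t * (S i θ₂)⁻¹)) hI (hC2 r) a b
    simpa [Matrix.mul_assoc] using this
  have hT := fun r => hasDerivAt_trace (hX r)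
  have hXY := hasDerivAt_trace (hasDerivAt_matrix_mul (hX r) (hX s))
  have := (hXY.const_mul (cC (q i) (g i) / 2)).fun_add
    (((hT r).fun_mul (hT s)).const_mul ((cC (q i) (g i) - 1) / 4))
  simpa only [zero_smul, add_zero, Matrix.trace_add] using this

end InfoDerivatives

/-! ### Validity of the explicit scores near the parameter point. -/

section Neighbourhood

variable {n p₁ p₂ : ℕ} {q : Fin n → ℕ} {g : Fin n → ℝ → ℝ}
  {μ : ∀ i, (Fin p₁ → ℝ) → Fin (q i) → ℝ}
  {S : ∀ i, (Fin p₂ → ℝ) → Matrix (Fin (q i)) (Fin (q i)) ℝ}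
  {θ : Fin p₁ ⊕ Fin p₂ → ℝ} {Θ₁ : Set (Fin p₁ → ℝ)} {Θ₂ : Set (Fin p₂ → ℝ)}

/-- A whole neighbourhood is needed because the Fisher information will be differentiated. The
excluded null set `{y_i = μ_i(τ)}` moves with `τ`, which is harmless since each expectation involves
a single `τ`. -/
theorem exists_nhds_hasExplicitScore (hq : ∀ i, 0 < q i) (hg : ∀ i, IsGenerator (q i) (g i))
    (hΘ₁ : IsOpen Θ₁) (hΘ₂ : IsOpen Θ₂)
    (hμ : ∀ i a, TwiceDifferentiableOn (fun t => μ i t a) Θ₁)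
    (hS : ∀ i a b, TwiceDifferentiableOn (fun t => S i t a b) Θ₂)
    (hSpos : ∀ i, ∀ t ∈ Θ₂, (S i t).PosDef) (hθ₁ : θ ∘ Sum.inl ∈ Θ₁) (hθ₂ : θ ∘ Sum.inr ∈ Θ₂)
    (hreg : IsRegularAt (modelDensity g μ S) (modelLogLik g μ S) θ) :
    ∃ N : Set (Fin p₁ ⊕ Fin p₂ → ℝ), IsOpen N ∧ θ ∈ N ∧ ∀ τ ∈ N, HasExplicitScore g μ S τ := by
  obtain ⟨N₀, hN₀, hθN₀, G, -, hae⟩ := hreg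
  have hc1 : Continuous fun τ : Fin p₁ ⊕ Fin p₂ → ℝ => τ ∘ Sum.inl :=
    continuous_pi fun i => continuous_apply _
  have hc2 : Continuous fun τ : Fin p₁ ⊕ Fin p₂ → ℝ => τ ∘ Sum.inr :=
    continuous_pi fun i => continuous_apply _
  refine ⟨N₀ ∩ ((fun τ => τ ∘ Sum.inl) ⁻¹' Θ₁ ∩ (fun τ => τ ∘ Sum.inr) ⁻¹' Θ₂),
    hN₀.inter ((hΘ₁.preimage hc1).inter (hΘ₂.preimage hc2)), ⟨hθN₀, hθ₁, hθ₂⟩, ?_⟩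
  rintro τ ⟨hτ0, hτ1, hτ2⟩
  have hp : ∀ i, (S i (τ ∘ Sum.inr)).PosDef := fun i => hSpos i _ hτ2
  have hd : ∀ᵐ y, DifferentiableAt ℝ (fun t => modelLogLik g μ S t y) τ := by
    filter_upwards [hae] with y hy
    exact (hy.1.differentiableOn (by norm_num)).differentiableAt (hN₀.mem_nhds hτ0)
  refine ⟨hp, fun i s => scaleDeriv_isSymm hΘ₂ (hSpos i) hτ2 s, ?_, ?_⟩
  · filter_upwards [hd, ae_forall_ne hq fun i => μ i (τ ∘ Sum.inl)] with y h1 h2 r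
    exact score_inl hg hp (fun i a => (hμ i a).1.differentiableAt (hΘ₁.mem_nhds hτ1)) h2 h1 r
  · filter_upwards [hd, ae_forall_ne hq fun i => μ i (τ ∘ Sum.inl)] with y h1 h2 s
    exact score_inr hg hp (fun i a b => (hS i a b).1.differentiableAt (hΘ₂.mem_nhds hτ2)) h2 h1 s

end Neighbourhood

/-! ### Vectorized matrix identities for one observation -/

section VecIdentities

theorem dotProduct_mulVec_mulVec_eq_sum {k l m : Type*} [Fintype k] [Fintype l] [Fintype m]
    (v : m → ℝ) (H : Matrix m k ℝ) (A : Matrix k l ℝ) (w : l → ℝ) :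
    v ⬝ᵥ (H *ᵥ (A *ᵥ w)) = ∑ p, w p * (v ⬝ᵥ (H *ᵥ fun a => A a p)) := by
  rw [Matrix.dotProduct_mulVec, Matrix.dotProduct_mulVec, dotProduct]
  refine Finset.sum_congr rfl fun p _ => ?_
  rw [mul_comm, Matrix.dotProduct_mulVec]
  rfl

theorem outer_mulVec {k l : Type*} [Fintype l] (v : k → ℝ) (w x : l → ℝ) :
    outer v w *ᵥ x = (w ⬝ᵥ x) • v := by
  ext a
  simp [outer, Matrix.vecMulVec_mulVec, mul_comm]

variable {q p : ℕ} {g : ℝ → ℝ} {S : Matrix (Fin q) (Fin q) ℝ}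

theorem inv_two_smul_kronecker (hS : S.PosDef) :
    ((2 : ℝ) • (S ⊗ₖ S))⁻¹ = (1 / 2 : ℝ) • (S⁻¹ ⊗ₖ S⁻¹) := by
  have hu : IsUnit (S ⊗ₖ S).det := by
    rw [Matrix.det_kronecker]
    exact ((isUnit_det_of_posDef hS).pow _).mul ((isUnit_det_of_posDef hS).pow _)
  refine Matrix.inv_eq_left_inv ?_
  rw [← Matrix.inv_kronecker, Matrix.smul_mul, Matrix.mul_smul, Matrix.nonsing_inv_mul _ hu,
    smul_smul]
  norm_num

theorem kronecker_inv_mulVec_vec (hS : S.PosDef) (X : Matrix (Fin q) (Fin q) ℝ) :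
    (S⁻¹ ⊗ₖ S⁻¹) *ᵥ X.vec = (S⁻¹ * X * S⁻¹).vec := by
  rw [Matrix.kronecker_mulVec_vec, (isSymm_of_posDef hS.inv).eq]

theorem vec_inv_dotProduct_vec (hS : S.PosDef) (X : Matrix (Fin q) (Fin q) ℝ) :
    (S⁻¹).vec ⬝ᵥ X.vec = (S⁻¹ * X).trace := by
  rw [Matrix.vec_dotProduct_vec, (isSymm_of_posDef hS.inv).eq]

theorem Ht2_mulVec_vec (hS : S.PosDef) (X : Matrix (Fin q) (Fin q) ℝ) :
    Ht2 g S *ᵥ X.vec = ((cC q g / 2) • (S⁻¹ * X * S⁻¹)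
      + ((cC q g - 1) / 4 * (S⁻¹ * X).trace) • S⁻¹).vec := by
  rw [Ht2, inv_two_smul_kronecker hS, Matrix.add_mulVec, Matrix.smul_mulVec, Matrix.smul_mulVec,
    Matrix.smul_mulVec, kronecker_inv_mulVec_vec hS, outer_mulVec, vec_inv_dotProduct_vec hS,
    Matrix.vec_add, Matrix.vec_smul, Matrix.vec_smul, smul_smul, smul_smul]
  congr 2
  ring

theorem vec_dotProduct_vec_sandwich {C : Matrix (Fin q) (Fin q) ℝ} (hC : C.IsSymm)
    (X : Matrix (Fin q) (Fin q) ℝ) :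
    C.vec ⬝ᵥ (S⁻¹ * X * S⁻¹).vec = (S⁻¹ * C * (S⁻¹ * X)).trace := by
  rw [Matrix.vec_dotProduct_vec, hC.eq, ← Matrix.mul_assoc, Matrix.trace_mul_comm]
  simp only [Matrix.mul_assoc]

theorem vec_dotProduct_Ht2_mulVec_vec (hS : S.PosDef) {C : Matrix (Fin q) (Fin q) ℝ}
    (hC : C.IsSymm) (X : Matrix (Fin q) (Fin q) ℝ) :
    C.vec ⬝ᵥ (Ht2 g S *ᵥ X.vec) = cC q g / 2 * (S⁻¹ * C * (S⁻¹ * X)).trace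
      + (cC q g - 1) / 4 * ((S⁻¹ * C).trace * (S⁻¹ * X).trace) := by
  rw [Ht2_mulVec_vec hS, Matrix.vec_add, Matrix.vec_smul, Matrix.vec_smul, dotProduct_add,
    dotProduct_smul, dotProduct_smul, vec_dotProduct_vec_sandwich hC, dotProduct_comm C.vec,
    vec_inv_dotProduct_vec hS, smul_eq_mul, smul_eq_mul]
  ring

/-- `H̃₂` is a rank-one perturbation of `c (2 Σ ⊗ Σ)⁻¹`, and `M*` undoes both the factor `c` and the
perturbation, as in the Sherman–Morrison formula: `H̃₂ M* = (2 Σ ⊗ Σ)⁻¹`. -/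
theorem Ht2_mulVec_Mstar_mulVec (hq : 0 < q) (hg : IsGenerator q g) (hS : S.PosDef)
    (X : Matrix (Fin q) (Fin q) ℝ) :
    Ht2 g S *ᵥ (Mstar g S *ᵥ X.vec) = ((1 / 2 : ℝ) • (S⁻¹ * X * S⁻¹)).vec := by
  have hc := (hg.cC_pos hq).ne'
  have hd := (hg.two_cC_add_pos hq).ne'
  have hu := isUnit_det_of_posDef hS
  have h1 : Mstar g S *ᵥ X.vec = ((1 / cC q g) • (X - ((cC q g - 1) /
      (2 * cC q g + (cC q g - 1) * q) * (S⁻¹ * X).trace) • S)).vec := by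
    rw [Mstar, Matrix.smul_mulVec, Matrix.sub_mulVec, Matrix.one_mulVec, Matrix.smul_mulVec,
      outer_mulVec, vec_inv_dotProduct_vec hS, smul_smul, Matrix.vec_smul, Matrix.vec_sub,
      Matrix.vec_smul]
  rw [h1, Ht2_mulVec_vec hS]
  congr 1
  have hk : (cC q g - 1) / (2 * cC q g + (cC q g - 1) * q) * (2 * cC q g + (cC q g - 1) * q)
      = cC q g - 1 := div_mul_cancel₀ _ hd
  have hc1 : 1 / cC q g * cC q g = 1 := div_mul_cancel₀ _ hc
  generalize (cC q g - 1) / (2 * cC q g + (cC q g - 1) * q) = k at hk ⊢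
  generalize 1 / cC q g = e at hc1 ⊢
  simp only [Matrix.mul_smul, Matrix.smul_mul, Matrix.mul_sub, Matrix.sub_mul, Matrix.trace_smul,
    Matrix.trace_sub, Matrix.nonsing_inv_mul _ hu, Matrix.one_mul, smul_eq_mul, Matrix.trace_one,
    Fintype.card_fin]
  ext a b
  simp only [Matrix.add_apply, Matrix.smul_apply, Matrix.sub_apply, smul_eq_mul]
  -- `hc1` settles the coefficient of `Σ⁻¹ X Σ⁻¹`; by `hk` the coefficient of `Σ⁻¹` is zero.
  linear_combination (1 / 2 * (S⁻¹ * X * S⁻¹) a b) * hc1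
    - (1 / 4 * e * (S⁻¹ * X).trace * S⁻¹ a b) * hk

theorem idKronCol_mulVec (a w : Fin q → ℝ) :
    idKronCol a *ᵥ w = (Matrix.vecMulVec a w).vec := by
  ext ⟨j, i⟩
  simp [idKronCol, Matrix.mulVec, dotProduct, Matrix.vec, Matrix.vecMulVec_apply,
    Matrix.one_apply, mul_comm]

/-- Columns of `P*` are vectorized matrices, so the identity for `H̃₂ M*` applies to them one at a
time. -/
theorem Pstar_col (m : (Fin p → ℝ) → Fin q → ℝ) (θ : Fin p → ℝ) (a : Fin q → ℝ) (t : Fin p) :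
    (fun k => Pstar g S a (locJac m θ) k t)
      = ((2 * eta2 q g) • Matrix.vecMulVec a (locDeriv m θ t)
        + (eta1 q g * (a ⬝ᵥ (S⁻¹ *ᵥ locDeriv m θ t))) • S).vec := by
  change ((2 * eta2 q g) • idKronCol a + eta1 q g • (outer S.vec a * S⁻¹)) *ᵥ locDeriv m θ t = _
  rw [Matrix.add_mulVec, Matrix.smul_mulVec, Matrix.smul_mulVec, ← Matrix.mulVec_mulVec,
    outer_mulVec, idKronCol_mulVec, Matrix.vec_add, Matrix.vec_smul, Matrix.vec_smul, smul_smul]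

theorem vec_dotProduct_Pstar (hq : 0 < q) (hg : IsGenerator q g) (hS : S.PosDef)
    {C : Matrix (Fin q) (Fin q) ℝ} (hC : C.IsSymm) (m : (Fin p → ℝ) → Fin q → ℝ)
    (θ : Fin p → ℝ) (s t : Fin p) :
    C.vec ⬝ᵥ (Ht2 g S *ᵥ (Mstar g S *ᵥ fun k => Pstar g S (locDeriv m θ s) (locJac m θ) k t))
      = eta2 q g * (locDeriv m θ s ⬝ᵥ ((S⁻¹ * C * S⁻¹) *ᵥ locDeriv m θ t))
        + 1 / 2 * eta1 q g * (locDeriv m θ s ⬝ᵥ (S⁻¹ *ᵥ locDeriv m θ t)) * (S⁻¹ * C).trace := by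
  rw [Pstar_col, Ht2_mulVec_Mstar_mulVec hq hg hS, Matrix.vec_smul, dotProduct_smul,
    vec_dotProduct_vec_sandwich hC, Matrix.mul_add, Matrix.mul_add, Matrix.mul_smul,
    Matrix.mul_smul, Matrix.mul_smul, Matrix.mul_smul,
    Matrix.nonsing_inv_mul _ (isUnit_det_of_posDef hS), Matrix.mul_one, Matrix.trace_add,
    Matrix.trace_smul, Matrix.trace_smul, Matrix.mul_vecMulVec, Matrix.mul_vecMulVec,
    Matrix.trace_vecMulVec, smul_eq_mul, smul_eq_mul, smul_eq_mul, Matrix.mulVec_mulVec,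
    dotProduct_comm ((S⁻¹ * C * S⁻¹) *ᵥ _), Matrix.dotProduct_mulVec, ← Matrix.mulVec_transpose,
    (isSymm_sandwich hS hC).eq, dotProduct_comm _ (locDeriv m θ s)]
  ring

theorem S1_mulVec_vec {C : Matrix (Fin q) (Fin q) ℝ} (Z : Matrix (Fin q) (Fin q) ℝ) :
    S1 S C *ᵥ Z.vec
      = (((Cᵀ * Z).trace + 1 / 2 * (C * S⁻¹).trace * (Sᵀ * Z).trace) • S).vec := by
  rw [S1, Matrix.add_mulVec, Matrix.smul_mulVec, outer_mulVec, outer_mulVec,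
    Matrix.vec_dotProduct_vec, Matrix.vec_dotProduct_vec, smul_smul, ← add_smul, Matrix.vec_smul]

theorem S2_mulVec_vec {C : Matrix (Fin q) (Fin q) ℝ} (Z : Matrix (Fin q) (Fin q) ℝ) :
    S2 S C *ᵥ Z.vec
      = ((Sᵀ * Z).trace • C + (Cᵀ * Z).trace • S + (4 : ℝ) • (C * Z * Sᵀ)
        + (C * S⁻¹).trace • (S * Z * Sᵀ + (1 / 2 * (Sᵀ * Z).trace) • S)).vec := by
  simp only [S2, Matrix.add_mulVec, Matrix.smul_mulVec, outer_mulVec, Matrix.vec_dotProduct_vec,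
    Matrix.kronecker_mulVec_vec, Matrix.vec_smul, Matrix.vec_add, smul_smul]

theorem scaleJac_col (T : (Fin p → ℝ) → Matrix (Fin q) (Fin q) ℝ) (θ : Fin p → ℝ) (t : Fin p) :
    (fun k => scaleJac T θ k t) = (scaleDeriv T θ t).vec := rfl

theorem vec_dotProduct_Qstar (hq : 0 < q) (hg : IsGenerator q g) (hS : S.PosDef)
    {C : Matrix (Fin q) (Fin q) ℝ} (hC : C.IsSymm) {D : Matrix (Fin q) (Fin q) ℝ} (hD : D.IsSymm)
    (T : (Fin p → ℝ) → Matrix (Fin q) (Fin q) ℝ) (θ : Fin p → ℝ) (t : Fin p) :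
    C.vec ⬝ᵥ (Ht2 g S *ᵥ (Mstar g S *ᵥ fun k => Qstar g S D (scaleJac T θ) k t))
      = 1 / 2 * ((cC q g - 1) * ((S⁻¹ * D * (S⁻¹ * scaleDeriv T θ t)).trace * (S⁻¹ * C).trace
          + 1 / 2 * ((S⁻¹ * D).trace * (S⁻¹ * scaleDeriv T θ t).trace * (S⁻¹ * C).trace))
        + 1 / 2 * (cC q g + 8 * omegaT q g) *
          ((S⁻¹ * scaleDeriv T θ t).trace * (S⁻¹ * C * (S⁻¹ * D)).trace
          + (S⁻¹ * C).trace * (S⁻¹ * D * (S⁻¹ * scaleDeriv T θ t)).trace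
          + 4 * (S⁻¹ * C * (S⁻¹ * D) * (S⁻¹ * scaleDeriv T θ t)).trace
          + (S⁻¹ * D).trace * (S⁻¹ * C * (S⁻¹ * scaleDeriv T θ t)).trace
          + 1 / 2 * ((S⁻¹ * D).trace * (S⁻¹ * scaleDeriv T θ t).trace * (S⁻¹ * C).trace))) := by
  set E := scaleDeriv T θ t with hE
  have hu := isUnit_det_of_posDef hS
  have hcol : (fun k => Qstar g S D (scaleJac T θ) k t)
      = ((cC q g - 1) • S1 S D + (1 / 2 * (cC q g + 8 * omegaT q g)) • S2 S D)
        *ᵥ (S⁻¹ * E * S⁻¹).vec := by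
    rw [← kronecker_inv_mulVec_vec hS, hE, ← scaleJac_col, Matrix.mulVec_mulVec]
    rfl
  have h1 : (S * (S⁻¹ * E * S⁻¹)).trace = (S⁻¹ * E).trace := by
    rw [← Matrix.mul_assoc, ← Matrix.mul_assoc, Matrix.mul_nonsing_inv _ hu, Matrix.one_mul,
      Matrix.trace_mul_comm]
  have h2 : (D * (S⁻¹ * E * S⁻¹)).trace = (S⁻¹ * D * (S⁻¹ * E)).trace := by
    rw [← Matrix.mul_assoc, Matrix.trace_mul_comm, ← Matrix.mul_assoc, Matrix.mul_assoc]
  have h3 : S * (S⁻¹ * E * S⁻¹) * S = E := by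
    rw [← Matrix.mul_assoc, ← Matrix.mul_assoc, Matrix.mul_nonsing_inv _ hu, Matrix.one_mul,
      Matrix.mul_assoc, Matrix.nonsing_inv_mul _ hu, Matrix.mul_one]
  have h4 : D * (S⁻¹ * E * S⁻¹) * S = D * (S⁻¹ * E) := by
    rw [Matrix.mul_assoc, sandwich_mul hS]
  have h5 : (D * S⁻¹).trace = (S⁻¹ * D).trace := Matrix.trace_mul_comm _ _
  have hq2 : (S⁻¹ * S) = 1 := Matrix.nonsing_inv_mul _ hu
  rw [hcol, Matrix.add_mulVec, Matrix.smul_mulVec, Matrix.smul_mulVec, S1_mulVec_vec,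
    S2_mulVec_vec, ← Matrix.vec_smul, ← Matrix.vec_smul, ← Matrix.vec_add,
    Ht2_mulVec_Mstar_mulVec hq hg hS, Matrix.vec_smul, dotProduct_smul,
    vec_dotProduct_vec_sandwich hC, hD.eq, (isSymm_of_posDef hS).eq, h1, h2, h3, h4, h5]
  simp only [Matrix.mul_add, Matrix.mul_smul, hq2, Matrix.mul_one, Matrix.trace_add,
    Matrix.trace_smul, smul_eq_mul, ← Matrix.mul_assoc]
  ring

end VecIdentities

/-! ### Quantities of the whole sample as sums over observations -/

section SampleSums

theorem blockDiagonal'_mulVec {o : Type*} [Fintype o] [DecidableEq o] {m : o → Type*}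
    [∀ i, Fintype (m i)] (M : ∀ i, Matrix (m i) (m i) ℝ) (w : (Σ i, m i) → ℝ) (i : o) (a : m i) :
    (Matrix.blockDiagonal' M *ᵥ w) ⟨i, a⟩ = (M i *ᵥ fun b => w ⟨i, b⟩) a := by
  simp only [Matrix.mulVec, dotProduct, Fintype.sum_sigma]
  rw [Finset.sum_eq_single i]
  · simp
  · intro j _ hj
    exact Finset.sum_eq_zero fun b _ => by
      rw [Matrix.blockDiagonal'_apply_ne _ _ _ hj.symm, zero_mul]
  · simp

theorem dotProduct_blockDiagonal'_mulVec {o : Type*} [Fintype o] [DecidableEq o] {m : o → Type*}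
    [∀ i, Fintype (m i)] (M : ∀ i, Matrix (m i) (m i) ℝ) (v w : (Σ i, m i) → ℝ) :
    v ⬝ᵥ (Matrix.blockDiagonal' M *ᵥ w)
      = ∑ i, (fun a => v ⟨i, a⟩) ⬝ᵥ (M i *ᵥ fun a => w ⟨i, a⟩) := by
  simp only [dotProduct, Fintype.sum_sigma, blockDiagonal'_mulVec]

theorem isUnit_det_of_dotProduct_pos {k : Type*} [Fintype k] [DecidableEq k] {A : Matrix k k ℝ}
    (hA : ∀ v, v ≠ 0 → 0 < v ⬝ᵥ (A *ᵥ v)) : IsUnit A.det := by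
  rw [← Matrix.isUnit_iff_isUnit_det, ← Matrix.mulVec_injective_iff_isUnit,
    ← Matrix.coe_mulVecLin, injective_iff_map_eq_zero]
  intro v hv
  by_contra h
  have h1 := hA v h
  rw [Matrix.mulVecLin_apply] at hv
  rw [hv, dotProduct_zero] at h1
  exact h1.false

theorem isUnit_det_transpose_mul_blockDiagonal' {o k : Type*} [Fintype o] [DecidableEq o]
    [Fintype k] [DecidableEq k] {m : o → Type*} [∀ i, Fintype (m i)]
    {M : ∀ i, Matrix (m i) (m i) ℝ} (hM : ∀ i v, v ≠ 0 → 0 < v ⬝ᵥ (M i *ᵥ v))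
    {F : Matrix (Σ i, m i) k ℝ} (hF : ∀ v, F *ᵥ v = 0 → v = 0) :
    IsUnit (Fᵀ * Matrix.blockDiagonal' M * F).det := by
  refine isUnit_det_of_dotProduct_pos fun v hv => ?_
  rw [← Matrix.mulVec_mulVec, ← Matrix.mulVec_mulVec, Matrix.dotProduct_mulVec,
    Matrix.vecMul_transpose, dotProduct_blockDiagonal'_mulVec]
  have hnn : ∀ i (w : m i → ℝ), 0 ≤ w ⬝ᵥ (M i *ᵥ w) := fun i w => by
    by_cases h : w = 0
    · simp [h]
    · exact (hM i w h).le
  have hne : F *ᵥ v ≠ 0 := fun h => hv (hF v h)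
  obtain ⟨⟨i, a⟩, hia⟩ := Function.ne_iff.1 hne
  refine Finset.sum_pos' (fun i _ => hnn i _) ⟨i, Finset.mem_univ i, hM i _ fun h => hia ?_⟩
  exact congrFun h a

theorem eq_zero_of_rank_eq_card {k l : Type*} [Fintype k] [Fintype l]
    {F : Matrix k l ℝ} (hF : F.rank = Fintype.card l) (v : l → ℝ) (hv : F *ᵥ v = 0) : v = 0 := by
  have h1 := LinearMap.finrank_range_add_finrank_ker F.mulVecLin
  rw [Module.finrank_fintype_fun_eq_card] at h1
  change F.rank + _ = _ at h1
  have h2 : Module.finrank ℝ (LinearMap.ker F.mulVecLin) = 0 := by omega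
  have h3 := Submodule.finrank_eq_zero.1 h2
  have h4 : v ∈ LinearMap.ker F.mulVecLin := by
    rw [LinearMap.mem_ker, Matrix.mulVecLin_apply, hv]
  rw [h3] at h4
  exact (Submodule.mem_bot ℝ).1 h4

/-- The indices are swapped because `Matrix.vec` is indexed by (column, row). -/
theorem sum_vec_mul {k : Type*} [Fintype k] (M : Matrix k k ℝ) (f : k × k → ℝ) :
    ∑ p, M.vec p * f p = ∑ s, ∑ t, M s t * f (t, s) := by
  rw [Fintype.sum_prod_type, Finset.sum_comm]
  rfl

/-- A symmetric matrix sees only the symmetric part of what it is contracted with. The bias summands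
and those of the stated formula are shown to agree only in this sense. -/
theorem sum_mul_congr_of_isSymm {k : Type*} [Fintype k] {M : Matrix k k ℝ} (hM : M.IsSymm)
    {f f' : k → k → ℝ} (h : ∀ s t, f s t + f t s = f' s t + f' t s) :
    ∑ s, ∑ t, M s t * f s t = ∑ s, ∑ t, M s t * f' s t := by
  have key : ∀ e : k → k → ℝ, ∑ s, ∑ t, M s t * e s t
      = ∑ s, ∑ t, M s t * (1 / 2 * (e s t + e t s)) := by
    intro e
    have h1 : ∑ s, ∑ t, M s t * e s t = ∑ s, ∑ t, M s t * e t s := by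
      rw [Finset.sum_comm]
      exact Finset.sum_congr rfl fun s _ => Finset.sum_congr rfl fun t _ => by rw [hM.apply]
    have h2 : ∑ s, ∑ t, M s t * (1 / 2 * (e s t + e t s))
        = 1 / 2 * (∑ s, ∑ t, M s t * e s t) + 1 / 2 * ∑ s, ∑ t, M s t * e t s := by
      simp only [Finset.mul_sum, ← Finset.sum_add_distrib]
      exact Finset.sum_congr rfl fun s _ => Finset.sum_congr rfl fun t _ => by ring
    rw [h2, ← h1]
    ring
  rw [key f, key f']
  simp only [h]

/-- With `Σ = R Rᵀ` and `X = R Y Rᵀ` the form becomes `c/2 · tr(Yᵀ Y) + (c - 1)/4 · (tr Y)²`. By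
Cauchy–Schwarz `(tr Y)² ≤ q tr(Yᵀ Y)`. No symmetry of `X` is required. -/
theorem dotProduct_Ht2_mulVec_pos {q : ℕ} {g : ℝ → ℝ} (hq : 0 < q) (hg : IsGenerator q g)
    {S : Matrix (Fin q) (Fin q) ℝ} (hS : S.PosDef) (v : Fin q × Fin q → ℝ) (hv : v ≠ 0) :
    0 < v ⬝ᵥ (Ht2 g S *ᵥ v) := by
  obtain ⟨X, rfl⟩ := Matrix.vec_bijective.2 v
  obtain ⟨R, rfl⟩ := exists_mul_transpose_eq hS
  have hR : IsUnit R.det := (det_ne_zero_of_mul_transpose rfl hS).isUnit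
  have hRt : IsUnit Rᵀ.det := by rwa [Matrix.det_transpose]
  obtain ⟨Y, rfl⟩ : ∃ Y, X = R * Y * Rᵀ := ⟨R⁻¹ * X * (Rᵀ)⁻¹, by
    rw [← Matrix.mul_assoc, ← Matrix.mul_assoc, Matrix.mul_nonsing_inv _ hR, Matrix.one_mul,
      Matrix.mul_assoc, Matrix.nonsing_inv_mul _ hRt, Matrix.mul_one]⟩
  have hY : Y ≠ 0 := by
    rintro rfl
    simp at hv
  have h1 : ((R * Rᵀ)⁻¹ * (R * Y * Rᵀ)) = (Rᵀ)⁻¹ * Y * Rᵀ := by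
    rw [Matrix.mul_inv_rev, Matrix.mul_assoc, Matrix.mul_assoc, ← Matrix.mul_assoc R⁻¹,
      Matrix.nonsing_inv_mul _ hR, Matrix.one_mul, Matrix.mul_assoc]
  have h2 : ((Rᵀ)⁻¹ * Y * Rᵀ).trace = Y.trace := by
    rw [Matrix.trace_mul_comm, ← Matrix.mul_assoc, Matrix.mul_nonsing_inv _ hRt, Matrix.one_mul]
  have h3 : ((R * Y * Rᵀ)ᵀ * ((Rᵀ)⁻¹ * Y * Rᵀ * (R * Rᵀ)⁻¹)).trace = (Yᵀ * Y).trace := by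
    have e1 : (Rᵀ)⁻¹ * Y * Rᵀ * (R * Rᵀ)⁻¹ = (Rᵀ)⁻¹ * Y * R⁻¹ := by
      rw [Matrix.mul_inv_rev, Matrix.mul_assoc _ Rᵀ, ← Matrix.mul_assoc Rᵀ,
        Matrix.mul_nonsing_inv _ hRt, Matrix.one_mul]
    rw [e1, Matrix.transpose_mul, Matrix.transpose_mul, Matrix.transpose_transpose,
      ← Matrix.mul_assoc, Matrix.trace_mul_comm, ← Matrix.mul_assoc, ← Matrix.mul_assoc,
      ← Matrix.mul_assoc, Matrix.nonsing_inv_mul _ hR, Matrix.one_mul,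
      Matrix.mul_assoc Yᵀ, Matrix.mul_nonsing_inv _ hRt, Matrix.mul_one]
  have h4 : 0 < (Yᵀ * Y).trace := by
    rw [← Matrix.vec_dotProduct_vec]
    have hY' : Y.vec ≠ 0 := by rwa [ne_eq, Matrix.vec_eq_zero_iff]
    exact lt_of_le_of_ne (Finset.sum_nonneg fun _ _ => mul_self_nonneg _)
      fun h => hY' (dotProduct_self_eq_zero.1 h.symm)
  have h5 : Y.trace ^ 2 ≤ q * (Yᵀ * Y).trace := by
    have e1 : Y.trace ^ 2 ≤ q * ∑ i, Y i i ^ 2 := by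
      have := sq_sum_le_card_mul_sum_sq (s := Finset.univ) (f := fun i => Y i i)
      simpa [Matrix.trace] using this
    refine e1.trans (mul_le_mul_of_nonneg_left ?_ (Nat.cast_nonneg q))
    rw [Matrix.trace]
    refine Finset.sum_le_sum fun i _ => ?_
    rw [Matrix.diag_apply, Matrix.mul_apply]
    refine le_trans (le_of_eq ?_) (Finset.single_le_sum (f := fun j => Yᵀ i j * Y j i)
      (fun j _ => mul_self_nonneg (Y j i)) (Finset.mem_univ i))
    simp [sq]
  rw [Ht2_mulVec_vec hS, Matrix.vec_add, Matrix.vec_smul, Matrix.vec_smul, dotProduct_add,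
    dotProduct_smul, dotProduct_smul, dotProduct_comm _ ((R * Rᵀ)⁻¹).vec,
    vec_inv_dotProduct_vec hS, h1, h2, Matrix.vec_dotProduct_vec, h3, smul_eq_mul, smul_eq_mul]
  have hc := hg.cC_pos hq
  have hd := hg.two_cC_add_pos hq
  -- For `c ≥ 1` both terms are nonnegative. For `c < 1` the form is at least `(2c + (c - 1) q)/4 ·
  -- tr(Yᵀ Y)`.
  rcases le_or_gt 1 (cC q g) with h | h
  · have : 0 ≤ (cC q g - 1) * Y.trace ^ 2 := mul_nonneg (by linarith) (sq_nonneg _)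
    nlinarith [mul_pos hc h4]
  · have := mul_le_mul_of_nonneg_left h5 (show 0 ≤ 1 - cC q g by linarith)
    nlinarith [mul_pos hd h4]

theorem dotProduct_Ht1_mulVec_pos {q : ℕ} {g : ℝ → ℝ} (hq : 0 < q) (hg : IsGenerator q g)
    {S : Matrix (Fin q) (Fin q) ℝ} (hS : S.PosDef) (v : Fin q → ℝ) (hv : v ≠ 0) :
    0 < v ⬝ᵥ (Ht1 g S *ᵥ v) := by
  rw [Ht1, Matrix.smul_mulVec, dotProduct_smul, smul_eq_mul]
  have hq' : (0 : ℝ) < q := Nat.cast_pos.2 hq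
  have h1 := hg.psi_two_one_pos hq
  have h2 : 0 < v ⬝ᵥ (S⁻¹ *ᵥ v) := hS.inv.dotProduct_mulVec_pos hv
  positivity

variable {n p₁ p₂ : ℕ} {q : Fin n → ℕ} {g : Fin n → ℝ → ℝ}
  {μ : ∀ i, (Fin p₁ → ℝ) → Fin (q i) → ℝ}
  {S : ∀ i, (Fin p₂ → ℝ) → Matrix (Fin (q i)) (Fin (q i)) ℝ}
  {θ₁ : Fin p₁ → ℝ} {θ₂ : Fin p₂ → ℝ}

theorem transpose_F1_mulVec_H1 (w : (Σ i, Fin (q i)) → ℝ) (r : Fin p₁) :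
    ((F1 μ θ₁)ᵀ *ᵥ (H1 g S θ₂ *ᵥ w)) r
      = ∑ i, locDeriv (μ i) θ₁ r ⬝ᵥ (Ht1 (g i) (S i θ₂) *ᵥ fun a => w ⟨i, a⟩) :=
  dotProduct_blockDiagonal'_mulVec (fun i => Ht1 (g i) (S i θ₂)) (fun k => F1 μ θ₁ k r) w

theorem transpose_F2_mulVec_H2 (w : (Σ i, Fin (q i) × Fin (q i)) → ℝ) (r : Fin p₂) :
    ((F2 S θ₂)ᵀ *ᵥ (H2 g S θ₂ *ᵥ w)) r
      = ∑ i, (scaleDeriv (S i) θ₂ r).vec ⬝ᵥ (Ht2 (g i) (S i θ₂) *ᵥ fun a => w ⟨i, a⟩) :=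
  dotProduct_blockDiagonal'_mulVec (fun i => Ht2 (g i) (S i θ₂)) (fun k => F2 S θ₂ k r) w

theorem transpose_mul_mul_apply {k l : Type*} [Fintype k] (F : Matrix k l ℝ) (H : Matrix k k ℝ)
    (r s : l) : (Fᵀ * H * F) r s = (Fᵀ *ᵥ (H *ᵥ fun a => F a s)) r := by
  rw [Matrix.mulVec_mulVec]
  rfl

theorem K1_apply (r s : Fin p₁) : K1 g μ S θ₁ θ₂ r s = locInfo g μ S θ₁ θ₂ r s := by
  rw [K1, transpose_mul_mul_apply, transpose_F1_mulVec_H1, locInfo]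
  refine Finset.sum_congr rfl fun i _ => ?_
  have e : (fun a => F1 μ θ₁ ⟨i, a⟩ s) = locDeriv (μ i) θ₁ s := rfl
  rw [e, Ht1, Matrix.smul_mulVec, dotProduct_smul, smul_eq_mul]

theorem K2_apply (hS : ∀ i, (S i θ₂).PosDef) (hC : ∀ i s, (scaleDeriv (S i) θ₂ s).IsSymm)
    (r s : Fin p₂) : K2 g S θ₂ r s = scaleInfo g S θ₂ r s := by
  rw [K2, transpose_mul_mul_apply, transpose_F2_mulVec_H2, scaleInfo]
  refine Finset.sum_congr rfl fun i _ => ?_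
  have e : (fun a => F2 S θ₂ ⟨i, a⟩ s) = (scaleDeriv (S i) θ₂ s).vec := rfl
  rw [e, vec_dotProduct_Ht2_mulVec_vec (hS i) (hC i r)]

theorem isUnit_det_K1 (hq : ∀ i, 0 < q i) (hg : ∀ i, IsGenerator (q i) (g i))
    (hS : ∀ i, (S i θ₂).PosDef)
    (hrank : (Matrix.fromBlocks (F1 μ θ₁) 0 0 (F2 S θ₂)).rank = p₁ + p₂) :
    IsUnit (K1 g μ S θ₁ θ₂).det := by
  refine isUnit_det_transpose_mul_blockDiagonal'
    (fun i => dotProduct_Ht1_mulVec_pos (hq i) (hg i) (hS i)) fun v hv => ?_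
  have h := eq_zero_of_rank_eq_card (F := Matrix.fromBlocks (F1 μ θ₁) 0 0 (F2 S θ₂))
    (by simpa using hrank) (Sum.elim v 0) (by
      rw [Matrix.fromBlocks_mulVec]
      simp [hv])
  exact funext fun r => congrFun h (Sum.inl r)

theorem isUnit_det_K2 (hq : ∀ i, 0 < q i) (hg : ∀ i, IsGenerator (q i) (g i))
    (hS : ∀ i, (S i θ₂).PosDef)
    (hrank : (Matrix.fromBlocks (F1 μ θ₁) 0 0 (F2 S θ₂)).rank = p₁ + p₂) :
    IsUnit (K2 g S θ₂).det := by
  refine isUnit_det_transpose_mul_blockDiagonal'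
    (fun i => dotProduct_Ht2_mulVec_pos (hq i) (hg i) (hS i)) fun v hv => ?_
  have h := eq_zero_of_rank_eq_card (F := Matrix.fromBlocks (F1 μ θ₁) 0 0 (F2 S θ₂))
    (by simpa using hrank) (Sum.elim 0 v) (by
      rw [Matrix.fromBlocks_mulVec]
      simp [hv])
  exact funext fun r => congrFun h (Sum.inr r)

theorem transpose_F1_mulVec_xi1 (r : Fin p₁) :
    ((F1 μ θ₁)ᵀ *ᵥ (H1 g S θ₂ *ᵥ xi1 g μ S θ₁ θ₂)) r
      = ∑ s, ∑ t, (K1 g μ S θ₁ θ₂)⁻¹ s t * ∑ i, -(1 / 2) * (4 * psi (q i) (g i) 2 1 / q i *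
        (locDeriv (μ i) θ₁ r ⬝ᵥ ((S i θ₂)⁻¹ *ᵥ locDeriv2 (μ i) θ₁ s t))) := by
  rw [transpose_F1_mulVec_H1]
  have h : ∀ i, locDeriv (μ i) θ₁ r ⬝ᵥ (Ht1 (g i) (S i θ₂) *ᵥ fun a => xi1 g μ S θ₁ θ₂ ⟨i, a⟩)
      = ∑ s, ∑ t, (K1 g μ S θ₁ θ₂)⁻¹ s t * (-(1 / 2) * (4 * psi (q i) (g i) 2 1 / q i *
        (locDeriv (μ i) θ₁ r ⬝ᵥ ((S i θ₂)⁻¹ *ᵥ locDeriv2 (μ i) θ₁ s t)))) := by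
    intro i
    have e : (fun a => xi1 g μ S θ₁ θ₂ ⟨i, a⟩) = (-(1 / 2) : ℝ) •
      (dotJac (locJac (μ i)) θ₁ *ᵥ ((K1 g μ S θ₁ θ₂)⁻¹).vec) := rfl
    rw [e, Matrix.mulVec_smul, dotProduct_smul, dotProduct_mulVec_mulVec_eq_sum, sum_vec_mul,
      smul_eq_mul, Finset.mul_sum]
    refine Finset.sum_congr rfl fun s _ => ?_
    rw [Finset.mul_sum]
    refine Finset.sum_congr rfl fun t _ => ?_
    rw [Ht1, Matrix.smul_mulVec, dotProduct_smul, smul_eq_mul, mul_left_comm]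
    rfl
  simp only [h]
  rw [Finset.sum_comm]
  refine Finset.sum_congr rfl fun s _ => ?_
  rw [Finset.sum_comm]
  exact Finset.sum_congr rfl fun t _ => (Finset.mul_sum _ _ _).symm

theorem transpose_F2_mulVec_xi2 (hq : ∀ i, 0 < q i) (hg : ∀ i, IsGenerator (q i) (g i))
    (hS : ∀ i, (S i θ₂).PosDef) (hC : ∀ i s, (scaleDeriv (S i) θ₂ s).IsSymm) (r : Fin p₂) :
    ((F2 S θ₂)ᵀ *ᵥ (H2 g S θ₂ *ᵥ xi2 g μ S θ₁ θ₂)) r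
      = (∑ s, ∑ t, (K1 g μ S θ₁ θ₂)⁻¹ s t * ∑ i, 1 / 4 *
          (eta2 (q i) (g i) * (locDeriv (μ i) θ₁ t ⬝ᵥ
            (((S i θ₂)⁻¹ * scaleDeriv (S i) θ₂ r * (S i θ₂)⁻¹) *ᵥ locDeriv (μ i) θ₁ s))
          + 1 / 2 * eta1 (q i) (g i) *
            (locDeriv (μ i) θ₁ t ⬝ᵥ ((S i θ₂)⁻¹ *ᵥ locDeriv (μ i) θ₁ s))
            * ((S i θ₂)⁻¹ * scaleDeriv (S i) θ₂ r).trace))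
        + ∑ s, ∑ t, (K2 g S θ₂)⁻¹ s t * ∑ i, (1 / 4 *
          ((scaleDeriv (S i) θ₂ r).vec ⬝ᵥ (Ht2 (g i) (S i θ₂) *ᵥ (Mstar (g i) (S i θ₂) *ᵥ
            fun k => Qstar (g i) (S i θ₂) (scaleDeriv (S i) θ₂ t) (scaleJac (S i) θ₂) k s)))
          - 1 / 2 * ((scaleDeriv (S i) θ₂ r).vec ⬝ᵥ
            (Ht2 (g i) (S i θ₂) *ᵥ (scaleDeriv2 (S i) θ₂ s t).vec))) := by
  rw [transpose_F2_mulVec_H2]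
  have hswap : ∀ {k : ℕ} (M : Matrix (Fin k) (Fin k) ℝ) (f : Fin n → Fin k → Fin k → ℝ),
      ∑ s, ∑ t, M s t * ∑ i, f i s t = ∑ i, ∑ s, ∑ t, M s t * f i s t := by
    intro k M f
    simp only [Finset.mul_sum]
    exact (Finset.sum_congr rfl fun s _ => Finset.sum_comm).trans Finset.sum_comm
  rw [hswap, hswap, ← Finset.sum_add_distrib]
  refine Finset.sum_congr rfl fun i _ => ?_
  have e : (fun a => xi2 g μ S θ₁ θ₂ ⟨i, a⟩)
    = (1 / 4 : ℝ) • ((Mstar (g i) (S i θ₂) *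
        hcat fun r => Pstar (g i) (S i θ₂) (locDeriv (μ i) θ₁ r) (locJac (μ i) θ₁)) *ᵥ
          ((K1 g μ S θ₁ θ₂)⁻¹).vec) +
      (1 / 4 : ℝ) • ((Mstar (g i) (S i θ₂) *
        (hcat fun s => Qstar (g i) (S i θ₂) (scaleDeriv (S i) θ₂ s) (scaleJac (S i) θ₂)) -
          (2 : ℝ) • dotJac (scaleJac (S i)) θ₂) *ᵥ ((K2 g S θ₂)⁻¹).vec) := rfl
  rw [e, Matrix.mulVec_add, dotProduct_add, Matrix.mulVec_smul, dotProduct_smul,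
    Matrix.mulVec_smul, dotProduct_smul, Matrix.sub_mulVec, Matrix.mulVec_sub, dotProduct_sub,
    Matrix.smul_mulVec, Matrix.mulVec_smul, dotProduct_smul,
    dotProduct_mulVec_mulVec_eq_sum, dotProduct_mulVec_mulVec_eq_sum,
    dotProduct_mulVec_mulVec_eq_sum, sum_vec_mul, sum_vec_mul, sum_vec_mul]
  simp only [smul_eq_mul, Finset.mul_sum, ← Finset.sum_sub_distrib]
  congr 1
  · refine Finset.sum_congr rfl fun s _ => Finset.sum_congr rfl fun t _ => ?_
    rw [← vec_dotProduct_Pstar (hq i) (hg i) (hS i) (hC i r), mul_left_comm]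
    rfl
  · refine Finset.sum_congr rfl fun s _ => Finset.sum_congr rfl fun t _ => ?_
    have e1 : (fun a => (Mstar (g i) (S i θ₂) *
        hcat fun s => Qstar (g i) (S i θ₂) (scaleDeriv (S i) θ₂ s) (scaleJac (S i) θ₂)) a (t, s))
        = Mstar (g i) (S i θ₂) *ᵥ
          fun k => Qstar (g i) (S i θ₂) (scaleDeriv (S i) θ₂ t) (scaleJac (S i) θ₂) k s := rfl
    have e2 : (fun a => dotJac (scaleJac (S i)) θ₂ a (t, s))
      = (scaleDeriv2 (S i) θ₂ s t).vec := rfl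
    rw [e1, e2]
    ring

end SampleSums

/-! ### The bias of the two blocks of parameters -/

section BlockBias

/-- The inverse information is block diagonal as well, so only triples with `r` in the block of `j`
and `s`, `t` in a common block contribute. -/
theorem secondOrderBias_of_fromBlocks {κ₁ κ₂ Y : Type*} [Fintype κ₁] [DecidableEq κ₁]
    [Fintype κ₂] [DecidableEq κ₂] [MeasureSpace Y] {f l : (κ₁ ⊕ κ₂ → ℝ) → Y → ℝ}
    {θ : κ₁ ⊕ κ₂ → ℝ} {A : Matrix κ₁ κ₁ ℝ} {B : Matrix κ₂ κ₂ ℝ} (hA : IsUnit A.det)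
    (hB : IsUnit B.det) (hK : fisherInfo f l θ = Matrix.fromBlocks A 0 0 B)
    {β : κ₁ ⊕ κ₂ → κ₁ ⊕ κ₂ → κ₁ ⊕ κ₂ → ℝ}
    (hβ : ∀ r s t, 1 / 2 * kappaThree f l θ r s t + kappaTwoOne f l θ r s t = β r s t) :
    (∀ j, secondOrderBias f l θ (Sum.inl j) = (A⁻¹ *ᵥ fun r =>
      (∑ s, ∑ t, A⁻¹ s t * β (Sum.inl r) (Sum.inl s) (Sum.inl t))
        + ∑ s, ∑ t, B⁻¹ s t * β (Sum.inl r) (Sum.inr s) (Sum.inr t)) j) ∧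
    (∀ j, secondOrderBias f l θ (Sum.inr j) = (B⁻¹ *ᵥ fun r =>
      (∑ s, ∑ t, A⁻¹ s t * β (Sum.inr r) (Sum.inl s) (Sum.inl t))
        + ∑ s, ∑ t, B⁻¹ s t * β (Sum.inr r) (Sum.inr s) (Sum.inr t)) j) := by
  have hinv : (fisherInfo f l θ)⁻¹ = Matrix.fromBlocks A⁻¹ 0 0 B⁻¹ := by
    rw [hK]
    refine Matrix.inv_eq_left_inv ?_
    rw [Matrix.fromBlocks_multiply]
    simp [Matrix.nonsing_inv_mul _ hA, Matrix.nonsing_inv_mul _ hB]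
  constructor <;> intro j <;>
    simp only [secondOrderBias, hinv, hβ, Fintype.sum_sum_type, Matrix.fromBlocks_apply₁₁,
      Matrix.fromBlocks_apply₁₂, Matrix.fromBlocks_apply₂₁, Matrix.fromBlocks_apply₂₂,
      Matrix.zero_apply, mul_zero, zero_mul, Finset.sum_const_zero, add_zero, zero_add,
      Matrix.mulVec, dotProduct, mul_add, Finset.mul_sum, Finset.sum_add_distrib, mul_assoc]

/-- A trilinear identity between the scale contributions of one observation, with
`A r = Σ⁻¹ C_r` and `D r s = Σ⁻¹ ∂²Σ/∂θ_r∂θ_s`. -/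
theorem scale_bias_identity {q p : ℕ} (A : Fin p → Matrix (Fin q) (Fin q) ℝ)
    (D : Fin p → Fin p → Matrix (Fin q) (Fin q) ℝ)
    (hA : ∀ r s t, (A r * A s * A t).trace = (A t * A s * A r).trace)
    (hD : ∀ r s, D r s = D s r) (c ω : ℝ) {dK F F' : Fin p → Fin p → Fin p → ℝ}
    (hdK : ∀ r s t, dK r s t = c / 2 *
      (((-(A t) * A r + D r t) * A s).trace + (A r * (-(A t) * A s + D s t)).trace)
      + (c - 1) / 4 * ((-(A t) * A r + D r t).trace * (A s).trace
        + (A r).trace * (-(A t) * A s + D s t).trace))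
    (hF : ∀ r s t, F r s t = 1 / 4 * (dK s t r + dK r t s - 3 * dK r s t
      - -((ω + 3 / 8 * c - 1 / 4) * ((A r).trace * (A s).trace * (A t).trace)
        + (c / 4 + 2 * ω) * ((A r).trace * (A s * A t).trace + (A s).trace * (A r * A t).trace
          + (A t).trace * (A r * A s).trace) + 8 * ω * (A r * A s * A t).trace)))
    (hF' : ∀ r s t, F' r s t = 1 / 4 * (1 / 2 * ((c - 1) * ((A t * A s).trace * (A r).trace
          + 1 / 2 * ((A t).trace * (A s).trace * (A r).trace))
        + 1 / 2 * (c + 8 * ω) * ((A s).trace * (A r * A t).trace + (A r).trace * (A t * A s).trace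
          + 4 * (A r * A t * A s).trace + (A t).trace * (A r * A s).trace
          + 1 / 2 * ((A t).trace * (A s).trace * (A r).trace))))
      - 1 / 2 * (c / 2 * (A r * D s t).trace + (c - 1) / 4 * ((A r).trace * (D s t).trace)))
    (r s t : Fin p) : F r s t + F r t s = F' r s t + F' r t s := by
  -- Cyclicity together with the reversal `hA` identifies all six traces of products of three
  -- matrices; they are normalized to the order `r s t`.
  have hcyc : ∀ r s t, (A r * A s * A t).trace = (A t * A r * A s).trace := fun r s t =>
    Matrix.trace_mul_cycle _ _ _
  have b1 : (A t * A s).trace = (A s * A t).trace := Matrix.trace_mul_comm _ _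
  have b2 : (A s * A r).trace = (A r * A s).trace := Matrix.trace_mul_comm _ _
  have b3 : (A t * A r).trace = (A r * A t).trace := Matrix.trace_mul_comm _ _
  have t1 : (A t * A r * A s).trace = (A r * A s * A t).trace := (hcyc r s t).symm
  have t2 : (A s * A t * A r).trace = (A r * A s * A t).trace := hcyc s t r
  have t4 : (A r * A t * A s).trace = (A r * A s * A t).trace := (hA r t s).trans t2
  have t5 : (A s * A r * A t).trace = (A r * A s * A t).trace := (hA s r t).trans t1
  have d1 : ∀ x y z, (D x y * A z).trace = (A z * D x y).trace := fun _ _ _ =>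
    Matrix.trace_mul_comm _ _
  rw [hF, hF, hF', hF', hdK, hdK, hdK, hdK, hD t s, hD s r, hD t r]
  simp only [Matrix.add_mul, Matrix.mul_add, Matrix.neg_mul, Matrix.mul_neg, Matrix.trace_add,
    Matrix.trace_neg, ← Matrix.mul_assoc, d1, b1, b2, b3, t1, t4, t5]
  ring

/-- Transposition reverses the product of symmetric factors, and one cyclic move restores the
position of `S⁻¹`. -/
theorem trace_mul_mul_reverse {q : ℕ} {S X Y Z : Matrix (Fin q) (Fin q) ℝ} (hS : S.PosDef)
    (hX : X.IsSymm) (hY : Y.IsSymm) (hZ : Z.IsSymm) :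
    (S⁻¹ * X * (S⁻¹ * Y) * (S⁻¹ * Z)).trace = (S⁻¹ * Z * (S⁻¹ * Y) * (S⁻¹ * X)).trace := by
  rw [← Matrix.trace_transpose]
  simp only [Matrix.transpose_mul, hX.eq, hY.eq, hZ.eq, (isSymm_of_posDef hS.inv).eq]
  simp only [Matrix.mul_assoc]
  rw [Matrix.trace_mul_comm S⁻¹]
  simp only [Matrix.mul_assoc]

theorem dotProduct_inv_mulVec_comm {q : ℕ} {S : Matrix (Fin q) (Fin q) ℝ} (hS : S.PosDef)
    (a b : Fin q → ℝ) : a ⬝ᵥ (S⁻¹ *ᵥ b) = b ⬝ᵥ (S⁻¹ *ᵥ a) := by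
  rw [dotProduct_inv_mulVec hS, dotProduct_comm]

variable {n p₁ p₂ : ℕ} {q : Fin n → ℕ}

/-- The derivative of the `(r, s)` entry of the Fisher information in the direction of the `t`-th
parameter. -/
def infoDeriv (g : Fin n → ℝ → ℝ) (μ : ∀ i, (Fin p₁ → ℝ) → Fin (q i) → ℝ)
    (S : ∀ i, (Fin p₂ → ℝ) → Matrix (Fin (q i)) (Fin (q i)) ℝ)
    (θ₁ : Fin p₁ → ℝ) (θ₂ : Fin p₂ → ℝ) :
    Fin p₁ ⊕ Fin p₂ → Fin p₁ ⊕ Fin p₂ → Fin p₁ ⊕ Fin p₂ → ℝ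
  | Sum.inl r, Sum.inl s, Sum.inl t => ∑ i, 4 * psi (q i) (g i) 2 1 / q i *
        (locDeriv2 (μ i) θ₁ r t ⬝ᵥ ((S i θ₂)⁻¹ *ᵥ locDeriv (μ i) θ₁ s)
          + locDeriv (μ i) θ₁ r ⬝ᵥ ((S i θ₂)⁻¹ *ᵥ locDeriv2 (μ i) θ₁ s t))
  | Sum.inl r, Sum.inl s, Sum.inr t => ∑ i, 4 * psi (q i) (g i) 2 1 / q i *
        -(locDeriv (μ i) θ₁ r ⬝ᵥ (((S i θ₂)⁻¹ * scaleDeriv (S i) θ₂ t * (S i θ₂)⁻¹)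
          *ᵥ locDeriv (μ i) θ₁ s))
  | Sum.inr r, Sum.inr s, Sum.inr t => ∑ i, (cC (q i) (g i) / 2 *
        (((-((S i θ₂)⁻¹ * scaleDeriv (S i) θ₂ t) * ((S i θ₂)⁻¹ * scaleDeriv (S i) θ₂ r)
            + (S i θ₂)⁻¹ * scaleDeriv2 (S i) θ₂ r t) * ((S i θ₂)⁻¹ * scaleDeriv (S i) θ₂ s)).trace
          + (((S i θ₂)⁻¹ * scaleDeriv (S i) θ₂ r) *
            (-((S i θ₂)⁻¹ * scaleDeriv (S i) θ₂ t) * ((S i θ₂)⁻¹ * scaleDeriv (S i) θ₂ s)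
            + (S i θ₂)⁻¹ * scaleDeriv2 (S i) θ₂ s t)).trace)
        + (cC (q i) (g i) - 1) / 4 *
          ((-((S i θ₂)⁻¹ * scaleDeriv (S i) θ₂ t) * ((S i θ₂)⁻¹ * scaleDeriv (S i) θ₂ r)
            + (S i θ₂)⁻¹ * scaleDeriv2 (S i) θ₂ r t).trace
              * ((S i θ₂)⁻¹ * scaleDeriv (S i) θ₂ s).trace
          + ((S i θ₂)⁻¹ * scaleDeriv (S i) θ₂ r).trace
            * (-((S i θ₂)⁻¹ * scaleDeriv (S i) θ₂ t) * ((S i θ₂)⁻¹ * scaleDeriv (S i) θ₂ s)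
            + (S i θ₂)⁻¹ * scaleDeriv2 (S i) θ₂ s t).trace))
  | _, _, _ => 0

variable {g : Fin n → ℝ → ℝ} {μ : ∀ i, (Fin p₁ → ℝ) → Fin (q i) → ℝ}
  {S : ∀ i, (Fin p₂ → ℝ) → Matrix (Fin (q i)) (Fin (q i)) ℝ}
  {θ₁ : Fin p₁ → ℝ} {θ₂ : Fin p₂ → ℝ}

/-- Near the parameter point the information coincides with its explicit formula, which is then
differentiated. The off-diagonal blocks vanish on the whole neighbourhood, and the scale block does
not involve `θ₁`. -/
theorem hasDerivAt_fisherInfo (hq : ∀ i, 0 < q i) (hg : ∀ i, IsGenerator (q i) (g i))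
    (hμ2 : ∀ i a, DifferentiableAt ℝ (fderiv ℝ fun t => μ i t a) θ₁)
    (hS : ∀ i, (S i θ₂).PosDef)
    (hSd : ∀ i a b, DifferentiableAt ℝ (fun t => S i t a b) θ₂)
    (hSd2 : ∀ i a b, DifferentiableAt ℝ (fderiv ℝ fun t => S i t a b) θ₂)
    {N : Set (Fin p₁ ⊕ Fin p₂ → ℝ)} (hN : IsOpen N) (hθN : Sum.elim θ₁ θ₂ ∈ N)
    (hex : ∀ τ ∈ N, HasExplicitScore g μ S τ) (r s t : Fin p₁ ⊕ Fin p₂) :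
    HasDerivAt (fun x : ℝ => fisherInfo (modelDensity g μ S) (modelLogLik g μ S)
      (Sum.elim θ₁ θ₂ + x • Pi.single t (1 : ℝ)) r s) (infoDeriv g μ S θ₁ θ₂ r s t) 0 := by
  have hmem := eventually_line_mem hN hθN (Pi.single t (1 : ℝ))
  match r, s, t, hmem with
  | Sum.inl r, Sum.inl s, Sum.inl t, hmem =>
    refine (hasDerivAt_locInfo_loc hμ2 r s t).congr_of_eventuallyEq ?_
    filter_upwards [hmem] with x hx
    rw [fisherInfo_inl_inl hq hg (hex _ hx), (inl_line _ t x).1, (inl_line _ t x).2]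
    rfl
  | Sum.inl r, Sum.inl s, Sum.inr t, hmem =>
    refine (hasDerivAt_locInfo_scale hS hSd r s t).congr_of_eventuallyEq ?_
    filter_upwards [hmem] with x hx
    rw [fisherInfo_inl_inl hq hg (hex _ hx), (inr_line _ t x).1, (inr_line _ t x).2]
    rfl
  | Sum.inr r, Sum.inr s, Sum.inr t, hmem =>
    refine (hasDerivAt_scaleInfo hS hSd hSd2 r s t).congr_of_eventuallyEq ?_
    filter_upwards [hmem] with x hx
    rw [fisherInfo_inr_inr hq hg (hex _ hx), (inr_line _ t x).2]
    rfl
  | Sum.inr r, Sum.inr s, Sum.inl t, hmem =>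
    refine (hasDerivAt_const 0 (scaleInfo g S θ₂ r s)).congr_of_eventuallyEq ?_
    filter_upwards [hmem] with x hx
    rw [fisherInfo_inr_inr hq hg (hex _ hx), (inl_line _ t x).2]
    rfl
  | Sum.inl r, Sum.inr s, t, hmem =>
    have h0 : infoDeriv g μ S θ₁ θ₂ (Sum.inl r) (Sum.inr s) t = 0 := by cases t <;> rfl
    rw [h0]
    refine (hasDerivAt_const 0 (0 : ℝ)).congr_of_eventuallyEq ?_
    filter_upwards [hmem] with x hx
    exact fisherInfo_inl_inr (hex _ hx) r s
  | Sum.inr r, Sum.inl s, t, hmem =>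
    have h0 : infoDeriv g μ S θ₁ θ₂ (Sum.inr r) (Sum.inl s) t = 0 := by cases t <;> rfl
    rw [h0]
    refine (hasDerivAt_const 0 (0 : ℝ)).congr_of_eventuallyEq ?_
    filter_upwards [hmem] with x hx
    exact fisherInfo_inr_inl (hex _ hx) s r

theorem inv_isSymm {k : Type*} [Fintype k] [DecidableEq k] {A : Matrix k k ℝ} (hA : A.IsSymm) :
    (A⁻¹).IsSymm := by
  rw [Matrix.IsSymm, Matrix.transpose_nonsing_inv, hA.eq]

theorem K1_isSymm (hS : ∀ i, (S i θ₂).PosDef) : (K1 g μ S θ₁ θ₂).IsSymm := by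
  ext r s
  rw [Matrix.transpose_apply, K1_apply, K1_apply]
  exact Finset.sum_congr rfl fun i _ => by rw [dotProduct_inv_mulVec_comm (hS i)]

theorem K2_isSymm (hS : ∀ i, (S i θ₂).PosDef) (hC : ∀ i s, (scaleDeriv (S i) θ₂ s).IsSymm) :
    (K2 g S θ₂).IsSymm := by
  ext r s
  rw [Matrix.transpose_apply, K2_apply hS hC, K2_apply hS hC]
  refine Finset.sum_congr rfl fun i _ => ?_
  rw [Matrix.trace_mul_comm, mul_comm ((S i θ₂)⁻¹ * scaleDeriv (S i) θ₂ s).trace]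

/-- Write `[rs, t]` for the weighted inner product of `∂_r ∂_s μ` with `∂_t μ`. The summand is
`([rs, t] - [rt, s] - [st, r])/2`; the first two terms cancel under symmetrization in `s, t`,
leaving `-[st, r]/2`. -/
theorem sum_loc_eq_transpose_F1_mulVec_xi1 (hS : ∀ i, (S i θ₂).PosDef)
    (h2 : ∀ i r s, locDeriv2 (μ i) θ₁ r s = locDeriv2 (μ i) θ₁ s r) (r : Fin p₁) :
    ∑ s, ∑ t, (K1 g μ S θ₁ θ₂)⁻¹ s t * (1 / 4 *
      (infoDeriv g μ S θ₁ θ₂ (Sum.inl s) (Sum.inl t) (Sum.inl r)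
      + infoDeriv g μ S θ₁ θ₂ (Sum.inl r) (Sum.inl t) (Sum.inl s)
      - 3 * infoDeriv g μ S θ₁ θ₂ (Sum.inl r) (Sum.inl s) (Sum.inl t) - 0))
      = ((F1 μ θ₁)ᵀ *ᵥ (H1 g S θ₂ *ᵥ xi1 g μ S θ₁ θ₂)) r := by
  rw [transpose_F1_mulVec_xi1]
  refine sum_mul_congr_of_isSymm (inv_isSymm (K1_isSymm hS)) fun s t => ?_
  simp only [infoDeriv, sub_zero, Finset.mul_sum, ← Finset.sum_add_distrib,
    ← Finset.sum_sub_distrib]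
  refine Finset.sum_congr rfl fun i _ => ?_
  rw [h2 i t s, h2 i s r, h2 i t r, dotProduct_inv_mulVec_comm (hS i) (locDeriv (μ i) θ₁ s),
    dotProduct_inv_mulVec_comm (hS i) (locDeriv (μ i) θ₁ t),
    dotProduct_inv_mulVec_comm (hS i) (locDeriv (μ i) θ₁ r)]
  ring

theorem sum_scale_eq_transpose_F2_mulVec_xi2 (hq : ∀ i, 0 < q i)
    (hg : ∀ i, IsGenerator (q i) (g i)) (hS : ∀ i, (S i θ₂).PosDef)
    (hC : ∀ i s, (scaleDeriv (S i) θ₂ s).IsSymm)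
    (h2 : ∀ i r s, scaleDeriv2 (S i) θ₂ r s = scaleDeriv2 (S i) θ₂ s r)
    (hex : HasExplicitScore g μ S (Sum.elim θ₁ θ₂)) (r : Fin p₂) :
    (∑ s, ∑ t, (K1 g μ S θ₁ θ₂)⁻¹ s t * (1 / 4 *
      (infoDeriv g μ S θ₁ θ₂ (Sum.inl s) (Sum.inl t) (Sum.inr r)
      + infoDeriv g μ S θ₁ θ₂ (Sum.inr r) (Sum.inl t) (Sum.inl s)
      - 3 * infoDeriv g μ S θ₁ θ₂ (Sum.inr r) (Sum.inl s) (Sum.inl t)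
      - scoreMoment3 (modelDensity g μ S) (modelLogLik g μ S) (Sum.elim θ₁ θ₂)
        (Sum.inr r) (Sum.inl s) (Sum.inl t))))
    + (∑ s, ∑ t, (K2 g S θ₂)⁻¹ s t * (1 / 4 *
      (infoDeriv g μ S θ₁ θ₂ (Sum.inr s) (Sum.inr t) (Sum.inr r)
      + infoDeriv g μ S θ₁ θ₂ (Sum.inr r) (Sum.inr t) (Sum.inr s)
      - 3 * infoDeriv g μ S θ₁ θ₂ (Sum.inr r) (Sum.inr s) (Sum.inr t)
      - scoreMoment3 (modelDensity g μ S) (modelLogLik g μ S) (Sum.elim θ₁ θ₂)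
        (Sum.inr r) (Sum.inr s) (Sum.inr t))))
      = ((F2 S θ₂)ᵀ *ᵥ (H2 g S θ₂ *ᵥ xi2 g μ S θ₁ θ₂)) r := by
  rw [transpose_F2_mulVec_xi2 hq hg hS hC]
  congr 1
  · refine sum_mul_congr_of_isSymm (inv_isSymm (K1_isSymm hS)) fun s t => ?_
    simp only [scoreMoment3_inr_inl_inl hq hg hex, Sum.elim_comp_inl, Sum.elim_comp_inr,
      infoDeriv, mul_zero, sub_zero, add_zero, Finset.mul_sum, ← Finset.sum_add_distrib,
      ← Finset.sum_sub_distrib]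
    refine Finset.sum_congr rfl fun i _ => ?_
    -- The term `-4 ψ_{(2,1)}/q` from the derivative of the location information joins `c*` from the
    -- third moment to form `η₂`.
    rw [eta2]
    ring
  · refine sum_mul_congr_of_isSymm (inv_isSymm (K2_isSymm hS hC)) fun s t => ?_
    simp only [scoreMoment3_inr_inr_inr hq hg hex, Sum.elim_comp_inr,
      infoDeriv, Finset.mul_sum, ← Finset.sum_add_distrib, ← Finset.sum_sub_distrib]
    refine Finset.sum_congr rfl fun i _ => ?_
    rw [vec_dotProduct_Qstar (hq i) (hg i) (hS i) (hC i r) (hC i t),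
      vec_dotProduct_Qstar (hq i) (hg i) (hS i) (hC i r) (hC i s),
      vec_dotProduct_Ht2_mulVec_vec (hS i) (hC i r), vec_dotProduct_Ht2_mulVec_vec (hS i) (hC i r)]
    exact scale_bias_identity (fun r => (S i θ₂)⁻¹ * scaleDeriv (S i) θ₂ r)
      (fun r s => (S i θ₂)⁻¹ * scaleDeriv2 (S i) θ₂ r s)
      (fun r s t => trace_mul_mul_reverse (hS i) (hC i r) (hC i s) (hC i t))
      (fun r s => by rw [h2]) (cC (q i) (g i)) (omegaT (q i) (g i))
      (fun _ _ _ => rfl) (fun _ _ _ => rfl) (fun _ _ _ => rfl) r s t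

end BlockBias

end EllipticalBias

end

/-! ### The bias formulas for location and scale parameters. -/

open EllipticalBias in
theorem corollary3p1 {n p₁ p₂ : ℕ} (q : Fin n → ℕ) (hq : ∀ i, 0 < q i)
    (g : Fin n → ℝ → ℝ) (hg : ∀ i, EllipticalBias.IsGenerator (q i) (g i))
    (Θ₁ : Set (Fin p₁ → ℝ)) (Θ₂ : Set (Fin p₂ → ℝ)) (hΘ₁ : IsOpen Θ₁) (hΘ₂ : IsOpen Θ₂)
    (μ : ∀ i, (Fin p₁ → ℝ) → Fin (q i) → ℝ)
    (S : ∀ i, (Fin p₂ → ℝ) → Matrix (Fin (q i)) (Fin (q i)) ℝ)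
    (hμ : ∀ i a, EllipticalBias.TwiceDifferentiableOn (fun t => μ i t a) Θ₁)
    (hS : ∀ i a b, EllipticalBias.TwiceDifferentiableOn (fun t => S i t a b) Θ₂)
    (hSpos : ∀ i, ∀ t ∈ Θ₂, (S i t).PosDef)
    (θ₁ : Fin p₁ → ℝ) (θ₂ : Fin p₂ → ℝ) (hθ₁ : θ₁ ∈ Θ₁) (hθ₂ : θ₂ ∈ Θ₂)
    (hreg : EllipticalBias.IsRegularAt
      (EllipticalBias.jointDensity g (fun i t => μ i (t ∘ Sum.inl)) (fun i t => S i (t ∘ Sum.inr)))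
      (EllipticalBias.logLik g (fun i t => μ i (t ∘ Sum.inl)) (fun i t => S i (t ∘ Sum.inr)))
      (Sum.elim θ₁ θ₂))
    (hrank : (Matrix.fromBlocks (EllipticalBias.F1 μ θ₁) 0 0 (EllipticalBias.F2 S θ₂)).rank
      = p₁ + p₂) :
    IsUnit (EllipticalBias.K1 g μ S θ₁ θ₂).det ∧
    IsUnit (EllipticalBias.K2 g S θ₂).det ∧
    (fun r => EllipticalBias.modelBias g μ S (Sum.elim θ₁ θ₂) (Sum.inl r)) =
      ((EllipticalBias.K1 g μ S θ₁ θ₂)⁻¹ * (EllipticalBias.F1 μ θ₁)ᵀ *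
        EllipticalBias.H1 g S θ₂) *ᵥ EllipticalBias.xi1 g μ S θ₁ θ₂ ∧
    (fun s => EllipticalBias.modelBias g μ S (Sum.elim θ₁ θ₂) (Sum.inr s)) =
      ((EllipticalBias.K2 g S θ₂)⁻¹ * (EllipticalBias.F2 S θ₂)ᵀ *
        EllipticalBias.H2 g S θ₂) *ᵥ EllipticalBias.xi2 g μ S θ₁ θ₂ := by
  have hSθ : ∀ i, (S i θ₂).PosDef := fun i => hSpos i θ₂ hθ₂
  have hK1 := isUnit_det_K1 (g := g) (μ := μ) hq hg hSθ hrank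
  have hK2 := isUnit_det_K2 (g := g) (S := S) hq hg hSθ hrank
  obtain ⟨N, hN, hθN, hex⟩ := exists_nhds_hasExplicitScore (θ := Sum.elim θ₁ θ₂) hq hg hΘ₁ hΘ₂ hμ
    hS hSpos hθ₁ hθ₂ hreg
  have hex0 := hex _ hθN
  have hC : ∀ i s, (scaleDeriv (S i) θ₂ s).IsSymm := fun i s =>
    scaleDeriv_isSymm hΘ₂ (hSpos i) hθ₂ s
  have hinfo : fisherInfo (modelDensity g μ S) (modelLogLik g μ S) (Sum.elim θ₁ θ₂)
      = Matrix.fromBlocks (K1 g μ S θ₁ θ₂) 0 0 (K2 g S θ₂) := by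
    ext r s
    rcases r with r | r <;> rcases s with s | s
    · rw [fisherInfo_inl_inl hq hg hex0, Matrix.fromBlocks_apply₁₁, K1_apply]
      rfl
    · exact fisherInfo_inl_inr hex0 r s
    · exact fisherInfo_inr_inl hex0 s r
    · rw [fisherInfo_inr_inr hq hg hex0, Matrix.fromBlocks_apply₂₂, K2_apply hSθ hC]
      rfl
  have hβ := half_kappaThree_add_kappaTwoOne hreg hN hθN
    (fun τ hτ y => jointDensity_eq_exp (μ := fun i t => μ i (t ∘ Sum.inl))
      (S := fun i t => S i (t ∘ Sum.inr)) hg (hex τ hτ).posDef y)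
    (fun τ hτ => aestronglyMeasurable_logLik (μ := fun i t => μ i (t ∘ Sum.inl))
      (S := fun i t => S i (t ∘ Sum.inr)) hg (hex τ hτ).posDef)
    (fun τ hτ => integral_jointDensity (μ := fun i t => μ i (t ∘ Sum.inl))
      (S := fun i t => S i (t ∘ Sum.inr)) hg (hex τ hτ).posDef)
    (hasDerivAt_fisherInfo hq hg
      (fun i a => (hμ i a).2.differentiableAt (hΘ₁.mem_nhds hθ₁)) hSθ
      (fun i a b => (hS i a b).1.differentiableAt (hΘ₂.mem_nhds hθ₂))
      (fun i a b => (hS i a b).2.differentiableAt (hΘ₂.mem_nhds hθ₂)) hN hθN hex)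
  obtain ⟨hb1, hb2⟩ := secondOrderBias_of_fromBlocks hK1 hK2 hinfo hβ
  refine ⟨hK1, hK2, funext fun r => ?_, funext fun r => ?_⟩
  · rw [modelBias, hb1 r, ← Matrix.mulVec_mulVec, ← Matrix.mulVec_mulVec]
    congr 2
    funext r
    rw [← sum_loc_eq_transpose_F1_mulVec_xi1 hSθ
      (fun i => locDeriv2_comm hΘ₁ (hμ i) hθ₁) r]
    -- For a location parameter the sum over pairs of scale indices vanishes: every information
    -- derivative in it is zero, and the third moment is odd. This is why `ξ₁` contains no `K₂⁻¹`.
    simp only [scoreMoment3_inl_inl_inl hex0, scoreMoment3_inl_inr_inr hex0]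
    simp [infoDeriv]
  · rw [modelBias, hb2 r, ← Matrix.mulVec_mulVec, ← Matrix.mulVec_mulVec]
    congr 2
    funext r
    exact sum_scale_eq_transpose_F2_mulVec_xi2 hq hg hSθ hC
      (fun i => scaleDeriv2_comm hΘ₂ (hS i) hθ₂) hex0 r
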